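/- \textbf{Setting.} Let $D=[0,1]^2$, $N,L\ge 1$. For $k=1,\dots,L$ let $\mathcal I_U^k$ be the nodes (boundary included) of the uniform grid with $N2^{k-1}$ cells per side, each cell being cut into two triangles along the diagonal of direction $(1,1)$, let $\varphi_i^k$ be the nodal hat functions and $U^k=\mathrm{span}\{\varphi^k_i: i\in\mathcal I_U^k\}$. Fix arbitrary sets $\mathcal I_V^k\subset\mathcal I_U^k$ of interior nodes (local refinement), and put $V^k=\mathrm{span}\{\varphi_i^k:i\in\mathcal I_V^k\}$ and $\operatorname{supp}V^k=\bigcup_{i\in\mathcal I_V^k}\operatorname{supp}\varphi_i^k$. Let $\Gamma\subset\mathbb R^{\mathbb N}$ and let $\kappa:D\times\Gamma\to\mathbb R$ satisfy $\kappa_{\min}\le\kappa(x,\mathbf y)\le\kappa_{\max}$ with constants $\kappa_{\min},\kappa_{\max}>0$. Let $\kappa_h(\cdot,\mathbf y)\in U^L$ be the nodal interpolant of $\kappa(\cdot,\mathbf y)$ and ${\boldsymbol\kappa_{\mathbf y}}_{\mathrm{img}}\in\mathbb R^{\mathcal I_U^L}$ its image of nodal values. The matrix $A_{\mathbf y}$,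 indexed by all pairs $(k,i)$ with $i\in\mathcal I_V^k$, has the entries $\int_D\kappa_h(\cdot,\mathbf y)\langle\nabla\varphi^k_i,\nabla\varphi^\ell_j\rangle\,dx$. For $f\in U^L$ let $\mathbf f=(\int_D f\varphi_i^k\,dx)_{(k,i)}$ and $\mathbf f_{\mathrm{img}}=(\int_D f\varphi_i^L\,dx)_{i\in\mathcal I_U^L}$. Write $\|\mathbf v\|_{A_{\mathbf y}}=(\mathbf v^\top A_{\mathbf y}\mathbf v)^{1/2}$. \textbf{Multigrid iteration.} Let $\bar{\mathcal I}^k$ consist of $\mathcal I_V^k$ and all $i\in\mathcal I_U^k$ with $\operatorname{supp}\varphi_i^k\cap\operatorname{supp}V^k\ne\emptyset$, let $P_k:\mathbb R^{\bar{\mathcal I}^k}\to\mathbb R^{\bar{\mathcal I}^{k+1}}$ be nodal interpolation and let $\bar A^k$ be the matrix of the same bilinear form with rows in $\mathcal I_V^k$ and columns in $\bar{\mathcal I}^k$. Vectors on $\mathcal I_V^k$ are extended by zero to $\bar{\mathcal I}^k$ where needed. One run of $\mathrm{LLMG}(\mathbf u,\mathbf f,\mathbf y)$ with damping $\omega$ first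 computes $\tilde{\mathbf u}^1=0$, $\tilde{\mathbf u}^{k+1}=P_k(\tilde{\mathbf u}^k+\mathbf u^k)$ and $\bar{\mathbf u}^L=0$, $\bar{\mathbf u}^{k}=P_k^\top(\bar{\mathbf u}^{k+1}+(\bar A^{k+1})^\top\mathbf u^{k+1})$. Then for $k=L,\dots,1$ it performs $\mathbf u^k\leftarrow\mathbf u^k+\omega(\mathbf f^k-[\bar A^k(\mathbf u^k+\tilde{\mathbf u}^k)+\bar{\mathbf u}^k|_{\mathcal I_V^k}])$ followed, if $k>1$, by $\bar{\mathbf u}^{k-1}\leftarrow P_{k-1}^\top(\bar{\mathbf u}^k+(\bar A^k)^\top\mathbf u^k)$. Finally for $k=1,\dots,L$ it performs the same update of $\mathbf u^k$ followed, if $k<L$, by $\tilde{\mathbf u}^{k+1}\leftarrow P_k(\tilde{\mathbf u}^k+\mathbf u^k)$. $\mathrm{LLMG}^m(0,\mathbf f,\mathbf y)$ is the result of $m$ runs started from $0$. \textbf{Networks.} A CNN with activation function $\sigma$ is a finite sequence of layers. Each layer adds a multi-channel feature map on one of the $L$ grids, namely a sum of zero-padded convolutions of earlier feature maps (vanilla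 on the same grid, $2$-strided from the next finer grid, $2$-transpose strided from the next coarser grid) plus one bias per channel, optionally followed by $\sigma$. Layers may be submanifold sparse, i.e. applied only at the active nodes $\mathcal I_V^k$ of their grid and zero elsewhere. The output on grid $k$ is one channel of one of the feature maps, restricted to $\mathcal I_V^k$. $M(\Psi)$ is the total number of kernel entries and biases (the sets $\mathcal I_V^k$ are not counted). \textbf{Statement.} Let $\sigma\in L^\infty_{\mathrm{loc}}(\mathbb R)$ be three times continuously differentiable near some $x_0$ with $\sigma''(x_0)\ne0$. There is a constant $C>0$, depending only on $\sigma$, such that for all $\mathfrak c,\mathfrak C>0$ and $0<\omega\le\mathfrak C^{-1}$ there is a constant $c>0$ such that, with $c_L=\frac{cL}{1+cL}$, the following holds for all $N,L,\mathcal I_V^k,\Gamma,\kappa$ as above for which all nonzero eigenvalues of $A_{\mathbf y}$, $\mathbf y\in\Gamma$, lie in $[\mathfrak c,\mathfrak C]$. (i) If $\operatorname{supp}V^{k+1}\subset\operatorname{supp}V^k$ for all $k<L$, then $\|\mathbf u-\mathrm{LLMG}^m(0,\mathbf f,\mathbf y)\|_{A_{\mathbf y}}\le\varepsilon\|\mathbf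 u\|_{A_{\mathbf y}}$ for all $\varepsilon>0$, $m\in\mathbb N$ with $m\ge\log(\varepsilon^{-1})/\log(c_L^{-1})$, $\mathbf y\in\Gamma$, $f\in U^L$ and $\mathbf u$ with $A_{\mathbf y}\mathbf u=\mathbf f$. (ii) For all $0<\varepsilon\le\frac12$, $M>0$ and $m\in\mathbb N$ with $m\ge\log(\varepsilon^{-1})/\log(c_L^{-1})$ there is a CNN $\Psi:\mathbb R^{2\times\mathcal I_U^L}\to\mathbb R^{\bigtimes_{k=1}^L\mathcal I_V^k}$ with \[M(\Psi)\le C\,L\,\frac{\log(\varepsilon^{-1})}{\log(c_L^{-1})}\] such that for all $\mathbf y\in\Gamma$, all $f\in U^L$ with $\|\mathbf f_{\mathrm{img}}\|_{\ell^\infty}\le M$ and all $\mathbf u$ with $A_{\mathbf y}\mathbf u=\mathbf f$, \[\|\Psi({\boldsymbol\kappa_{\mathbf y}}_{\mathrm{img}},\mathbf f_{\mathrm{img}})-\mathbf u\|_{A_{\mathbf y}}\le\varepsilon\,(1+\|\mathbf u\|_{A_{\mathbf y}}),\] and if $\operatorname{supp}V^{k+1}\subset\operatorname{supp}V^k$ for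 all $k<L$, then moreover \[\|\Psi({\boldsymbol\kappa_{\mathbf y}}_{\mathrm{img}},\mathbf f_{\mathrm{img}})-\mathbf u\|_{A_{\mathbf y}}\le\|\Psi({\boldsymbol\kappa_{\mathbf y}}_{\mathrm{img}},\mathbf f_{\mathrm{img}})-\mathrm{LLMG}^m(0,\mathbf f,\mathbf y)\|_{A_{\mathbf y}}+\|\mathrm{LLMG}^m(0,\mathbf f,\mathbf y)-\mathbf u\|_{A_{\mathbf y}}\le\varepsilon\,(1+\|\mathbf u\|_{A_{\mathbf y}}).\] -/

import Mathlib

open Set MeasureTheory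

noncomputable section

namespace LocalMG

/-! ### Uniform grids on the unit square and piecewise linear functions -/

/-- The physical space `ℝ²`. -/
abbrev Plane := EuclideanSpace ℝ (Fin 2)

/-- The closed unit square `D = [0,1]²`. -/
def unitSquare : Set Plane := {x | ∀ j, x j ∈ Icc (0 : ℝ) 1}

/-- Index set of all nodes (boundary nodes included) of the uniform grid with `N * 2 ^ ℓ` cells per
side. Levels are counted from `0`: level `0` is the coarsest grid, with `N` cells per side, and
level `L - 1` is the finest of `L` grids. -/
abbrev Node (N ℓ : ℕ) := Fin (N * 2 ^ ℓ + 1) × Fin (N * 2 ^ ℓ + 1)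

/-- Side length of a grid cell on level `ℓ`. -/
def meshWidth (N ℓ : ℕ) : ℝ := 1 / ((N : ℝ) * 2 ^ ℓ)

/-- Position of a node in the unit square. -/
def nodePos {N ℓ : ℕ} (i : Node N ℓ) : Plane :=
  !₂[((i.1 : ℕ) : ℝ) * meshWidth N ℓ, ((i.2 : ℕ) : ℝ) * meshWidth N ℓ]

/-- The nodal hat function at node `i` of the mesh that arises from the grid by cutting each square
cell into two triangles along its diagonal in direction `(1, 1)`. In the coordinates `s, t` scaled by
the mesh width and centred at the node, it is the continuous function that is affine on every
triangle, `1` at the origin and `0` at all other integer points. -/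
def hat {N ℓ : ℕ} (i : Node N ℓ) (x : Plane) : ℝ :=
  let s := x 0 / meshWidth N ℓ - ((i.1 : ℕ) : ℝ)
  let t := x 1 / meshWidth N ℓ - ((i.2 : ℕ) : ℝ)
  max 0 (1 - max |s| (max |t| |s - t|))

/-- The space `U^ℓ` spanned by all hat functions of level `ℓ`. -/
def gridSpace (N ℓ : ℕ) : Submodule ℝ (Plane → ℝ) :=
  Submodule.span ℝ (range (hat : Node N ℓ → Plane → ℝ))

/-- The image of nodal values of a function on the grid of level `ℓ`. -/
def nodalImage (N ℓ : ℕ) (g : Plane → ℝ) : Node N ℓ → ℝ := fun i => g (nodePos i)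

/-- Nodal interpolation in `U^ℓ`. -/
def interpolate (N ℓ : ℕ) (g : Plane → ℝ) : Plane → ℝ :=
  fun x => ∑ i : Node N ℓ, nodalImage N ℓ g i * hat i x

/-- The bilinear form `∫_D κ ⟨∇v, ∇w⟩ dx`. -/
def energyForm (κ v w : Plane → ℝ) : ℝ :=
  ∫ x in unitSquare, κ x * inner ℝ (gradient v x) (gradient w x)

/-- The functional `w ↦ ∫_D f w dx`. -/
def loadFunctional (f w : Plane → ℝ) : ℝ := ∫ x in unitSquare, f x * w x

/-- The image of the load functional on the grid of level `ℓ`: entry `i` is `∫_D f φ_i dx`. -/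
def loadImage (N ℓ : ℕ) (f : Plane → ℝ) : Node N ℓ → ℝ := fun i => loadFunctional f (hat i)

/-! ### Locally refined multilevel spaces and the discrete problem -/

/-- A locally refined multilevel discretization with `L` levels: on each level a set of nodes of the
uniform grid is selected (the degrees of freedom of that level). All of them are interior nodes, so
the hat functions vanish on the boundary of the unit square. -/
structure LocalGrid (N L : ℕ) where
  nodes : ∀ k : Fin L, Finset (Node N k)
  interior : ∀ k, ∀ i ∈ nodes k,
    (0 < (i.1 : ℕ) ∧ (i.1 : ℕ) < N * 2 ^ (k : ℕ)) ∧ (0 < (i.2 : ℕ) ∧ (i.2 : ℕ) < N * 2 ^ (k : ℕ))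

/-- The finest level. -/
def finest {L : ℕ} (hL : 0 < L) : Fin L := ⟨L - 1, Nat.sub_lt hL Nat.one_pos⟩

namespace LocalGrid

variable {N L : ℕ} (G : LocalGrid N L)

/-- All degrees of freedom: pairs of a level and a selected node of that level. -/
abbrev Dof := (k : Fin L) × G.nodes k

/-- The support of the space `V^k` spanned by the selected hat functions of level `k`. -/
def levelSupport (k : Fin L) : Set Plane := ⋃ i ∈ G.nodes k, tsupport (hat i)

/-- Every level is supported inside the support of the preceding coarser level. -/
def Nested : Prop :=
  ∀ k k' : Fin L, (k' : ℕ) = k + 1 → G.levelSupport k' ⊆ G.levelSupport k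

open Classical in
/-- The closure of the selected nodes of level `k`: all nodes whose hat functions have a support that
meets the support of `V^k`. -/
def closureNodes (k : Fin L) : Finset (Node N k) :=
  G.nodes k ∪ Finset.univ.filter fun i => (tsupport (hat i) ∩ G.levelSupport k).Nonempty

/-- Entry of the discretized operator for the hat functions of two nodes on any two levels. -/
def entry (κ : Plane → ℝ) {k k' : Fin L} (i : Node N k) (j : Node N k') : ℝ :=
  energyForm κ (hat i) (hat j)

/-- The discretized operator `A`. -/
def stiffness (κ : Plane → ℝ) : Matrix G.Dof G.Dof ℝ :=
  Matrix.of fun p q => entry κ (p.2 : Node N p.1) (q.2 : Node N q.1)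

/-- The right-hand side: the load functional applied to all basis functions. -/
def rhs (f : Plane → ℝ) : G.Dof → ℝ := fun p => loadFunctional f (hat (p.2 : Node N p.1))

/-- `‖v‖_A = (vᵀ A v)^{1/2}`. -/
def energyNorm (κ : Plane → ℝ) (v : G.Dof → ℝ) : ℝ :=
  Real.sqrt (dotProduct v ((G.stiffness κ).mulVec v))

/-! ### The levelwise local multigrid algorithm -/

/-- Coefficients on the selected nodes, level by level. -/
abbrev LevelVec := ∀ k : Fin L, G.nodes k → ℝ

/-- Auxiliary vectors on the closures, level by level. -/
abbrev AuxVec := ∀ k : Fin L, G.closureNodes k → ℝ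

open Classical in
/-- Extension by zero from the selected nodes of a level to their closure. -/
def extend {k : Fin L} (v : G.nodes k → ℝ) : G.closureNodes k → ℝ :=
  fun i => if h : (i : Node N k) ∈ G.nodes k then v ⟨i, h⟩ else 0

/-- Restriction from the closure to the selected nodes. -/
def restrict {k : Fin L} (v : G.closureNodes k → ℝ) : G.nodes k → ℝ :=
  fun i => v ⟨i, Finset.mem_union_left _ i.2⟩

/-- Prolongation: nodal interpolation of functions of level `k` at the closure of level `k'`. -/
def prolongation (k k' : Fin L) : Matrix (G.closureNodes k') (G.closureNodes k) ℝ :=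
  Matrix.of fun j i => hat (i : Node N k) (nodePos (j : Node N k'))

/-- The operator of level `k` with rows in the selected nodes and columns in their closure. -/
def levelStiffness (κ : Plane → ℝ) (k : Fin L) : Matrix (G.nodes k) (G.closureNodes k) ℝ :=
  Matrix.of fun i j => entry κ (i : Node N k) (j : Node N k)

/-- The vector `ũ`: `ũ = 0` on the coarsest level, `ũ^{k+1} = P_k (ũ^k + u^k)`. -/
def tildeInit (u : G.LevelVec) : ∀ (k : ℕ) (h : k < L), G.closureNodes ⟨k, h⟩ → ℝ
  | 0, _ => 0
  | k + 1, h =>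
    (G.prolongation ⟨k, Nat.lt_of_succ_lt h⟩ ⟨k + 1, h⟩).mulVec
      (tildeInit u k (Nat.lt_of_succ_lt h) + G.extend (u ⟨k, Nat.lt_of_succ_lt h⟩))

/-- The vector `ū`: `ū = 0` on the finest level, `ū^k = P_kᵀ (ū^{k+1} + (A^{k+1})ᵀ u^{k+1})`. -/
def barInit (κ : Plane → ℝ) (u : G.LevelVec) (k : ℕ) (hk : k < L) : G.closureNodes ⟨k, hk⟩ → ℝ :=
  if h : k + 1 < L then
    (G.prolongation ⟨k, hk⟩ ⟨k + 1, h⟩).transpose.mulVec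
      (barInit κ u (k + 1) h
        + (G.levelStiffness κ ⟨k + 1, h⟩).transpose.mulVec (u ⟨k + 1, h⟩))
  else 0
termination_by L - k

/-- The variables of the algorithm. -/
structure State where
  u : G.LevelVec
  tilde : G.AuxVec
  bar : G.AuxVec

/-- `u^k ← u^k + ω (f^k - [A^k (u^k + ũ^k) + ū^k])`. -/
def smooth (κ : Plane → ℝ) (ω : ℝ) (f : G.LevelVec) (s : G.State) (k : Fin L) : G.State :=
  { s with
    u := Function.update s.u k
      (s.u k + ω • (f k - ((G.levelStiffness κ k).mulVec (G.extend (s.u k) + s.tilde k)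
        + G.restrict (s.bar k)))) }

/-- `ū^{k-1} ← P_{k-1}ᵀ (ū^k + (A^k)ᵀ u^k)` unless `k` is the coarsest level. -/
def updateBar (κ : Plane → ℝ) (s : G.State) (k : Fin L) : G.State :=
  if 0 < (k : ℕ) then
    let k' : Fin L := ⟨k - 1, lt_of_le_of_lt (Nat.sub_le _ _) k.2⟩
    { s with
      bar := Function.update s.bar k'
        ((G.prolongation k' k).transpose.mulVec
          (s.bar k + (G.levelStiffness κ k).transpose.mulVec (s.u k))) }
  else s

/-- `ũ^{k+1} ← P_k (ũ^k + u^k)` unless `k` is the finest level. -/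
def updateTilde (s : G.State) (k : Fin L) : G.State :=
  if h : (k : ℕ) + 1 < L then
    let k' : Fin L := ⟨k + 1, h⟩
    { s with
      tilde := Function.update s.tilde k'
        ((G.prolongation k k').mulVec (s.tilde k + G.extend (s.u k))) }
  else s

/-- One run of the algorithm: initialize the auxiliary vectors, go through the levels from fine to
coarse, then from coarse to fine. -/
def llmg (κ : Plane → ℝ) (ω : ℝ) (f u : G.Dof → ℝ) : G.Dof → ℝ :=
  let fl : G.LevelVec := fun k i => f ⟨k, i⟩
  let ul : G.LevelVec := fun k i => u ⟨k, i⟩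
  let s₀ : G.State :=
    { u := ul
      tilde := fun k => G.tildeInit ul k k.2
      bar := fun k => G.barInit κ ul k k.2 }
  let s₁ := (List.finRange L).reverse.foldl
    (fun s k => G.updateBar κ (G.smooth κ ω fl s k) k) s₀
  let s₂ := (List.finRange L).foldl
    (fun s k => G.updateTilde (G.smooth κ ω fl s k) k) s₁
  fun p => s₂.u p.1 p.2

/-- `m` runs of the algorithm, started from `0`. -/
def llmgIter (κ : Plane → ℝ) (ω : ℝ) (f : G.Dof → ℝ) (m : ℕ) : G.Dof → ℝ :=
  (G.llmg κ ω f)^[m] 0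

end LocalGrid

/-! ### Convolutional neural networks on multilevel images -/

/-- Shape of a feature map: the grid level of its images and the number of channels. -/
structure Shape (L : ℕ) where
  level : Fin L
  channels : ℕ

/-- A feature map: one image on the whole uniform grid for each channel. -/
abbrev FeatureMap (N : ℕ) {L : ℕ} (s : Shape L) := Fin s.channels → Node N s.level → ℝ

/-- Pixel of an image at an integer position, with zero padding. -/
def pixel {N ℓ : ℕ} (x : Node N ℓ → ℝ) (p q : ℤ) : ℝ :=
  if h : (0 ≤ p ∧ p.toNat < N * 2 ^ ℓ + 1) ∧ (0 ≤ q ∧ q.toNat < N * 2 ^ ℓ + 1) then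
    x (⟨p.toNat, h.1.2⟩, ⟨q.toNat, h.2.2⟩)
  else 0

/-- Pixel of the image dilated by a zero between any two pixels. -/
def dilatedPixel {N ℓ : ℕ} (x : Node N ℓ → ℝ) (p q : ℤ) : ℝ :=
  if 2 ∣ p ∧ 2 ∣ q then pixel x (p / 2) (q / 2) else 0

/-- Kinds of convolutions from an image of level `ℓ` to one of level `ℓ'`: vanilla (same level),
`2`-strided (to the next coarser level), `2`-transpose strided (to the next finer level). -/
inductive ConvKind {L : ℕ} (ℓ ℓ' : Fin L) : Type
  | vanilla (h : ℓ' = ℓ)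
  | strided (h : (ℓ : ℕ) = ℓ' + 1)
  | transposed (h : (ℓ' : ℕ) = ℓ + 1)

/-- The input value that the kernel weight with offset `(d, e)` meets at output pixel `(p, q)`. -/
def ConvKind.sample {N L : ℕ} {ℓ ℓ' : Fin L} (kd : ConvKind ℓ ℓ') (x : Node N ℓ → ℝ)
    (p q d e : ℤ) : ℝ :=
  match kd with
  | .vanilla _ => pixel x (p + d) (q + e)
  | .strided _ => pixel x (2 * p + d) (2 * q + e)
  | .transposed _ => dilatedPixel x (p + d) (q + e)

/-- A convolution that reads one of the available feature maps, with its kernel. -/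
structure ConvTerm {L : ℕ} (ctx : List (Shape L)) (out : Shape L) where
  src : Fin ctx.length
  kind : ConvKind (ctx.get src).level out.level
  width : ℕ
  height : ℕ
  kernel : Fin out.channels → Fin (ctx.get src).channels →
    Fin (2 * width + 1) → Fin (2 * height + 1) → ℝ

/-- Number of kernel entries. -/
def ConvTerm.numParams {L : ℕ} {ctx : List (Shape L)} {out : Shape L} (t : ConvTerm ctx out) : ℕ :=
  out.channels * (ctx.get t.src).channels * (2 * t.width + 1) * (2 * t.height + 1)

/-- Values of all feature maps that have been computed so far. -/
abbrev Env (N : ℕ) {L : ℕ} (ctx : List (Shape L)) :=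
  ∀ p : Fin ctx.length, FeatureMap N (ctx.get p)

/-- Multi-channel convolution with zero padding. -/
def ConvTerm.eval {N L : ℕ} {ctx : List (Shape L)} {out : Shape L} (t : ConvTerm ctx out)
    (env : Env N ctx) : FeatureMap N out :=
  fun c i => ∑ c' : Fin (ctx.get t.src).channels, ∑ d : Fin (2 * t.width + 1),
    ∑ e : Fin (2 * t.height + 1),
      t.kernel c c' d e * t.kind.sample (env t.src c') ((i.1 : ℕ) : ℤ) ((i.2 : ℕ) : ℤ)
        (((d : ℕ) : ℤ) - (t.width : ℤ)) (((e : ℕ) : ℤ) - (t.height : ℤ))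

/-- A layer: the sum of convolutions of available feature maps (several of them in the case of skip
connections) plus one bias per channel, followed by the activation function if `activated`. A
layer with `sparse = true` is submanifold sparse: it is applied only at the active nodes of its
level, and its output is zero at all other nodes. -/
structure Layer {L : ℕ} (ctx : List (Shape L)) (out : Shape L) where
  terms : List (ConvTerm ctx out)
  bias : Fin out.channels → ℝ
  activated : Bool
  sparse : Bool

/-- Number of kernel entries and biases. -/
def Layer.numParams {L : ℕ} {ctx : List (Shape L)} {out : Shape L} (l : Layer ctx out) : ℕ :=
  (l.terms.map ConvTerm.numParams).sum + out.channels

open Classical in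
/-- The feature map computed by a layer; `active` holds the active nodes of every level. -/
def Layer.eval {N L : ℕ} (σ : ℝ → ℝ) (active : ∀ k : Fin L, Finset (Node N k))
    {ctx : List (Shape L)} {out : Shape L} (l : Layer ctx out) (env : Env N ctx) :
    FeatureMap N out :=
  fun c i =>
    if l.sparse = true ∧ i ∉ active out.level then 0
    else
      let z := (l.terms.map fun t => t.eval env c i).sum + l.bias c
      if l.activated then σ z else z

/-- A convolutional neural network (with skip connections) that starts from feature maps of the
shapes `ctx`: a finite sequence of layers, each of which adds a feature map, and the choice of one
output image on every level. -/
inductive CNN {L : ℕ} : List (Shape L) → Type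
  | output {ctx : List (Shape L)} (src : Fin L → Fin ctx.length)
      (level_eq : ∀ k, (ctx.get (src k)).level = k)
      (channel : ∀ k, Fin (ctx.get (src k)).channels) : CNN ctx
  | layer {ctx : List (Shape L)} (s : Shape L) (l : Layer ctx s) (rest : CNN (s :: ctx)) : CNN ctx

/-- Total number of kernel entries and biases. -/
def CNN.numParams {L : ℕ} : ∀ {ctx : List (Shape L)}, CNN ctx → ℕ
  | _, .output _ _ _ => 0
  | _, .layer _ l rest => l.numParams + rest.numParams

/-- The output images of a network. -/
def CNN.eval {N L : ℕ} (σ : ℝ → ℝ) (active : ∀ k : Fin L, Finset (Node N k)) :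
    ∀ {ctx : List (Shape L)}, CNN ctx → Env N ctx → ∀ k : Fin L, Node N k → ℝ
  | _, .output src _ channel, env =>
    fun k i => pixel (env (src k) (channel k)) ((i.1 : ℕ) : ℤ) ((i.2 : ℕ) : ℤ)
  | _, .layer _ l rest, env =>
    rest.eval σ active
      (fun p => Fin.cases (motive := fun p => FeatureMap N ((_ :: _ : List (Shape L)).get p))
        (l.eval σ active env) env p)

/-- Shape of the network input: two images on the finest grid. -/
abbrev inputShape {L : ℕ} (hL : 0 < L) : List (Shape L) := [⟨finest hL, 2⟩]

/-- The network input that consists of two images on the finest grid. -/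
def inputEnv {N L : ℕ} (hL : 0 < L) (a b : Node N (finest hL) → ℝ) : Env N (inputShape hL) :=
  fun p => Fin.cases (motive := fun p => FeatureMap N ((inputShape hL).get p))
    (fun c : Fin 2 => if c = 0 then a else b) (fun q => q.elim0) p

/-- The map `ℝ^{2 × I_U^L} → ℝ^{⨉ I_V^k}` realized by a network: the output images on the selected
nodes, which are also the active nodes of the sparse layers. -/
def CNN.realize {N L : ℕ} (σ : ℝ → ℝ) (G : LocalGrid N L) (hL : 0 < L)
    (Ψ : CNN (inputShape hL)) (a b : Node N (finest hL) → ℝ) : G.Dof → ℝ :=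
  fun p => Ψ.eval σ G.nodes (inputEnv hL a b) p.1 p.2

/-- Locally essentially bounded functions that near some point are three times continuously
differentiable with nonzero second derivative at that point. -/
def AdmissibleActivation (σ : ℝ → ℝ) : Prop :=
  (∀ K : Set ℝ, IsCompact K → MemLp σ ⊤ (volume.restrict K)) ∧
    ∃ x₀ : ℝ, ContDiffAt ℝ 3 σ x₀ ∧ iteratedDeriv 2 σ x₀ ≠ 0

/-- The rate `c_L = c L / (1 + c L)`. -/
def rate (c : ℝ) (L : ℕ) : ℝ := c * L / (1 + c * L)

end LocalMG

end

open LocalMG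

noncomputable section

namespace LocalMG

/-! ### The hexagonal hat profile -/

/-! The multigrid iteration is a block relaxation in disguise. Hat functions of a coarse level are
exact interpolants on every finer level (`hat_eq_sum`). Hence `ũ^k` holds the nodal values of the
part of the iterate from coarser levels, and `ū^k` the operator applied to the part from finer
levels. One smoothing step is thus a damped Richardson step on block `k` of the full multilevel
system. Storing the auxiliary vectors only on the closures loses nothing when the supports are
nested: the entries that are dropped either vanish or are never read. This gives `llmg_eq_relaxRun`.

The relaxation converges for a symmetric positive semidefinite `A` whose nonzero eigenvalues lie in
`[cmin, cmax]`. With `ω ≤ 1 / cmax`, each block step lowers the energy by at least `|w|² / ω`, where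
`w` is the correction. The corrections of distinct blocks are orthogonal, and together they control
the residual `A e` up to a factor linear in the number of levels. The residual in turn controls the
energy, because `cmin ⟨e, A e⟩ ≤ |A e|²` holds also in the presence of a kernel. A sweep therefore
reduces the energy by the factor `1 - cmin ω / (2 L)` (`form_foldl_blockStep_le`). Taking `c` large
makes this at most `rate c L ^ 3`, so `m` runs reach even `ε ^ 3`, which leaves room for the error
of the network.

The network imitates the relaxation on full grids, so it needs no nesting. Grid transfers are
strided and transpose strided convolutions with the two-scale kernel. The operator on each level is
encoded by nine images, linear in the nodal values of the coefficient: at interior nodes the stencil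
on the finest level is translation invariant, and coarser stencils follow by Galerkin projection
(`operatorImage_eq`). The only nonlinear operation is the pixelwise product, obtained from second
differences of `σ` (`exists_scalar_product`). The notion `Approx` fixes the number of parameters
before the accuracy, and it is stable under linear layers and products on bounded families; hence a
run costs `O(L)` parameters (`GridApprox.run`) whatever the tolerance. Sparse layers alone carry the
information on the local refinement.

Finally, uniform closeness of the coefficients is turned into closeness in the energy norm, and the
network imitates `⌈log ε⁻¹ / log (rate c L)⁻¹⌉` runs, independently of the given `m`. -/

/-- The profile of all nodal hat functions in lattice coordinates. -/
def hexHat (s t : ℝ) : ℝ := max 0 (1 - max |s| (max |t| |s - t|))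

lemma hat_eq_hexHat {N ℓ : ℕ} (i : Node N ℓ) (x : Plane) :
    hat i x = hexHat (x 0 / meshWidth N ℓ - ((i.1 : ℕ) : ℝ))
      (x 1 / meshWidth N ℓ - ((i.2 : ℕ) : ℝ)) := rfl

lemma hexHat_nonneg (s t : ℝ) : 0 ≤ hexHat s t := le_max_left _ _

lemma hexHat_comm (s t : ℝ) : hexHat s t = hexHat t s := by
  unfold hexHat
  rw [abs_sub_comm s t, max_left_comm]

lemma hexHat_neg (s t : ℝ) : hexHat (-s) (-t) = hexHat s t := by
  unfold hexHat
  rw [abs_neg, abs_neg, ← neg_sub', abs_neg]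

lemma hexHat_pos_iff {s t : ℝ} : 0 < hexHat s t ↔ |s| < 1 ∧ |t| < 1 ∧ |s - t| < 1 := by
  unfold hexHat
  rw [lt_max_iff]
  simp only [lt_irrefl, false_or, sub_pos, max_lt_iff]

lemma hexHat_ne_zero_iff {s t : ℝ} : hexHat s t ≠ 0 ↔ |s| < 1 ∧ |t| < 1 ∧ |s - t| < 1 := by
  rw [← hexHat_pos_iff]
  exact ⟨fun h => lt_of_le_of_ne (hexHat_nonneg _ _) h.symm, fun h => h.ne'⟩

lemma hexHat_int (a b : ℤ) : hexHat a b = if a = 0 ∧ b = 0 then 1 else 0 := by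
  split_ifs with h
  · rw [h.1, h.2]; simp [hexHat]
  · by_contra h0
    obtain ⟨h1, h2, -⟩ := hexHat_ne_zero_iff.1 h0
    apply h
    constructor
    · rw [← Int.abs_lt_one_iff]; exact_mod_cast h1
    · rw [← Int.abs_lt_one_iff]; exact_mod_cast h2

/-- The positive part is affine on a triangle whose integer vertex values differ by at most one. -/
lemma max_zero_combination {u v w : ℤ} (h₁ : |u - v| ≤ 1) (h₂ : |u - w| ≤ 1) (h₃ : |v - w| ≤ 1)
    {α β γ : ℝ} (hα : 0 ≤ α) (hβ : 0 ≤ β) (hγ : 0 ≤ γ) :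
    max 0 (α * u + β * v + γ * w) =
      α * ((max 0 u : ℤ) : ℝ) + β * ((max 0 v : ℤ) : ℝ) + γ * ((max 0 w : ℤ) : ℝ) := by
  rw [abs_le] at h₁ h₂ h₃
  have h : (0 ≤ u ∧ 0 ≤ v ∧ 0 ≤ w) ∨ (u ≤ 0 ∧ v ≤ 0 ∧ w ≤ 0) := by omega
  rcases h with ⟨hu, hv, hw⟩ | ⟨hu, hv, hw⟩
  · rw [max_eq_right hu, max_eq_right hv, max_eq_right hw, max_eq_right]
    have : (0 : ℝ) ≤ u := by exact_mod_cast hu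
    have : (0 : ℝ) ≤ v := by exact_mod_cast hv
    have : (0 : ℝ) ≤ w := by exact_mod_cast hw
    positivity
  · rw [max_eq_left hu, max_eq_left hv, max_eq_left hw, max_eq_left]
    · simp
    have hu' : (u : ℝ) ≤ 0 := by exact_mod_cast hu
    have hv' : (v : ℝ) ≤ 0 := by exact_mod_cast hv
    have hw' : (w : ℝ) ≤ 0 := by exact_mod_cast hw
    have := mul_nonpos_of_nonneg_of_nonpos hα hu'
    have := mul_nonpos_of_nonneg_of_nonpos hβ hv'
    have := mul_nonpos_of_nonneg_of_nonpos hγ hw'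
    linarith

/-- The maximum of `|s|`, `|t|`, `|s - t|` is the spread of the three numbers `0, s, t`, that is
`max(0, s, t) + max(0, -s, -t)`. Writing it with nested positive parts prepares for
`max_zero_combination`. -/
lemma hexHat_div {r : ℝ} (hr : 0 < r) (s t : ℝ) : hexHat (s / r) (t / r) =
    max 0 (r - max 0 (t + max 0 (s - t)) - max 0 (-t + max 0 (t - s))) / r := by
  have h : max |s / r| (max |t / r| |s / r - t / r|) =
      (max 0 (t + max 0 (s - t)) + max 0 (-t + max 0 (t - s))) / r := by
    rw [← sub_div, abs_div, abs_div, abs_div, abs_of_pos hr, max_div_div_right hr.le,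
      max_div_div_right hr.le]
    congr 1
    rcases le_total s t with h | h
    · rw [abs_of_nonpos (sub_nonpos.2 h), max_eq_left (sub_nonpos.2 h), max_eq_right (sub_nonneg.2 h)]
      rcases abs_cases s with ⟨hs, hs'⟩ | ⟨hs, hs'⟩ <;> rcases abs_cases t with ⟨ht, ht'⟩ | ⟨ht, ht'⟩ <;>
        rw [hs, ht] <;> simp only [max_def] <;> split_ifs <;> linarith
    · rw [abs_of_nonneg (sub_nonneg.2 h), max_eq_right (sub_nonneg.2 h), max_eq_left (sub_nonpos.2 h)]
      rcases abs_cases s with ⟨hs, hs'⟩ | ⟨hs, hs'⟩ <;> rcases abs_cases t with ⟨ht, ht'⟩ | ⟨ht, ht'⟩ <;>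
        rw [hs, ht] <;> simp only [max_def] <;> split_ifs <;> linarith
  rw [hexHat, h, ← max_div_div_right hr.le, zero_div]
  congr 1
  field_simp
  ring

/-- Lattice form of the hat profile refined `r` times. -/
def hexInt (r : ℕ) (a b : ℤ) : ℤ :=
  max 0 (r - max 0 (b + max 0 (a - b)) - max 0 (-b + max 0 (b - a)))

lemma hexHat_div_int {r : ℕ} (hr : 0 < r) (a b : ℤ) :
    hexHat (a / r) (b / r) = (hexInt r a b : ℝ) / r := by
  rw [hexHat_div (by exact_mod_cast hr)]
  simp [hexInt]

/-- No kink of the coarse profile crosses the interior of a fine triangle. Every argument of a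
positive part in `hexHat_div` has integer vertex values that differ by at most one, so the positive
parts can be evaluated at the vertices one after another, from the innermost to the outermost. -/
lemma hexHat_interp {r : ℕ} (hr : 0 < r) (a b : ℤ) {α β γ : ℝ} (hα : 0 ≤ α) (hβ : 0 ≤ β)
    (hγ : 0 ≤ γ) (h : α + β + γ = 1) :
    hexHat ((a + β + γ) / r) ((b + γ) / r) =
      α * hexHat (a / r) (b / r) + β * hexHat ((a + 1) / r) (b / r)
        + γ * hexHat ((a + 1) / r) ((b + 1) / r) := by
  have hr' : (0 : ℝ) < r := by exact_mod_cast hr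
  have e1 := hexHat_div_int hr a b
  have e2 := hexHat_div_int hr (a + 1) b
  have e3 := hexHat_div_int hr (a + 1) (b + 1)
  push_cast at e1 e2 e3
  rw [e1, e2, e3, hexHat_div hr']
  have m1 : max 0 ((a + β + γ) - (b + γ)) = α * ((max 0 (a - b) : ℤ) : ℝ)
      + β * ((max 0 (a + 1 - b) : ℤ) : ℝ) + γ * ((max 0 (a + 1 - (b + 1)) : ℤ) : ℝ) := by
    rw [← max_zero_combination _ _ _ hα hβ hγ]
    · congr 1
      push_cast
      linear_combination (-(a : ℝ) + b) * h
    all_goals rw [abs_le]; omega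
  have m2 : max 0 ((b + γ) - (a + β + γ)) = α * ((max 0 (b - a) : ℤ) : ℝ)
      + β * ((max 0 (b - (a + 1)) : ℤ) : ℝ) + γ * ((max 0 (b + 1 - (a + 1)) : ℤ) : ℝ) := by
    rw [← max_zero_combination _ _ _ hα hβ hγ]
    · congr 1
      push_cast
      linear_combination ((a : ℝ) - b) * h
    all_goals rw [abs_le]; omega
  have m3 : max 0 ((b + γ) + max 0 ((a + β + γ) - (b + γ))) =
      α * ((max 0 (b + max 0 (a - b)) : ℤ) : ℝ)
      + β * ((max 0 (b + max 0 (a + 1 - b)) : ℤ) : ℝ)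
      + γ * ((max 0 (b + 1 + max 0 (a + 1 - (b + 1))) : ℤ) : ℝ) := by
    rw [← max_zero_combination _ _ _ hα hβ hγ, m1]
    · congr 1
      push_cast
      linear_combination (-(b : ℝ)) * h
    all_goals rw [abs_le]; omega
  have m4 : max 0 (-(b + γ) + max 0 ((b + γ) - (a + β + γ))) =
      α * ((max 0 (-b + max 0 (b - a)) : ℤ) : ℝ)
      + β * ((max 0 (-b + max 0 (b - (a + 1))) : ℤ) : ℝ)
      + γ * ((max 0 (-(b + 1) + max 0 (b + 1 - (a + 1))) : ℤ) : ℝ) := by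
    rw [← max_zero_combination _ _ _ hα hβ hγ, m2]
    · congr 1
      push_cast
      linear_combination ((b : ℝ)) * h
    all_goals rw [abs_le]; omega
  rw [m3, m4, ← mul_div_assoc, ← mul_div_assoc, ← mul_div_assoc, ← add_div, ← add_div]
  congr 1
  simp only [hexInt]
  refine Eq.trans ?_ (max_zero_combination ?_ ?_ ?_ hα hβ hγ)
  · congr 1
    push_cast
    linear_combination (-(r : ℝ)) * h
  all_goals rw [abs_le]; omega

/-! ### Hat functions and nodes -/

lemma meshWidth_pos {N : ℕ} (hN : 0 < N) (ℓ : ℕ) : 0 < meshWidth N ℓ := by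
  unfold meshWidth
  positivity

lemma div_meshWidth {N : ℕ} (ℓ : ℕ) (x : ℝ) :
    x / meshWidth N ℓ = x * ((N * 2 ^ ℓ : ℕ) : ℝ) := by
  unfold meshWidth
  push_cast
  rw [div_div_eq_mul_div, div_one]

lemma meshWidth_div {N : ℕ} (hN : 0 < N) {ℓ k : ℕ} (h : ℓ ≤ k) :
    meshWidth N k / meshWidth N ℓ = 1 / ((2 ^ (k - ℓ) : ℕ) : ℝ) := by
  obtain ⟨m, rfl⟩ := Nat.exists_eq_add_of_le h
  unfold meshWidth
  have : (N : ℝ) ≠ 0 := by positivity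
  rw [Nat.add_sub_cancel_left]
  push_cast
  rw [pow_add]
  field_simp

/-- The value of a hat function at a node of a finer grid. -/
lemma hat_nodePos {N : ℕ} (hN : 0 < N) {ℓ k : ℕ} (h : ℓ ≤ k) (i : Node N ℓ) (j : Node N k) :
    hat i (nodePos j) =
      hexHat ((((j.1 : ℕ) : ℤ) - (2 ^ (k - ℓ) : ℕ) * ((i.1 : ℕ) : ℤ) : ℤ) / ((2 ^ (k - ℓ) : ℕ) : ℝ))
        ((((j.2 : ℕ) : ℤ) - (2 ^ (k - ℓ) : ℕ) * ((i.2 : ℕ) : ℤ) : ℤ) / ((2 ^ (k - ℓ) : ℕ) : ℝ)) := by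
  rw [hat_eq_hexHat]
  have e := meshWidth_div hN h
  have h2 : ((2 ^ (k - ℓ) : ℕ) : ℝ) ≠ 0 := by positivity
  generalize 2 ^ (k - ℓ) = r at *
  simp only [nodePos, PiLp.toLp_apply, Matrix.cons_val_zero, Matrix.cons_val_one]
  rw [mul_div_assoc, mul_div_assoc, e]
  push_cast
  congr 1 <;> field_simp

lemma hat_nodePos_self {N : ℕ} (hN : 0 < N) {ℓ : ℕ} (i j : Node N ℓ) :
    hat i (nodePos j) = if j = i then 1 else 0 := by
  rw [hat_nodePos hN le_rfl, Nat.sub_self, pow_zero]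
  simp only [Nat.cast_one, div_one]
  rw [hexHat_int]
  congr 1
  rw [Prod.ext_iff, Fin.ext_iff, Fin.ext_iff]
  simp only [one_mul, sub_eq_zero, Nat.cast_inj]

lemma exists_cell {n : ℕ} (hn : 0 < n) {x : ℝ} (hx : x ∈ Icc (0 : ℝ) 1) :
    -- The value `p = 1` is allowed so that the right end point belongs to the last cell; the floor
    -- alone would give `a = n` there.
    ∃ a : ℕ, a + 1 ≤ n ∧ ∃ p : ℝ, 0 ≤ p ∧ p ≤ 1 ∧ x * n = a + p := by
  have hn' : (0 : ℝ) < n := by exact_mod_cast hn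
  by_cases h : x = 1
  · refine ⟨n - 1, by omega, 1, by norm_num, le_rfl, ?_⟩
    rw [h, Nat.cast_sub hn]
    simp
  · have h0 : 0 ≤ x * n := mul_nonneg hx.1 hn'.le
    refine ⟨⌊x * n⌋₊, ?_, x * n - ⌊x * n⌋₊, ?_, ?_, by ring⟩
    · apply (Nat.floor_lt h0).2
      have : x < 1 := lt_of_le_of_ne hx.2 h
      nlinarith
    · linarith [Nat.floor_le h0]
    · linarith [Nat.lt_floor_add_one (x * n)]

/-- Every point of the unit square is a convex combination of three nodes, in such a way that all
hat functions of coarser levels are interpolated. -/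
lemma exists_barycentric {N : ℕ} (hN : 0 < N) (k : ℕ) {x : Plane} (hx : x ∈ unitSquare) :
    ∃ (j₁ j₂ j₃ : Node N k) (α β γ : ℝ), ∀ ℓ ≤ k, ∀ i : Node N ℓ,
      hat i x = α * hat i (nodePos j₁) + β * hat i (nodePos j₂) + γ * hat i (nodePos j₃) := by
  have hn : 0 < N * 2 ^ k := by positivity
  obtain ⟨a, ha, p, hp0, hp1, hp⟩ := exists_cell hn (hx 0)
  obtain ⟨b, hb, q, hq0, hq1, hq⟩ := exists_cell hn (hx 1)
  have hs : ∀ ℓ ≤ k, ∀ i : ℕ, ∀ y a p : ℝ, y * ((N * 2 ^ k : ℕ) : ℝ) = a + p →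
      y / meshWidth N ℓ - i = (a - (2 ^ (k - ℓ) : ℕ) * i + p) / ((2 ^ (k - ℓ) : ℕ) : ℝ) := by
    intro ℓ hℓ i y a p hy
    obtain ⟨m, rfl⟩ := Nat.exists_eq_add_of_le hℓ
    rw [Nat.add_sub_cancel_left, div_meshWidth, eq_div_iff (by positivity)]
    push_cast at hy ⊢
    rw [pow_add] at hy
    linear_combination hy
  -- The diagonal `p = q` decides in which of the two triangles of the cell the point lies.
  rcases le_total q p with hpq | hpq
  · refine ⟨(⟨a, by omega⟩, ⟨b, by omega⟩), (⟨a + 1, by omega⟩, ⟨b, by omega⟩),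
      (⟨a + 1, by omega⟩, ⟨b + 1, by omega⟩), 1 - p, p - q, q, fun ℓ hℓ i => ?_⟩
    have hr : 0 < 2 ^ (k - ℓ) := by positivity
    rw [hat_eq_hexHat, hs ℓ hℓ _ _ _ _ hp, hs ℓ hℓ _ _ _ _ hq, hat_nodePos hN hℓ, hat_nodePos hN hℓ,
      hat_nodePos hN hℓ]
    have key := hexHat_interp hr ((a : ℤ) - (2 ^ (k - ℓ) : ℕ) * ((i.1 : ℕ) : ℤ))
      ((b : ℤ) - (2 ^ (k - ℓ) : ℕ) * ((i.2 : ℕ) : ℤ)) (α := 1 - p) (β := p - q) (γ := q)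
      (by linarith) (by linarith) hq0 (by ring)
    generalize 2 ^ (k - ℓ) = r at *
    push_cast at key ⊢
    convert key using 2
    · ring
    all_goals congr 3 <;> ring
  · refine ⟨(⟨a, by omega⟩, ⟨b, by omega⟩), (⟨a, by omega⟩, ⟨b + 1, by omega⟩),
      (⟨a + 1, by omega⟩, ⟨b + 1, by omega⟩), 1 - q, q - p, p, fun ℓ hℓ i => ?_⟩
    have hr : 0 < 2 ^ (k - ℓ) := by positivity
    rw [hat_eq_hexHat, hs ℓ hℓ _ _ _ _ hp, hs ℓ hℓ _ _ _ _ hq, hat_nodePos hN hℓ, hat_nodePos hN hℓ,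
      hat_nodePos hN hℓ]
    have key := hexHat_interp hr ((b : ℤ) - (2 ^ (k - ℓ) : ℕ) * ((i.2 : ℕ) : ℤ))
      ((a : ℤ) - (2 ^ (k - ℓ) : ℕ) * ((i.1 : ℕ) : ℤ)) (α := 1 - q) (β := q - p) (γ := p)
      (by linarith) (by linarith) hp0 (by ring)
    generalize 2 ^ (k - ℓ) = r at *
    -- The upper triangle is the mirror image of the lower one, so the symmetry of the profile
    -- reduces it to the same identity with the coordinates exchanged.
    simp only [hexHat_comm (((b : ℤ) - (r : ℤ) * ((i.2 : ℕ) : ℤ) : ℤ) / _),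
      hexHat_comm ((((b : ℤ) - (r : ℤ) * ((i.2 : ℕ) : ℤ) : ℤ) + 1) / _),
      hexHat_comm ((((b : ℤ) - (r : ℤ) * ((i.2 : ℕ) : ℤ) : ℤ) + (q - p) + p) / _)] at key
    push_cast at key ⊢
    convert key using 2
    · ring
    all_goals congr 3 <;> ring

/-- A hat function of a coarser level is interpolated by the hat functions of a finer level. -/
lemma hat_eq_sum {N : ℕ} (hN : 0 < N) {ℓ k : ℕ} (h : ℓ ≤ k) (i : Node N ℓ) {x : Plane}
    (hx : x ∈ unitSquare) : hat i x = ∑ j : Node N k, hat i (nodePos j) * hat j x := by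
  obtain ⟨j₁, j₂, j₃, α, β, γ, H⟩ := exists_barycentric hN k hx
  -- The weights do not depend on the level or the node. Applied to the hats of level `k` itself,
  -- they show that the values `hat j x` are the barycentric coordinates of `x`.
  rw [H ℓ h i]
  simp only [H k le_rfl, hat_nodePos_self hN, mul_add, Finset.sum_add_distrib]
  simp [Finset.sum_ite_eq, mul_comm]

lemma nodePos_mem {N : ℕ} (hN : 0 < N) {k : ℕ} (i : Node N k) : nodePos i ∈ unitSquare := by
  have h : ∀ a : Fin (N * 2 ^ k + 1), ((a : ℕ) : ℝ) * meshWidth N k ∈ Icc (0 : ℝ) 1 := by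
    intro a
    refine ⟨mul_nonneg (by positivity) (meshWidth_pos hN k).le, ?_⟩
    have h1 : ((a : ℕ) : ℝ) ≤ ((N * 2 ^ k : ℕ) : ℝ) := by exact_mod_cast Nat.lt_succ_iff.1 a.2
    push_cast at h1
    unfold meshWidth
    rw [mul_one_div]
    exact div_le_one_of_le₀ h1 (by positivity)
  intro j
  fin_cases j
  · simpa [nodePos] using h i.1
  · simpa [nodePos] using h i.2

lemma hat_ne_zero_iff {N ℓ : ℕ} {i : Node N ℓ} {x : Plane} : hat i x ≠ 0 ↔
    |x 0 / meshWidth N ℓ - ((i.1 : ℕ) : ℝ)| < 1 ∧ |x 1 / meshWidth N ℓ - ((i.2 : ℕ) : ℝ)| < 1 ∧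
      |x 0 / meshWidth N ℓ - ((i.1 : ℕ) : ℝ) - (x 1 / meshWidth N ℓ - ((i.2 : ℕ) : ℝ))| < 1 := by
  rw [hat_eq_hexHat, hexHat_ne_zero_iff]

/-! ### Regularity of the hat functions -/

/-- The hat function of mesh width `h` centred at the origin. -/
def profile (h : ℝ) (x : Plane) : ℝ := hexHat (x 0 / h) (x 1 / h)

lemma hat_eq_profile {N : ℕ} (hN : 0 < N) {ℓ : ℕ} (i : Node N ℓ) :
    hat i = fun x => profile (meshWidth N ℓ) (x - nodePos i) := by
  funext x
  have := (meshWidth_pos hN ℓ).ne'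
  rw [hat_eq_hexHat, profile]
  simp only [nodePos, PiLp.sub_apply, Matrix.cons_val_zero, Matrix.cons_val_one]
  congr 1 <;> field_simp

lemma exists_lipschitzWith_profile (h : ℝ) : ∃ K, LipschitzWith K (profile h) := by
  have abs_lip : ∀ {f : Plane → ℝ}, (∃ K, LipschitzWith K f) → ∃ K, LipschitzWith K fun x => |f x| :=
    fun ⟨K, hK⟩ => ⟨_, lipschitzWith_one_norm.comp hK⟩
  have max_lip : ∀ {f g : Plane → ℝ}, (∃ K, LipschitzWith K f) → (∃ K, LipschitzWith K g) →
      ∃ K, LipschitzWith K fun x => max (f x) (g x) :=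
    fun ⟨K, hK⟩ ⟨K', hK'⟩ => ⟨_, hK.max hK'⟩
  have sub_lip : ∀ {f g : Plane → ℝ}, (∃ K, LipschitzWith K f) → (∃ K, LipschitzWith K g) →
      ∃ K, LipschitzWith K fun x => f x - g x :=
    fun ⟨K, hK⟩ ⟨K', hK'⟩ => ⟨_, hK.sub hK'⟩
  have coord : ∀ j : Fin 2, ∃ K, LipschitzWith K fun x : Plane => x j / h := by
    intro j
    have e : (fun x : Plane => x j / h) = ⇑(h⁻¹ • (EuclideanSpace.proj j : StrongDual ℝ Plane)) := by
      funext x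
      simp [div_eq_inv_mul]
    rw [e]
    exact ⟨_, ContinuousLinearMap.lipschitz _⟩
  have const : ∀ c : ℝ, ∃ K, LipschitzWith K fun _ : Plane => c := fun c => ⟨0, LipschitzWith.const c⟩
  exact max_lip (const 0) (sub_lip (const 1) (max_lip (abs_lip (coord 0))
    (max_lip (abs_lip (coord 1)) (abs_lip (sub_lip (coord 0) (coord 1))))))

/-- Lipschitz continuity yields bounded gradients and, by Rademacher's theorem, differentiability
almost everywhere; no description of the gradient on individual triangles is needed. -/
lemma exists_lipschitzWith_hat {N : ℕ} (hN : 0 < N) {ℓ : ℕ} (i : Node N ℓ) :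
    ∃ K, LipschitzWith K (hat i) := by
  obtain ⟨K, hK⟩ := exists_lipschitzWith_profile (meshWidth N ℓ)
  rw [hat_eq_profile hN]
  exact ⟨_, hK.comp (LipschitzWith.id.sub (LipschitzWith.const (nodePos i)))⟩

lemma continuous_hat {N : ℕ} (hN : 0 < N) {ℓ : ℕ} (i : Node N ℓ) : Continuous (hat i) :=
  (exists_lipschitzWith_hat hN i).choose_spec.continuous

lemma continuous_of_mem_gridSpace {N : ℕ} (hN : 0 < N) {ℓ : ℕ} {f : Plane → ℝ}
    (hf : f ∈ gridSpace N ℓ) : Continuous f := by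
  unfold gridSpace at hf
  induction hf using Submodule.span_induction with
  | mem f hf => obtain ⟨i, rfl⟩ := hf; exact continuous_hat hN i
  | zero => exact continuous_const
  | add f g _ _ hf hg => exact hf.add hg
  | smul c f _ hf => exact hf.const_smul c

lemma continuous_interpolate {N : ℕ} (hN : 0 < N) (ℓ : ℕ) (g : Plane → ℝ) :
    Continuous (interpolate N ℓ g) :=
  continuous_finsetSum _ fun i _ => continuous_const.mul (continuous_hat hN i)

/-- A zero of a nonnegative function is a minimum. At a kink the gradient has the default value `0`,
so support arguments hold at every point, without exceptional null sets. -/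
lemma gradient_ne_zero_imp {f : Plane → ℝ} (hf : ∀ x, 0 ≤ f x) {x : Plane}
    (h : gradient f x ≠ 0) : f x ≠ 0 := by
  intro h0
  apply h
  have : fderiv ℝ f x = 0 := IsLocalMin.fderiv_eq_zero (Filter.Eventually.of_forall fun y => by
    rw [h0]; exact hf y)
  simp [gradient, this]

lemma hat_nonneg {N ℓ : ℕ} (i : Node N ℓ) (x : Plane) : 0 ≤ hat i x := le_max_left _ _

lemma gradient_hat_eq_zero {N ℓ : ℕ} {i : Node N ℓ} {x : Plane} (h : hat i x = 0) :
    gradient (hat i) x = 0 := by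
  by_contra h'
  exact gradient_ne_zero_imp (hat_nonneg i) h' h

/-! ### The unit square -/

lemma isCompact_unitSquare : IsCompact unitSquare := by
  have h : unitSquare = (EuclideanSpace.equiv (Fin 2) ℝ).toHomeomorph ⁻¹'
      (Set.pi univ fun _ => Icc (0 : ℝ) 1) := by
    ext x
    simp only [unitSquare, mem_ofPred_eq, mem_preimage, mem_pi, mem_univ, true_implies]
    rfl
  rw [h, Homeomorph.isCompact_preimage]
  exact isCompact_univ_pi fun _ => isCompact_Icc

lemma convex_unitSquare : Convex ℝ unitSquare := by
  intro x hx y hy a b ha hb hab j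
  exact convex_Icc (0 : ℝ) 1 (hx j) (hy j) ha hb hab

/-- The interpolation identities hold only inside the square, so they may be differentiated only at
interior points. The boundary of a convex set is null and can be discarded. -/
lemma interior_unitSquare_ae_eq : interior unitSquare =ᵐ[volume] unitSquare :=
  interior_ae_eq_of_null_frontier (convex_unitSquare.addHaar_frontier volume)

/-! ### Bilinearity of the energy form -/

lemma energyForm_comm (κ v w : Plane → ℝ) : energyForm κ v w = energyForm κ w v := by
  unfold energyForm
  simp only [real_inner_comm]

lemma norm_gradient_le {f : Plane → ℝ} {K : NNReal} (hf : LipschitzWith K f) (x : Plane) :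
    ‖gradient f x‖ ≤ K := by
  rw [gradient, LinearIsometryEquiv.norm_map]
  exact norm_fderiv_le_of_lipschitz ℝ hf

lemma measurable_gradient (f : Plane → ℝ) : Measurable (gradient f) :=
  (InnerProductSpace.toDual ℝ Plane).symm.continuous.measurable.comp (measurable_fderiv ℝ f)

lemma integrableOn_energy {κ v w : Plane → ℝ} (hκ : Continuous κ) (hv : ∃ K, LipschitzWith K v)
    (hw : ∃ K, LipschitzWith K w) :
    IntegrableOn (fun x => κ x * inner ℝ (gradient v x) (gradient w x)) unitSquare := by
  obtain ⟨K, hK⟩ := hv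
  obtain ⟨K', hK'⟩ := hw
  obtain ⟨B, hB⟩ := isCompact_unitSquare.exists_bound_of_continuousOn hκ.continuousOn
  refine IntegrableOn.of_bound isCompact_unitSquare.measure_lt_top ?_ (B * (K * K')) ?_
  · exact (hκ.measurable.mul
      ((measurable_gradient v).inner (measurable_gradient w))).aestronglyMeasurable
  · refine (ae_restrict_iff' isCompact_unitSquare.measurableSet).2 (Filter.Eventually.of_forall ?_)
    intro x hx
    rw [norm_mul]
    refine mul_le_mul (hB x hx) ?_ (norm_nonneg _) ((norm_nonneg _).trans (hB x hx))
    refine (norm_inner_le_norm _ _).trans ?_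
    exact mul_le_mul (norm_gradient_le hK x) (norm_gradient_le hK' x) (norm_nonneg _) K.2

lemma gradient_sum {ι : Type*} (s : Finset ι) (c : ι → ℝ) (φ : ι → Plane → ℝ) {x : Plane}
    (h : ∀ i ∈ s, DifferentiableAt ℝ (φ i) x) :
    gradient (fun y => ∑ i ∈ s, c i * φ i y) x = ∑ i ∈ s, c i • gradient (φ i) x := by
  have e : fderiv ℝ (fun y => ∑ i ∈ s, c i * φ i y) x = ∑ i ∈ s, c i • fderiv ℝ (φ i) x := by
    rw [fderiv_fun_sum fun i hi => (h i hi).const_mul _]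
    exact Finset.sum_congr rfl fun i hi => fderiv_const_mul (h i hi) _
  simp only [gradient, e, map_sum]
  exact Finset.sum_congr rfl fun i _ => by simp

/-- The energy form is linear in the hat functions of a finer level that represent a hat function. -/
lemma energyForm_hat_eq_sum {N : ℕ} (hN : 0 < N) {κ v : Plane → ℝ} (hκ : Continuous κ)
    (hv : ∃ K, LipschitzWith K v) {ℓ k : ℕ} (h : ℓ ≤ k) (i : Node N ℓ) :
    energyForm κ v (hat i) = ∑ j : Node N k, hat i (nodePos j) * energyForm κ v (hat j) := by
  have hd : ∀ᵐ x : Plane, ∀ j : Node N k, DifferentiableAt ℝ (hat j) x := by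
    rw [ae_all_iff]
    intro j
    exact (exists_lipschitzWith_hat hN j).choose_spec.ae_differentiableAt
  unfold energyForm
  simp only [← integral_const_mul]
  rw [← integral_finsetSum]
  · rw [← setIntegral_congr_set interior_unitSquare_ae_eq,
      ← setIntegral_congr_set interior_unitSquare_ae_eq]
    refine setIntegral_congr_ae isOpen_interior.measurableSet ?_
    filter_upwards [hd] with x hx hxD
    have e : hat i =ᶠ[nhds x] fun y => ∑ j : Node N k, hat i (nodePos j) * hat j y :=
      Filter.eventually_of_mem (isOpen_interior.mem_nhds hxD)
        fun y hy => hat_eq_sum hN h i (interior_subset hy)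
    rw [e.gradient.eq_of_nhds, gradient_sum _ _ _ fun j _ => hx j, inner_sum, Finset.mul_sum]
    refine Finset.sum_congr rfl fun j _ => ?_
    rw [inner_smul_right]
    ring
  · intro j _
    exact (integrableOn_energy hκ hv (exists_lipschitzWith_hat hN j)).const_mul _

lemma energyForm_hat_eq_zero {N : ℕ} {κ : Plane → ℝ} {ℓ k : ℕ} {i : Node N ℓ} {j : Node N k}
    (h : ∀ x, hat i x ≠ 0 → hat j x ≠ 0 → False) : energyForm κ (hat i) (hat j) = 0 := by
  unfold energyForm
  rw [integral_eq_zero_of_ae]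
  refine Filter.Eventually.of_forall fun x => ?_
  by_cases hi : hat i x = 0
  · simp [gradient_hat_eq_zero hi]
  · have hj : hat j x = 0 := by
      by_contra hj
      exact h x hi hj
    simp [gradient_hat_eq_zero hj]

lemma loadFunctional_hat_eq_sum {N : ℕ} (hN : 0 < N) {f : Plane → ℝ} (hf : Continuous f)
    {ℓ k : ℕ} (h : ℓ ≤ k) (i : Node N ℓ) :
    loadFunctional f (hat i) = ∑ j : Node N k, hat i (nodePos j) * loadFunctional f (hat j) := by
  unfold loadFunctional
  simp only [← integral_const_mul]
  rw [← integral_finsetSum]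
  · refine setIntegral_congr_fun isCompact_unitSquare.measurableSet fun x hx => ?_
    rw [hat_eq_sum hN h i hx, Finset.mul_sum]
    exact Finset.sum_congr rfl fun j _ => by ring
  · intro j _
    exact ((hf.mul (continuous_hat hN j)).continuousOn.integrableOn_compact
      isCompact_unitSquare).const_mul _

/-! ### Supports of hat functions -/

/-- This is what restricts all sums over nodes of one level to kernels with three rows and columns.
-/
lemma abs_sub_le_one_of_hat_ne_zero {N ℓ : ℕ} {i j : Node N ℓ} {x : Plane} (hi : hat i x ≠ 0)
    (hj : hat j x ≠ 0) : |((j.1 : ℕ) : ℤ) - ((i.1 : ℕ) : ℤ)| ≤ 1 ∧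
      |((j.2 : ℕ) : ℤ) - ((i.2 : ℕ) : ℤ)| ≤ 1 := by
  rw [hat_ne_zero_iff] at hi hj
  have key : ∀ (s : ℝ) (a b : ℕ), |s - a| < 1 → |s - b| < 1 → |(b : ℤ) - a| ≤ 1 := by
    intro s a b ha hb
    have h2 : |(b : ℝ) - a| < 2 := by
      rw [abs_lt] at *
      constructor <;> linarith
    have h3 : |(b : ℤ) - a| < 2 := by exact_mod_cast h2
    omega
  exact ⟨key _ _ _ hi.1 hj.1, key _ _ _ hi.2.1 hj.2.1⟩

lemma hat_nodePos_succ {N : ℕ} (hN : 0 < N) {k : ℕ} (i : Node N k) (j : Node N (k + 1)) :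
    hat i (nodePos j) = hexHat ((((j.1 : ℕ) : ℤ) - 2 * ((i.1 : ℕ) : ℤ) : ℤ) / 2)
      ((((j.2 : ℕ) : ℤ) - 2 * ((i.2 : ℕ) : ℤ) : ℤ) / 2) := by
  rw [hat_nodePos hN (Nat.le_succ k)]
  simp

lemma hexHat_half_ne_zero {a b : ℤ} (h : hexHat ((a : ℝ) / 2) ((b : ℝ) / 2) ≠ 0) :
    |a| ≤ 1 ∧ |b| ≤ 1 ∧ |a - b| ≤ 1 := by
  rw [hexHat_ne_zero_iff, ← sub_div] at h
  have key : ∀ c : ℤ, |(c : ℝ) / 2| < 1 → |c| ≤ 1 := by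
    intro c hc
    rw [abs_div, abs_two, div_lt_one two_pos] at hc
    have : |c| < 2 := by exact_mod_cast hc
    omega
  refine ⟨key _ h.1, key _ h.2.1, key _ ?_⟩
  push_cast
  exact h.2.2

/-- If a hat function does not vanish at a node of the next finer level, then it does not vanish on
the support of the hat function of that node. -/
lemma tsupport_hat_subset {N : ℕ} (hN : 0 < N) {k : ℕ} {i : Node N k} {j : Node N (k + 1)}
    (h : hat i (nodePos j) ≠ 0) : tsupport (hat j) ⊆ tsupport (hat i) := by
  refine closure_mono fun x hx => ?_
  rw [Function.mem_support, hat_ne_zero_iff] at hx ⊢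
  rw [hat_nodePos_succ hN] at h
  obtain ⟨h1, h2, h3⟩ := hexHat_half_ne_zero h
  have e : ∀ y : ℝ, y / meshWidth N (k + 1) = 2 * (y / meshWidth N k) := by
    intro y
    rw [div_meshWidth, div_meshWidth]
    push_cast
    ring
  rw [e, e] at hx
  rw [← Int.cast_le (R := ℝ)] at h1 h2 h3
  push_cast at h1 h2 h3
  obtain ⟨g1, g2, g3⟩ := hx
  rw [abs_le] at h1 h2 h3
  rw [abs_lt] at g1 g2 g3
  refine ⟨abs_lt.2 ⟨?_, ?_⟩, abs_lt.2 ⟨?_, ?_⟩, abs_lt.2 ⟨?_, ?_⟩⟩ <;> linarith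

/-! ### Interior nodes and translation invariance of the stencil -/

/-- Nodes in the interior of the unit square. -/
def IsInterior {N ℓ : ℕ} (i : Node N ℓ) : Prop :=
  (0 < (i.1 : ℕ) ∧ (i.1 : ℕ) < N * 2 ^ ℓ) ∧ (0 < (i.2 : ℕ) ∧ (i.2 : ℕ) < N * 2 ^ ℓ)

lemma mem_unitSquare_of_hat_ne_zero {N : ℕ} (hN : 0 < N) {ℓ : ℕ} {i : Node N ℓ} (hi : IsInterior i)
    {x : Plane} (h : hat i x ≠ 0) : x ∈ unitSquare := by
  rw [hat_ne_zero_iff, div_meshWidth, div_meshWidth] at h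
  have key : ∀ (y : ℝ) (a : ℕ), 0 < a → a < N * 2 ^ ℓ → |y * ((N * 2 ^ ℓ : ℕ) : ℝ) - a| < 1 →
      y ∈ Icc (0 : ℝ) 1 := by
    intro y a ha ha' hy
    have hn : (0 : ℝ) < ((N * 2 ^ ℓ : ℕ) : ℝ) := by
      have : 0 < N * 2 ^ ℓ := by positivity
      exact_mod_cast this
    have h1 : (1 : ℝ) ≤ a := by exact_mod_cast ha
    have h2 : (a : ℝ) + 1 ≤ ((N * 2 ^ ℓ : ℕ) : ℝ) := by exact_mod_cast ha'
    rw [abs_lt] at hy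
    constructor
    · by_contra hneg
      have := mul_neg_of_neg_of_pos (not_le.1 hneg) hn
      linarith
    · by_contra hgt
      have := mul_lt_mul_of_pos_right (not_le.1 hgt) hn
      linarith
  intro j
  fin_cases j
  · exact key _ _ hi.1.1 hi.1.2 h.1
  · exact key _ _ hi.2.1 hi.2.2 h.2.1

lemma gradient_comp_sub (f : Plane → ℝ) (a x : Plane) :
    gradient (fun y => f (y - a)) x = gradient f (x - a) := by
  simp only [gradient, fderiv_comp_sub]

/-- The trilinear stencil: the integral of a hat function against the product of the gradients of
two further ones, for nodes with the given positions relative to the second node. -/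
def stencilIntegral (h : ℝ) (a b : Plane) : ℝ :=
  ∫ x : Plane, profile h (x - a) * inner ℝ (gradient (profile h) x) (gradient (profile h) (x - b))

/-- The gradient of an interior hat vanishes outside the square, so the integral extends to the
whole plane and can be translated. One interior factor suffices; `l` and `j` may lie on the
boundary. -/
lemma energyForm_hat_translate {N : ℕ} (hN : 0 < N) {ℓ : ℕ} {i : Node N ℓ} (hi : IsInterior i)
    (l j : Node N ℓ) : energyForm (hat l) (hat i) (hat j) =
      stencilIntegral (meshWidth N ℓ) (nodePos l - nodePos i) (nodePos j - nodePos i) := by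
  unfold energyForm stencilIntegral
  rw [setIntegral_eq_integral_of_forall_compl_eq_zero]
  · rw [← integral_add_right_eq_self _ (nodePos i)]
    congr 1
    funext x
    rw [hat_eq_profile hN i, hat_eq_profile hN j, hat_eq_profile hN l, gradient_comp_sub,
      gradient_comp_sub, add_sub_cancel_right, sub_sub_eq_add_sub, sub_sub_eq_add_sub]
  · intro x hx
    have : hat i x = 0 := by
      by_contra h
      exact hx (mem_unitSquare_of_hat_ne_zero hN hi h)
    simp [gradient_hat_eq_zero this]

lemma energyForm_mul_hat_eq_zero {N : ℕ} {ℓ k m : ℕ} {i : Node N ℓ} {j : Node N k} {l : Node N m}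
    (h : ∀ x, hat l x ≠ 0 → hat i x ≠ 0 → False) : energyForm (hat l) (hat i) (hat j) = 0 := by
  unfold energyForm
  rw [integral_eq_zero_of_ae]
  refine Filter.Eventually.of_forall fun x => ?_
  by_cases hi : hat i x = 0
  · simp [gradient_hat_eq_zero hi]
  · have hl : hat l x = 0 := by
      by_contra hl
      exact h x hl hi
    simp [hl]

lemma energyForm_interpolate {N : ℕ} (hN : 0 < N) (ℓ : ℕ) (g : Plane → ℝ) {v w : Plane → ℝ}
    (hv : ∃ K, LipschitzWith K v) (hw : ∃ K, LipschitzWith K w) :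
    energyForm (interpolate N ℓ g) v w =
      ∑ l : Node N ℓ, nodalImage N ℓ g l * energyForm (hat l) v w := by
  unfold energyForm interpolate
  simp only [← integral_const_mul]
  rw [← integral_finsetSum]
  · simp only [Finset.sum_mul, mul_assoc]
  · intro l _
    exact (integrableOn_energy (continuous_hat hN l) hv hw).const_mul _

/-! ### Block relaxation for symmetric positive semidefinite systems -/

section Relaxation

variable {ι β : Type*} [Fintype ι] [DecidableEq β]

open Matrix

/-- One damped Richardson step for the block `k` of the system `A u = f`. -/
def blockStep (A : Matrix ι ι ℝ) (b : ι → β) (ω : ℝ) (f : ι → ℝ) (u : ι → ℝ) (k : β) : ι → ℝ :=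
  fun p => if b p = k then u p + ω * (f p - (A *ᵥ u) p) else u p

variable {A : Matrix ι ι ℝ} {b : ι → β} {ω cmin cmax : ℝ}

/-- The error evolves by the same step with zero right-hand side, so convergence can be studied for
the homogeneous system. -/
lemma sub_blockStep {u f : ι → ℝ} (hu : A *ᵥ u = f) (v : ι → ℝ) (k : β) :
    u - blockStep A b ω f v k = blockStep A b ω 0 (u - v) k := by
  funext p
  simp only [blockStep, Pi.sub_apply, mulVec_sub, hu, Pi.zero_apply]
  split_ifs
  · ring
  · rfl

lemma sub_foldl_blockStep {u f : ι → ℝ} (hu : A *ᵥ u = f) (l : List β) (v : ι → ℝ) :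
    u - l.foldl (blockStep A b ω f) v = l.foldl (blockStep A b ω 0) (u - v) := by
  induction l generalizing v with
  | nil => rfl
  | cons k l ih => rw [List.foldl_cons, List.foldl_cons, ih, sub_blockStep hu]

lemma foldl_blockStep_of_notMem (l : List β) (f e : ι → ℝ) (p : ι) (hp : b p ∉ l) :
    l.foldl (blockStep A b ω f) e p = e p := by
  induction l generalizing e with
  | nil => rfl
  | cons k l ih =>
    rw [List.foldl_cons, ih _ fun h => hp (List.mem_cons_of_mem _ h)]
    refine if_neg ?_
    rintro rfl
    exact hp List.mem_cons_self

variable [DecidableEq ι]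

/-- Bounds of the nonzero eigenvalues of a symmetric matrix. -/
structure SpectralBounds (A : Matrix ι ι ℝ) (cmin cmax : ℝ) : Prop where
  symm : A.IsSymm
  pos : 0 < cmin
  bounds : ∀ μ ∈ spectrum ℝ A, μ ≠ 0 → cmin ≤ μ ∧ μ ≤ cmax

namespace SpectralBounds

/-- In an orthonormal eigenbasis the three quadratic forms are diagonal, and each spectral
inequality below reduces to one about a single eigenvalue that is `0` or lies in `[cmin, cmax]`. -/
lemma exists_diagonalization (h : SpectralBounds A cmin cmax) (x : ι → ℝ) :
    ∃ (d : ι → ℝ) (y : ι → ℝ), (∀ i, d i ≠ 0 → cmin ≤ d i ∧ d i ≤ cmax) ∧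
      x ⬝ᵥ x = ∑ i, y i ^ 2 ∧ x ⬝ᵥ A *ᵥ x = ∑ i, d i * y i ^ 2 ∧
      A *ᵥ x ⬝ᵥ A *ᵥ x = ∑ i, d i ^ 2 * y i ^ 2 := by
  have hA : A.IsHermitian := by
    rw [Matrix.IsHermitian, Matrix.conjTranspose_eq_transpose_of_trivial]
    exact h.symm
  let U : Matrix ι ι ℝ := hA.eigenvectorUnitary
  have hU1 : U * Uᵀ = 1 := by
    have := Unitary.coe_mul_star_self hA.eigenvectorUnitary
    rwa [Unitary.coe_star, Matrix.star_eq_conjTranspose,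
      Matrix.conjTranspose_eq_transpose_of_trivial] at this
  have hU2 : Uᵀ * U = 1 := mul_eq_one_comm.1 hU1
  have hD : A = U * diagonal hA.eigenvalues * Uᵀ := by
    have := hA.spectral_theorem
    rw [Unitary.conjStarAlgAut_apply] at this
    exact this
  have hiso : ∀ y : ι → ℝ, U *ᵥ y ⬝ᵥ U *ᵥ y = y ⬝ᵥ y := by
    intro y
    rw [dotProduct_mulVec, vecMul_mulVec, ← mulVec_transpose]
    simp [hU2]
  have hx : U *ᵥ (Uᵀ *ᵥ x) = x := by rw [mulVec_mulVec, hU1, one_mulVec]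
  have hAx : A *ᵥ x = U *ᵥ (diagonal hA.eigenvalues *ᵥ (Uᵀ *ᵥ x)) := by
    conv_lhs => rw [hD]
    rw [mulVec_mulVec, mulVec_mulVec, Matrix.mul_assoc]
  refine ⟨hA.eigenvalues, Uᵀ *ᵥ x, fun i hi => h.bounds _ ?_ hi, ?_, ?_, ?_⟩
  · rw [hA.spectrum_real_eq_range_eigenvalues]
    exact ⟨i, rfl⟩
  · conv_lhs => rw [← hx]
    rw [hiso]
    simp [dotProduct, sq]
  · rw [hAx]
    rw [dotProduct_mulVec, ← mulVec_transpose]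
    simp [dotProduct, mulVec_diagonal, sq]
    exact Finset.sum_congr rfl fun i _ => by ring
  · rw [hAx, hiso]
    simp [dotProduct, mulVec_diagonal, sq]
    exact Finset.sum_congr rfl fun i _ => by ring

lemma form_nonneg (h : SpectralBounds A cmin cmax) (x : ι → ℝ) : 0 ≤ x ⬝ᵥ A *ᵥ x := by
  obtain ⟨d, y, hd, -, h2, -⟩ := h.exists_diagonalization x
  rw [h2]
  refine Finset.sum_nonneg fun i _ => mul_nonneg ?_ (sq_nonneg _)
  by_cases h0 : d i = 0
  · exact h0.ge
  · exact h.pos.le.trans (hd i h0).1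

lemma form_le (h : SpectralBounds A cmin cmax) (hmax : 0 ≤ cmax) (x : ι → ℝ) :
    x ⬝ᵥ A *ᵥ x ≤ cmax * (x ⬝ᵥ x) := by
  obtain ⟨d, y, hd, h1, h2, -⟩ := h.exists_diagonalization x
  rw [h1, h2, Finset.mul_sum]
  refine Finset.sum_le_sum fun i _ => mul_le_mul_of_nonneg_right ?_ (sq_nonneg _)
  by_cases h0 : d i = 0
  · rw [h0]; exact hmax
  · exact (hd i h0).2

lemma norm_mulVec_le (h : SpectralBounds A cmin cmax) (x : ι → ℝ) :
    A *ᵥ x ⬝ᵥ A *ᵥ x ≤ cmax ^ 2 * (x ⬝ᵥ x) := by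
  obtain ⟨d, y, hd, h1, -, h3⟩ := h.exists_diagonalization x
  rw [h1, h3, Finset.mul_sum]
  refine Finset.sum_le_sum fun i _ => mul_le_mul_of_nonneg_right ?_ (sq_nonneg _)
  by_cases h0 : d i = 0
  · rw [h0, zero_pow two_ne_zero]; exact sq_nonneg _
  · have := h.pos.le.trans (hd i h0).1
    exact pow_le_pow_left₀ this (hd i h0).2 2

lemma form_le_norm_mulVec (h : SpectralBounds A cmin cmax) (x : ι → ℝ) :
    cmin * (x ⬝ᵥ A *ᵥ x) ≤ A *ᵥ x ⬝ᵥ A *ᵥ x := by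
  obtain ⟨d, y, hd, -, h2, h3⟩ := h.exists_diagonalization x
  rw [h2, h3, Finset.mul_sum]
  refine Finset.sum_le_sum fun i _ => ?_
  rw [← mul_assoc]
  refine mul_le_mul_of_nonneg_right ?_ (sq_nonneg _)
  by_cases h0 : d i = 0
  · rw [h0]; simp
  · rw [sq]
    exact mul_le_mul_of_nonneg_right (hd i h0).1 (h.pos.le.trans (hd i h0).1)

end SpectralBounds

/-- The correction `w` satisfies `w·w = ω w·Ae`. Expanding the energy of `e - w` gives a decrease of
`2 w·Ae - w·Aw`, and the damping makes `w·Aw ≤ cmax w·w ≤ w·w / ω`, which uses up only half of the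
gain. -/
lemma form_blockStep_le (hA : SpectralBounds A cmin cmax) (hω : 0 < ω) (hmax : 0 < cmax)
    (hωc : ω ≤ cmax⁻¹) (e : ι → ℝ) (k : β) :
    (e - blockStep A b ω 0 e k) ⬝ᵥ (e - blockStep A b ω 0 e k) ≤
      ω * (e ⬝ᵥ A *ᵥ e - blockStep A b ω 0 e k ⬝ᵥ A *ᵥ blockStep A b ω 0 e k) := by
  set e' := blockStep A b ω 0 e k with he'
  obtain ⟨w, hw⟩ : ∃ w, w = e - e' := ⟨_, rfl⟩
  rw [← hw]
  have hwp : ∀ p, w p = if b p = k then ω * (A *ᵥ e) p else 0 := by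
    intro p
    simp only [hw, he', blockStep, Pi.sub_apply, Pi.zero_apply]
    split_ifs <;> ring
  have h1 : w ⬝ᵥ w = ω * (w ⬝ᵥ A *ᵥ e) := by
    simp only [dotProduct, Finset.mul_sum]
    refine Finset.sum_congr rfl fun p _ => ?_
    rw [hwp]
    split_ifs <;> ring
  have h2 : e ⬝ᵥ A *ᵥ w = w ⬝ᵥ A *ᵥ e := by
    rw [dotProduct_mulVec, ← mulVec_transpose, hA.symm.eq, dotProduct_comm]
  have h3 : e' = e - w := by rw [hw]; abel
  have h4 : e' ⬝ᵥ A *ᵥ e' = e ⬝ᵥ A *ᵥ e - 2 * (w ⬝ᵥ A *ᵥ e) + w ⬝ᵥ A *ᵥ w := by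
    rw [h3, mulVec_sub, dotProduct_sub, sub_dotProduct, sub_dotProduct, h2]
    ring
  have h5 := hA.form_le hmax.le w
  have h6 : 0 ≤ w ⬝ᵥ w := by
    simp only [dotProduct]
    exact Finset.sum_nonneg fun p _ => mul_self_nonneg _
  have h7 : ω * cmax ≤ 1 := by
    calc ω * cmax ≤ cmax⁻¹ * cmax := mul_le_mul_of_nonneg_right hωc hmax.le
      _ = 1 := inv_mul_cancel₀ hmax.ne'
  have h8 := mul_le_mul_of_nonneg_left h5 hω.le
  have h9 := mul_le_mul_of_nonneg_right h7 h6
  rw [h4]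
  nlinarith

/-- The total correction of a sweep is bounded by the energy decrease and bounds the initial
residual on the visited blocks. Both are proved together, adding one block at the end. -/
lemma foldl_blockStep_estimate (hA : SpectralBounds A cmin cmax) (hω : 0 < ω) (hmax : 0 < cmax)
    (hωc : ω ≤ cmax⁻¹) (e : ι → ℝ) (l : List β) (hl : l.Nodup) :
    (e - l.foldl (blockStep A b ω 0) e) ⬝ᵥ (e - l.foldl (blockStep A b ω 0) e) ≤
      ω * (e ⬝ᵥ A *ᵥ e -
        l.foldl (blockStep A b ω 0) e ⬝ᵥ A *ᵥ l.foldl (blockStep A b ω 0) e) ∧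
    ω ^ 2 * ∑ p, (if b p ∈ l then (A *ᵥ e) p ^ 2 else 0) ≤
      2 * l.length *
        ((e - l.foldl (blockStep A b ω 0) e) ⬝ᵥ (e - l.foldl (blockStep A b ω 0) e)) := by
  induction l using List.reverseRecOn with
  | nil => simp
  | append_singleton l k ih =>
    have hk : k ∉ l := by
      intro h
      exact (List.nodup_append.1 hl).2.2 k h k (List.mem_singleton_self k) rfl
    obtain ⟨ih1, ih2⟩ := ih (List.nodup_append.1 hl).1
    rw [List.foldl_append, List.foldl_cons, List.foldl_nil]
    have hnot := foldl_blockStep_of_notMem (A := A) (b := b) (ω := ω) l 0 e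
    set el := l.foldl (blockStep A b ω 0) e with hel
    have hstep := form_blockStep_le (b := b) hA hω hmax hωc el k
    set el' := blockStep A b ω 0 el k with hel'
    set w := el - el' with hw
    have hwp : ∀ p, w p = if b p = k then ω * (A *ᵥ el) p else 0 := by
      intro p
      simp only [hw, hel', blockStep, Pi.sub_apply, Pi.zero_apply]
      split_ifs <;> ring
    -- Block `k` has not been visited before, so the new correction and the accumulated one have
    -- disjoint supports.
    have horth : (e - el') ⬝ᵥ (e - el') = (e - el) ⬝ᵥ (e - el) + w ⬝ᵥ w := by
      have h1 : e - el' = (e - el) + w := by rw [hw]; abel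
      have h2 : (e - el) ⬝ᵥ w = 0 := by
        refine Finset.sum_eq_zero fun p _ => ?_
        rw [hwp]
        split_ifs with h
        · rw [Pi.sub_apply, hnot p (h ▸ hk), sub_self, zero_mul]
        · rw [mul_zero]
      rw [h1, dotProduct_add, add_dotProduct, add_dotProduct, h2, dotProduct_comm w, h2]
      ring
    have hW : 0 ≤ w ⬝ᵥ w := Finset.sum_nonneg fun p _ => mul_self_nonneg _
    have hE : 0 ≤ (e - el) ⬝ᵥ (e - el) := Finset.sum_nonneg fun p _ => mul_self_nonneg _
    refine ⟨by rw [horth]; linarith, ?_⟩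
    -- On block `k` the initial residual is the current one plus `A (e - el)`. The first part is `w
    -- / ω`, the second is at most `cmax |e - el|` in norm, and `ω cmax ≤ 1`. Each block adds at
    -- most two copies of the final squared correction, whence the factor `2 * l.length`.
    have hblock : ω ^ 2 * ∑ p, (if b p = k then (A *ᵥ e) p ^ 2 else 0) ≤
        2 * (w ⬝ᵥ w) + 2 * ((e - el) ⬝ᵥ (e - el)) := by
      have hb1 : ∀ p, ω ^ 2 * (if b p = k then (A *ᵥ e) p ^ 2 else 0) ≤
          2 * (w p * w p) + 2 * ω ^ 2 * ((A *ᵥ (e - el)) p * (A *ᵥ (e - el)) p) := by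
        intro p
        rw [hwp, mulVec_sub, Pi.sub_apply]
        split_ifs
        · nlinarith [sq_nonneg (ω * (A *ᵥ el) p - ω * ((A *ᵥ e) p - (A *ᵥ el) p))]
        · rw [mul_zero]
          have := mul_self_nonneg ((A *ᵥ e) p - (A *ᵥ el) p)
          positivity
      have hb2 := hA.norm_mulVec_le (e - el)
      have hb3 : ω ^ 2 * (cmax ^ 2) ≤ 1 := by
        have h7 : ω * cmax ≤ 1 := by
          calc ω * cmax ≤ cmax⁻¹ * cmax := mul_le_mul_of_nonneg_right hωc hmax.le
            _ = 1 := inv_mul_cancel₀ hmax.ne'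
        rw [← mul_pow]
        exact pow_le_one₀ (by positivity) h7
      calc ω ^ 2 * ∑ p, (if b p = k then (A *ᵥ e) p ^ 2 else 0)
          ≤ ∑ p, (2 * (w p * w p) + 2 * ω ^ 2 * ((A *ᵥ (e - el)) p * (A *ᵥ (e - el)) p)) := by
            rw [Finset.mul_sum]
            exact Finset.sum_le_sum fun p _ => hb1 p
        _ = 2 * (w ⬝ᵥ w) + 2 * (ω ^ 2 * (A *ᵥ (e - el) ⬝ᵥ A *ᵥ (e - el))) := by
            rw [Finset.sum_add_distrib, ← Finset.mul_sum, ← Finset.mul_sum]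
            simp only [dotProduct]
            ring
        _ ≤ _ := by
            have := mul_le_mul_of_nonneg_left hb2 (sq_nonneg ω)
            have := mul_le_mul_of_nonneg_right hb3 hE
            nlinarith
    have hsplit : ∑ p, (if b p ∈ l ++ [k] then (A *ᵥ e) p ^ 2 else 0) =
        ∑ p, (if b p ∈ l then (A *ᵥ e) p ^ 2 else 0) +
          ∑ p, (if b p = k then (A *ᵥ e) p ^ 2 else 0) := by
      rw [← Finset.sum_add_distrib]
      refine Finset.sum_congr rfl fun p _ => ?_
      by_cases h : b p = k
      · simp [h, hk]
      · simp [h]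
    rw [hsplit, mul_add, horth, List.length_append, List.length_singleton]
    push_cast
    have : 0 ≤ (l.length : ℝ) * (w ⬝ᵥ w) := by positivity
    nlinarith

/-- A sweep through all blocks contracts the energy of the error. -/
lemma form_foldl_blockStep_le (hA : SpectralBounds A cmin cmax) (hω : 0 < ω) (hmax : 0 < cmax)
    (hωc : ω ≤ cmax⁻¹) (e : ι → ℝ) (l : List β) (hl : l.Nodup) (hall : ∀ p, b p ∈ l)
    (hlen : 0 < l.length) :
    l.foldl (blockStep A b ω 0) e ⬝ᵥ A *ᵥ l.foldl (blockStep A b ω 0) e ≤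
      (1 - cmin * ω / (2 * l.length)) * (e ⬝ᵥ A *ᵥ e) := by
  obtain ⟨h1, h2⟩ := foldl_blockStep_estimate (b := b) hA hω hmax hωc e l hl
  simp only [hall, if_true] at h2
  have h3 := hA.form_le_norm_mulVec e
  have h4 : A *ᵥ e ⬝ᵥ A *ᵥ e = ∑ p, (A *ᵥ e) p ^ 2 := by simp [dotProduct, sq]
  rw [← h4] at h2
  set q := e ⬝ᵥ A *ᵥ e
  set q' := l.foldl (blockStep A b ω 0) e ⬝ᵥ A *ᵥ l.foldl (blockStep A b ω 0) e
  have hn : (0 : ℝ) < l.length := by exact_mod_cast hlen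
  have h5 : ω ^ 2 * (cmin * q) ≤ 2 * l.length * (ω * (q - q')) :=
    (mul_le_mul_of_nonneg_left h3 (sq_nonneg ω)).trans
      (h2.trans (mul_le_mul_of_nonneg_left h1 (by positivity)))
  have h6 : ω * (cmin * q) ≤ 2 * l.length * (q - q') := by
    refine le_of_mul_le_mul_left ?_ hω
    linarith
  have h7 : cmin * ω / (2 * l.length) * q ≤ q - q' := by
    rw [div_mul_eq_mul_div, div_le_iff₀ (by positivity)]
    linarith
  linarith

end Relaxation

/-! ### Folding along consecutive levels -/

/-- Two folds run in parallel under an invariant indexed by the level to be processed next. The last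
step has no successor, so there the invariant stays at the same level (`h₁`); this is the level at
which the opposite sweep starts. -/
lemma foldl_isChain {α S U : Type*} {R : α → α → Prop} {stepS : S → α → S} {stepU : U → α → U}
    {I : S → U → α → Prop} (h₁ : ∀ s u k, I s u k → I (stepS s k) (stepU u k) k)
    (h₂ : ∀ s u k k', R k k' → I s u k → I (stepS s k) (stepU u k) k') (t : List α) :
    ∀ (k : α) (s : S) (u : U), (k :: t).IsChain R → I s u k →
      I ((k :: t).foldl stepS s) ((k :: t).foldl stepU u) ((k :: t).getLast (List.cons_ne_nil _ _)) := by
  induction t with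
  | nil => intro k s u _ h; exact h₁ s u k h
  | cons k' t ih =>
    intro k s u hc h
    rw [List.isChain_cons_cons] at hc
    rw [List.getLast_cons (List.cons_ne_nil _ _), List.foldl_cons, List.foldl_cons]
    exact ih k' _ _ hc.2 (h₂ s u k k' hc.1 h)

lemma isChain_finRange (L : ℕ) :
    (List.finRange L).IsChain fun a b : Fin L => (b : ℕ) = a + 1 := by
  rw [List.isChain_iff_getElem]
  intro i hi
  simp

lemma finRange_eq_cons {L : ℕ} (hL : 0 < L) : ∃ t, List.finRange L = ⟨0, hL⟩ :: t := by
  obtain ⟨n, rfl⟩ : ∃ n, L = n + 1 := ⟨L - 1, by omega⟩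
  exact ⟨_, List.finRange_succ⟩

lemma finRange_reverse_eq_cons {L : ℕ} (hL : 0 < L) :
    ∃ t, (List.finRange L).reverse = finest hL :: t := by
  obtain ⟨n, rfl⟩ : ∃ n, L = n + 1 := ⟨L - 1, by omega⟩
  rw [List.finRange_succ_last, List.reverse_append]
  exact ⟨_, rfl⟩

/-- Folding from the finest to the coarsest level. -/
lemma foldl_down {L : ℕ} (hL : 0 < L) {S U : Type*} {stepS : S → Fin L → S} {stepU : U → Fin L → U}
    {I : S → U → Fin L → Prop} (h₁ : ∀ s u k, I s u k → I (stepS s k) (stepU u k) k)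
    (h₂ : ∀ s u (k k' : Fin L), (k : ℕ) = k' + 1 → I s u k → I (stepS s k) (stepU u k) k')
    {s : S} {u : U} (h : I s u (finest hL)) :
    I ((List.finRange L).reverse.foldl stepS s) ((List.finRange L).reverse.foldl stepU u) ⟨0, hL⟩ := by
  have hc : (List.finRange L).reverse.IsChain fun a b : Fin L => (a : ℕ) = b + 1 := by
    rw [List.isChain_reverse]
    exact isChain_finRange L
  obtain ⟨t, ht⟩ := finRange_reverse_eq_cons hL
  obtain ⟨t', ht'⟩ := finRange_eq_cons hL
  have hlast : (finest hL :: t).getLast (List.cons_ne_nil _ _) = ⟨0, hL⟩ := by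
    simp only [← ht, List.getLast_reverse, ht', List.head_cons]
  rw [ht] at hc ⊢
  rw [← hlast]
  exact foldl_isChain h₁ h₂ t _ s u hc h

/-- Folding from the coarsest to the finest level. -/
lemma foldl_up {L : ℕ} (hL : 0 < L) {S U : Type*} {stepS : S → Fin L → S} {stepU : U → Fin L → U}
    {I : S → U → Fin L → Prop} (h₁ : ∀ s u k, I s u k → I (stepS s k) (stepU u k) k)
    (h₂ : ∀ s u (k k' : Fin L), (k' : ℕ) = k + 1 → I s u k → I (stepS s k) (stepU u k) k')
    {s : S} {u : U} (h : I s u ⟨0, hL⟩) :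
    I ((List.finRange L).foldl stepS s) ((List.finRange L).foldl stepU u) (finest hL) := by
  have hc := isChain_finRange L
  obtain ⟨t, ht⟩ := finRange_reverse_eq_cons hL
  obtain ⟨t', ht'⟩ := finRange_eq_cons hL
  have hlast : (⟨0, hL⟩ :: t').getLast (List.cons_ne_nil _ _) = finest hL := by
    simp only [← ht', List.getLast_eq_head_reverse, ht, List.head_cons]
  rw [ht'] at hc ⊢
  rw [← hlast]
  exact foldl_isChain h₁ h₂ t' _ s u hc h

namespace LocalGrid

open Matrix

variable {N L : ℕ} (G : LocalGrid N L)

/-! ### The exact auxiliary quantities of the multigrid iteration -/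

open Classical in
/-- The coefficients of one level, extended by zero to all nodes. -/
def fullExtend (u : G.Dof → ℝ) (k : Fin L) : Node N k → ℝ :=
  fun i => if h : i ∈ G.nodes k then u ⟨k, ⟨i, h⟩⟩ else 0

/-- Nodal values of the part of the approximation that belongs to coarser levels. -/
def coarsePart (u : G.Dof → ℝ) (k : Fin L) (j : Node N k) : ℝ :=
  ∑ l ∈ Finset.univ.filter (· < k), ∑ i : Node N l, G.fullExtend u l i * hat i (nodePos j)

/-- The operator applied to the part of the approximation that belongs to finer levels. -/
def finePart (κ : Plane → ℝ) (u : G.Dof → ℝ) (k : Fin L) (j : Node N k) : ℝ :=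
  ∑ l ∈ Finset.univ.filter (k < ·), ∑ i : Node N l, G.fullExtend u l i * entry κ j i

variable {G}

lemma fullExtend_of_mem (u : G.Dof → ℝ) {k : Fin L} (i : G.nodes k) :
    G.fullExtend u k i = u ⟨k, i⟩ := by
  rw [fullExtend, dif_pos i.2]

lemma fullExtend_of_notMem (u : G.Dof → ℝ) {k : Fin L} {i : Node N k} (h : i ∉ G.nodes k) :
    G.fullExtend u k i = 0 := dif_neg h

lemma sum_nodes (u : G.Dof → ℝ) (k : Fin L) (F : Node N k → ℝ) :
    ∑ i : G.nodes k, u ⟨k, i⟩ * F i = ∑ i : Node N k, G.fullExtend u k i * F i := by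
  simp only [← fullExtend_of_mem u]
  rw [Finset.sum_coe_sort (G.nodes k) fun i => G.fullExtend u k i * F i]
  refine Finset.sum_subset (Finset.subset_univ _) fun i _ hi => ?_
  rw [fullExtend_of_notMem u hi, zero_mul]

lemma entry_comm (κ : Plane → ℝ) {k l : Fin L} (i : Node N k) (j : Node N l) :
    entry κ i j = entry κ j i := energyForm_comm _ _ _

lemma entry_eq_sum (hN : 0 < N) {κ : Plane → ℝ} (hκ : Continuous κ) {k l m : Fin L} (h : l ≤ m)
    (i : Node N k) (j : Node N l) :
    entry κ i j = ∑ j' : Node N m, hat j (nodePos j') * entry κ i j' :=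
  energyForm_hat_eq_sum hN hκ (exists_lipschitzWith_hat hN i) h j

lemma filter_lt_succ {k k' : Fin L} (h : (k' : ℕ) = k + 1) :
    Finset.univ.filter (· < k') = insert k (Finset.univ.filter (· < k)) := by
  ext l
  simp only [Finset.mem_filter_univ, Finset.mem_insert, Fin.lt_def, Fin.ext_iff]
  omega

lemma filter_gt_succ {k k' : Fin L} (h : (k' : ℕ) = k + 1) :
    Finset.univ.filter (k < ·) = insert k' (Finset.univ.filter (k' < ·)) := by
  ext l
  simp only [Finset.mem_filter_univ, Finset.mem_insert, Fin.lt_def, Fin.ext_iff]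
  omega

lemma coarsePart_zero (u : G.Dof → ℝ) {k : Fin L} (h : (k : ℕ) = 0) : G.coarsePart u k = 0 := by
  funext j
  rw [coarsePart, Finset.filter_false_of_mem, Finset.sum_empty, Pi.zero_apply]
  intro l _
  rw [Fin.lt_def]
  omega

lemma finePart_finest (κ : Plane → ℝ) (u : G.Dof → ℝ) {k : Fin L} (h : ¬ (k : ℕ) + 1 < L) :
    G.finePart κ u k = 0 := by
  funext j
  rw [finePart, Finset.filter_false_of_mem, Finset.sum_empty, Pi.zero_apply]
  intro l _
  rw [Fin.lt_def]
  omega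

/-- Functions of levels up to `k` are determined by their nodal values on level `k`, so the
recursion of the algorithm for `ũ` is exact. -/
lemma coarsePart_succ (hN : 0 < N) (u : G.Dof → ℝ) {k k' : Fin L} (h : (k' : ℕ) = k + 1)
    (j : Node N k') : G.coarsePart u k' j =
      ∑ i : Node N k, hat i (nodePos j) * (G.coarsePart u k i + G.fullExtend u k i) := by
  rw [coarsePart, filter_lt_succ h, Finset.sum_insert (by simp)]
  simp only [mul_add, Finset.sum_add_distrib]
  rw [add_comm]
  congr 1
  · simp only [coarsePart, Finset.mul_sum]
    rw [Finset.sum_comm]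
    refine Finset.sum_congr rfl fun l hl => ?_
    rw [Finset.sum_comm]
    refine Finset.sum_congr rfl fun i _ => ?_
    have hlk : (l : ℕ) ≤ k := (Finset.mem_filter.1 hl).2.le
    rw [hat_eq_sum hN hlk i (nodePos_mem hN j), Finset.mul_sum]
    exact Finset.sum_congr rfl fun _ _ => by ring
  · exact Finset.sum_congr rfl fun _ _ => mul_comm _ _

/-- Dual to `coarsePart_succ`: the test function of level `k` is expanded in the hats of level `k'`,
simultaneously against all finer levels. -/
lemma finePart_pred (hN : 0 < N) {κ : Plane → ℝ} (hκ : Continuous κ) (u : G.Dof → ℝ)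
    {k k' : Fin L} (h : (k' : ℕ) = k + 1) (j : Node N k) : G.finePart κ u k j =
      ∑ j' : Node N k', hat j (nodePos j') *
        (G.finePart κ u k' j' + ∑ i : Node N k', G.fullExtend u k' i * entry κ i j') := by
  have hkk : k ≤ k' := by rw [Fin.le_def]; omega
  have e : ∀ (l : Fin L) (i : Node N l), G.fullExtend u l i * entry κ j i =
      ∑ j' : Node N k', hat j (nodePos j') * (G.fullExtend u l i * entry κ j' i) := by
    intro l i
    rw [entry_comm κ j i, entry_eq_sum hN hκ hkk, Finset.mul_sum]
    refine Finset.sum_congr rfl fun j' _ => ?_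
    rw [entry_comm κ i j']
    ring
  rw [finePart, filter_gt_succ h, Finset.sum_insert (by simp), add_comm]
  simp only [mul_add, Finset.sum_add_distrib]
  congr 1
  · simp only [finePart, Finset.mul_sum]
    rw [Finset.sum_comm]
    refine Finset.sum_congr rfl fun l _ => ?_
    rw [Finset.sum_comm]
    exact Finset.sum_congr rfl fun i _ => e l i
  · rw [Finset.sum_congr rfl fun i _ => e k' i, Finset.sum_comm]
    refine Finset.sum_congr rfl fun j' _ => ?_
    rw [Finset.mul_sum]
    exact Finset.sum_congr rfl fun i _ => by rw [entry_comm κ i j']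

/-- A row of the full system splits into coarser levels, level `k` and finer levels. The first two
act through nodal values on level `k`, so only the single-level operator is needed: this is the
bracket in the smoothing step. -/
lemma stiffness_mulVec (hN : 0 < N) {κ : Plane → ℝ} (hκ : Continuous κ) (u : G.Dof → ℝ)
    {k : Fin L} (i : G.nodes k) : (G.stiffness κ *ᵥ u) ⟨k, i⟩ =
      ∑ j : Node N k, entry κ (i : Node N k) j * (G.coarsePart u k j + G.fullExtend u k j) +
        G.finePart κ u k i := by
  have h1 : (G.stiffness κ *ᵥ u) ⟨k, i⟩ =
      ∑ l : Fin L, ∑ j : Node N l, G.fullExtend u l j * entry κ (i : Node N k) j := by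
    rw [mulVec, dotProduct, Fintype.sum_sigma]
    refine Finset.sum_congr rfl fun l _ => ?_
    rw [← sum_nodes]
    exact Finset.sum_congr rfl fun j _ => mul_comm _ _
  have h2 : (Finset.univ : Finset (Fin L)) = (Finset.univ.filter (· < k) ∪ {k}) ∪
      Finset.univ.filter (k < ·) := by
    ext l
    simp only [Finset.mem_univ, Finset.mem_union, Finset.mem_filter_univ, Finset.mem_singleton,
      true_iff]
    rcases lt_trichotomy l k with h | h | h <;> simp [h]
  rw [h1, h2, Finset.sum_union, Finset.sum_union, finePart, Finset.sum_singleton]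
  · congr 1
    simp only [mul_add, Finset.sum_add_distrib]
    congr 1
    · simp only [coarsePart, Finset.mul_sum]
      rw [Finset.sum_comm]
      refine Finset.sum_congr rfl fun l hl => ?_
      rw [Finset.sum_comm]
      refine Finset.sum_congr rfl fun j _ => ?_
      rw [entry_eq_sum hN hκ (Finset.mem_filter.1 hl).2.le, Finset.mul_sum]
      exact Finset.sum_congr rfl fun _ _ => by ring
    · exact Finset.sum_congr rfl fun _ _ => mul_comm _ _
  · rw [Finset.disjoint_singleton_right]
    simp
  · rw [Finset.disjoint_left]
    intro l hl hl'
    simp only [Finset.mem_union, Finset.mem_filter_univ, Finset.mem_singleton] at hl hl'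
    rcases hl with h | h
    · exact lt_asymm h hl'
    · exact hl'.ne' h

/-! ### One step of the relaxation -/

variable (G) in
/-- The damped Richardson step for level `k`. -/
def levelStep (κ : Plane → ℝ) (ω : ℝ) (f u : G.Dof → ℝ) (k : Fin L) : G.Dof → ℝ :=
  blockStep (G.stiffness κ) Sigma.fst ω f u k

variable {κ : Plane → ℝ} {ω : ℝ} {f u : G.Dof → ℝ}

lemma fullExtend_levelStep_of_ne {k l : Fin L} (h : l ≠ k) :
    G.fullExtend (G.levelStep κ ω f u k) l = G.fullExtend u l := by
  funext i
  unfold fullExtend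
  split_ifs
  · exact if_neg h
  · rfl

lemma coarsePart_levelStep {k l : Fin L} (h : l ≤ k) :
    G.coarsePart (G.levelStep κ ω f u k) l = G.coarsePart u l := by
  funext j
  refine Finset.sum_congr rfl fun m hm => ?_
  rw [fullExtend_levelStep_of_ne ((Finset.mem_filter.1 hm).2.trans_le h).ne]

lemma finePart_levelStep {k l : Fin L} (h : k ≤ l) :
    G.finePart κ (G.levelStep κ ω f u k) l = G.finePart κ u l := by
  funext j
  refine Finset.sum_congr rfl fun m hm => ?_
  rw [fullExtend_levelStep_of_ne (h.trans_lt (Finset.mem_filter.1 hm).2).ne']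

lemma levelStep_apply_self (hN : 0 < N) (hκ : Continuous κ) {k : Fin L} (i : G.nodes k) :
    G.levelStep κ ω f u k ⟨k, i⟩ = u ⟨k, i⟩ + ω * (f ⟨k, i⟩ -
      (∑ j : Node N k, entry κ (i : Node N k) j * (G.coarsePart u k j + G.fullExtend u k j) +
        G.finePart κ u k i)) := by
  rw [← stiffness_mulVec hN hκ]
  exact if_pos rfl

variable (G) in
/-- One run of the relaxation: all levels from fine to coarse, then from coarse to fine. -/
def relaxRun (κ : Plane → ℝ) (ω : ℝ) (f u : G.Dof → ℝ) : G.Dof → ℝ :=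
  (List.finRange L).foldl (G.levelStep κ ω f)
    ((List.finRange L).reverse.foldl (G.levelStep κ ω f) u)

/-! ### Localization to the closures of the levels -/

lemma levelSupport_subset (hG : G.Nested) {k l : Fin L} (h : k ≤ l) :
    G.levelSupport l ⊆ G.levelSupport k := by
  obtain ⟨l, hl⟩ := l
  obtain ⟨m, rfl⟩ := Nat.exists_eq_add_of_le (show (k : ℕ) ≤ l from h)
  clear h
  induction m with
  | zero => exact subset_rfl
  | succ m ih =>
    exact (hG ⟨k + m, by omega⟩ ⟨k + (m + 1), hl⟩ rfl).trans (ih (by omega))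

lemma mem_closureNodes_iff {k : Fin L} {i : Node N k} : i ∈ G.closureNodes k ↔
    i ∈ G.nodes k ∨ (tsupport (hat i) ∩ G.levelSupport k).Nonempty := by
  simp only [closureNodes, Finset.mem_union, Finset.mem_filter_univ]

lemma tsupport_subset_levelSupport {k : Fin L} {i : Node N k} (hi : i ∈ G.nodes k) :
    tsupport (hat i) ⊆ G.levelSupport k :=
  Set.subset_biUnion_of_mem (u := fun i : Node N k => tsupport (hat i)) hi

lemma nodePos_mem_tsupport (hN : 0 < N) {ℓ : ℕ} (i : Node N ℓ) : nodePos i ∈ tsupport (hat i) := by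
  refine subset_tsupport _ ?_
  rw [Function.mem_support, hat_nodePos_self hN, if_pos rfl]
  exact one_ne_zero

lemma nonempty_of_mem_closureNodes (hN : 0 < N) {k : Fin L} {i : Node N k}
    (hi : i ∈ G.closureNodes k) : (tsupport (hat i) ∩ G.levelSupport k).Nonempty := by
  rcases mem_closureNodes_iff.1 hi with h | h
  · exact ⟨nodePos i, nodePos_mem_tsupport hN i,
      tsupport_subset_levelSupport h (nodePos_mem_tsupport hN i)⟩
  · exact h

/-- By nestedness the active hats of finer levels live on the support of `V^k`, which the hats
outside the closure do not meet. -/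
lemma entry_eq_zero_of_notMem_closure (hG : G.Nested) {k l : Fin L} (h : k ≤ l) {i : Node N l}
    (hi : i ∈ G.nodes l) {j : Node N k} (hj : j ∉ G.closureNodes k) : entry κ j i = 0 := by
  refine energyForm_hat_eq_zero fun x hx hx' => hj (mem_closureNodes_iff.2 (Or.inr ⟨x, ?_, ?_⟩))
  · exact subset_tsupport _ hx
  · exact levelSupport_subset hG h (tsupport_subset_levelSupport hi (subset_tsupport _ hx'))

lemma finePart_eq_zero_of_notMem_closure (hG : G.Nested) {k : Fin L} {j : Node N k}
    (hj : j ∉ G.closureNodes k) : G.finePart κ u k j = 0 := by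
  refine Finset.sum_eq_zero fun l hl => Finset.sum_eq_zero fun i _ => ?_
  by_cases hi : i ∈ G.nodes l
  · rw [entry_eq_zero_of_notMem_closure hG (Finset.mem_filter.1 hl).2.le hi hj, mul_zero]
  · rw [fullExtend_of_notMem u hi, zero_mul]

/-- If the coarse hat is nonzero at `j`, its support contains that of the hat of `j`, which meets
the support of `V^{k'}` and hence that of `V^k`. So prolongation to a closure reads nothing outside
the coarser closure. -/
lemma hat_nodePos_eq_zero_of_notMem_closure (hN : 0 < N) (hG : G.Nested) {k k' : Fin L}
    (h : (k' : ℕ) = k + 1) {i : Node N k} (hi : i ∉ G.closureNodes k) {j : Node N k'}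
    (hj : j ∈ G.closureNodes k') : hat i (nodePos j) = 0 := by
  by_contra h0
  obtain ⟨x, hx, hx'⟩ := nonempty_of_mem_closureNodes hN hj
  refine hi (mem_closureNodes_iff.2 (Or.inr ⟨x, ?_, hG k k' h hx'⟩))
  obtain ⟨k', hk'⟩ := k'
  subst h
  exact tsupport_hat_subset hN h0 hx

lemma sum_closureNodes {k : Fin L} {F : Node N k → ℝ} (hF : ∀ i ∉ G.closureNodes k, F i = 0) :
    ∑ i : G.closureNodes k, F i = ∑ i : Node N k, F i := by
  rw [Finset.sum_coe_sort (G.closureNodes k) F]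
  exact Finset.sum_subset (Finset.subset_univ _) fun i _ hi => hF i hi

lemma extend_eq (u : G.Dof → ℝ) {k : Fin L} (i : G.closureNodes k) :
    G.extend (fun j => u ⟨k, j⟩) i = G.fullExtend u k i := rfl

lemma coarsePart_succ_closure (hN : 0 < N) (hG : G.Nested) {k k' : Fin L} (h : (k' : ℕ) = k + 1)
    {v : G.closureNodes k → ℝ} (hv : ∀ i : G.closureNodes k, v i = G.coarsePart u k i)
    (j : G.closureNodes k') :
    (G.prolongation k k' *ᵥ (v + G.extend fun i => u ⟨k, i⟩)) j = G.coarsePart u k' j := by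
  rw [coarsePart_succ hN u h, mulVec, dotProduct, ← sum_closureNodes]
  · refine Finset.sum_congr rfl fun i _ => ?_
    rw [Pi.add_apply, extend_eq, hv]
    rfl
  · intro i hi
    rw [hat_nodePos_eq_zero_of_notMem_closure hN hG h hi j.2, zero_mul]

lemma levelStiffness_transpose_mulVec {k : Fin L} (j : G.closureNodes k) :
    ((G.levelStiffness κ k)ᵀ *ᵥ fun i => u ⟨k, i⟩) j =
      ∑ i : Node N k, G.fullExtend u k i * entry κ i (j : Node N k) := by
  rw [← sum_nodes u k fun i => entry κ i (j : Node N k)]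
  exact Finset.sum_congr rfl fun i _ => mul_comm _ _

lemma finePart_pred_closure (hN : 0 < N) (hκ : Continuous κ) (hG : G.Nested) {k k' : Fin L}
    (h : (k' : ℕ) = k + 1) {v : G.closureNodes k' → ℝ}
    (hv : ∀ i : G.closureNodes k', v i = G.finePart κ u k' i) (j : G.closureNodes k) :
    ((G.prolongation k k')ᵀ *ᵥ (v + (G.levelStiffness κ k')ᵀ *ᵥ fun i => u ⟨k', i⟩)) j =
      G.finePart κ u k j := by
  rw [finePart_pred hN hκ u h, mulVec, dotProduct, ← sum_closureNodes]
  · refine Finset.sum_congr rfl fun i _ => ?_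
    rw [Pi.add_apply, levelStiffness_transpose_mulVec, hv]
    rfl
  · intro j' hj'
    rw [finePart_eq_zero_of_notMem_closure hG hj', Finset.sum_eq_zero, zero_add, mul_zero]
    intro i _
    by_cases hi : i ∈ G.nodes k'
    · rw [entry_comm, entry_eq_zero_of_notMem_closure hG le_rfl hi hj', mul_zero]
    · rw [fullExtend_of_notMem u hi, zero_mul]

lemma levelStiffness_mulVec (hG : G.Nested) {k : Fin L} {v : G.closureNodes k → ℝ}
    {w : Node N k → ℝ} (hv : ∀ j : G.closureNodes k, v j = w j) (i : G.nodes k) :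
    (G.levelStiffness κ k *ᵥ v) i = ∑ j : Node N k, entry κ (i : Node N k) j * w j := by
  rw [mulVec, dotProduct, ← sum_closureNodes]
  · refine Finset.sum_congr rfl fun j _ => ?_
    rw [hv]
    rfl
  · intro j hj
    rw [entry_comm, entry_eq_zero_of_notMem_closure hG le_rfl i.2 hj, zero_mul]

/-! ### The multigrid algorithm is the relaxation -/

/-- The variables of the algorithm are up to date when level `k` is to be processed. -/
structure Consistent (κ : Plane → ℝ) (s : G.State) (u : G.Dof → ℝ) (k : Fin L) : Prop where
  u_eq : ∀ l i, s.u l i = u ⟨l, i⟩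
  tilde_eq : ∀ l ≤ k, ∀ i : G.closureNodes l, s.tilde l i = G.coarsePart u l i
  bar_eq : ∀ l, k ≤ l → ∀ i : G.closureNodes l, s.bar l i = G.finePart κ u l i

lemma Consistent.u_eq' {s : G.State} {k : Fin L} (h : Consistent κ s u k) (l : Fin L) :
    s.u l = fun i => u ⟨l, i⟩ := funext fun i => h.u_eq l i

/-- Changing level `k` affects neither the coarse parts of levels up to `k` nor the fine parts of
levels from `k` on, so everything the invariant claims stays valid. -/
lemma Consistent.smooth (hN : 0 < N) (hκ : Continuous κ) (hG : G.Nested) {s : G.State} {k : Fin L}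
    (h : Consistent κ s u k) :
    Consistent κ (G.smooth κ ω (fun k i => f ⟨k, i⟩) s k) (G.levelStep κ ω f u k) k where
  u_eq l i := by
    unfold LocalGrid.smooth
    by_cases hl : l = k
    · subst hl
      simp only [Function.update_self, Pi.add_apply, Pi.smul_apply, Pi.sub_apply, smul_eq_mul]
      rw [levelStep_apply_self hN hκ, h.u_eq]
      congr 3
      congr 1
      · refine levelStiffness_mulVec hG (fun j => ?_) i
        rw [Pi.add_apply, h.u_eq', extend_eq, h.tilde_eq l le_rfl, add_comm]
      · exact h.bar_eq l le_rfl _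
    · simp only [Function.update_of_ne hl]
      rw [h.u_eq]
      exact (if_neg hl).symm
  tilde_eq l hl i := by
    rw [coarsePart_levelStep hl]
    exact h.tilde_eq l hl i
  bar_eq l hl i := by
    rw [finePart_levelStep hl]
    exact h.bar_eq l hl i

/-- The update writes to level `k - 1`, about which the invariant at `k` makes no claim for `bar`.
-/
lemma Consistent.updateBar_self {s : G.State} {k : Fin L} (h : Consistent κ s u k) :
    Consistent κ (G.updateBar κ s k) u k := by
  unfold updateBar
  split_ifs with hk
  · refine ⟨h.u_eq, h.tilde_eq, fun l hl i => ?_⟩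
    dsimp only
    rw [Function.update_of_ne]
    · exact h.bar_eq l hl i
    · intro h'
      rw [Fin.le_def, h'] at hl
      simp only at hl
      omega
  · exact h

lemma Consistent.updateBar (hN : 0 < N) (hκ : Continuous κ) (hG : G.Nested) {s : G.State}
    {k k' : Fin L} (hk : (k : ℕ) = k' + 1) (h : Consistent κ s u k) :
    Consistent κ (G.updateBar κ s k) u k' := by
  obtain rfl : k' = ⟨(k : ℕ) - 1, lt_of_le_of_lt (Nat.sub_le _ _) k.2⟩ := by
    rw [Fin.ext_iff]
    simp only
    omega
  unfold LocalGrid.updateBar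
  rw [if_pos (by omega)]
  dsimp only
  refine ⟨h.u_eq, fun l hl => h.tilde_eq l (hl.trans ?_), fun l hl i => ?_⟩
  · rw [Fin.le_def]; omega
  · dsimp only
    by_cases hl' : l = ⟨(k : ℕ) - 1, lt_of_le_of_lt (Nat.sub_le _ _) k.2⟩
    · subst hl'
      rw [Function.update_self, h.u_eq']
      exact finePart_pred_closure hN hκ hG hk (h.bar_eq k le_rfl) i
    · rw [Function.update_of_ne hl']
      refine h.bar_eq l ?_ i
      rw [Fin.le_def] at hl ⊢
      rw [Fin.ext_iff] at hl'
      omega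

lemma Consistent.updateTilde_self {s : G.State} {k : Fin L} (h : Consistent κ s u k) :
    Consistent κ (G.updateTilde s k) u k := by
  unfold updateTilde
  split_ifs with hk
  · refine ⟨h.u_eq, fun l hl i => ?_, h.bar_eq⟩
    dsimp only
    rw [Function.update_of_ne]
    · exact h.tilde_eq l hl i
    · intro h'
      rw [Fin.le_def, h'] at hl
      simp only at hl
      omega
  · exact h

lemma Consistent.updateTilde (hN : 0 < N) (hG : G.Nested) {s : G.State}
    {k k' : Fin L} (hk : (k' : ℕ) = k + 1) (h : Consistent κ s u k) :
    Consistent κ (G.updateTilde s k) u k' := by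
  have hlt : (k : ℕ) + 1 < L := hk ▸ k'.2
  obtain rfl : k' = ⟨(k : ℕ) + 1, hlt⟩ := Fin.ext hk
  unfold LocalGrid.updateTilde
  rw [dif_pos hlt]
  dsimp only
  refine ⟨h.u_eq, fun l hl i => ?_, fun l hl => h.bar_eq l (le_trans ?_ hl)⟩
  · dsimp only
    by_cases hl' : l = ⟨(k : ℕ) + 1, hlt⟩
    · subst hl'
      rw [Function.update_self, h.u_eq']
      exact coarsePart_succ_closure hN hG hk (h.tilde_eq k le_rfl) i
    · rw [Function.update_of_ne hl']
      refine h.tilde_eq l ?_ i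
      rw [Fin.le_def] at hl ⊢
      rw [Fin.ext_iff] at hl'
      omega
  · rw [Fin.le_def]; omega

lemma tildeInit_eq (hN : 0 < N) (hG : G.Nested) (u : G.Dof → ℝ) (k : ℕ) (hk : k < L)
    (i : G.closureNodes ⟨k, hk⟩) :
    G.tildeInit (fun k i => u ⟨k, i⟩) k hk i = G.coarsePart u ⟨k, hk⟩ i := by
  induction k with
  | zero => rw [tildeInit, coarsePart_zero u rfl]; rfl
  | succ k ih =>
    rw [tildeInit]
    exact coarsePart_succ_closure hN hG rfl (ih _) i

lemma barInit_eq (hN : 0 < N) (hκ : Continuous κ) (hG : G.Nested) (u : G.Dof → ℝ) (k : ℕ)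
    (hk : k < L) (i : G.closureNodes ⟨k, hk⟩) :
    G.barInit κ (fun k i => u ⟨k, i⟩) k hk i = G.finePart κ u ⟨k, hk⟩ i := by
  rw [barInit]
  split_ifs with h
  · exact finePart_pred_closure hN hκ hG rfl (barInit_eq hN hκ hG u (k + 1) h) i
  · rw [finePart_finest κ u h]; rfl
termination_by L - k

lemma llmg_eq_relaxRun (hN : 0 < N) (hL : 0 < L) (hκ : Continuous κ) (hG : G.Nested)
    (f u : G.Dof → ℝ) : G.llmg κ ω f u = G.relaxRun κ ω f u := by
  have h0 : Consistent κ (⟨fun k i => u ⟨k, i⟩, fun k => G.tildeInit (fun k i => u ⟨k, i⟩) k k.2,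
      fun k => G.barInit κ (fun k i => u ⟨k, i⟩) k k.2⟩ : G.State) u (finest hL) :=
    ⟨fun _ _ => rfl, fun l _ i => tildeInit_eq hN hG u l l.2 i,
      fun l _ i => barInit_eq hN hκ hG u l l.2 i⟩
  have h1 := foldl_down hL
    (stepS := fun s k => G.updateBar κ (G.smooth κ ω (fun k i => f ⟨k, i⟩) s k) k)
    (stepU := G.levelStep κ ω f) (I := Consistent κ)
    (fun s u k h => (h.smooth hN hκ hG).updateBar_self)
    (fun s u k k' hk h => (h.smooth hN hκ hG).updateBar hN hκ hG hk) h0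
  have h2 := foldl_up hL
    (stepS := fun s k => G.updateTilde (G.smooth κ ω (fun k i => f ⟨k, i⟩) s k) k)
    (stepU := G.levelStep κ ω f) (I := Consistent κ)
    (fun s u k h => (h.smooth hN hκ hG).updateTilde_self)
    (fun s u k k' hk h => (h.smooth hN hκ hG).updateTilde hN hG hk) h1
  funext p
  exact h2.u_eq p.1 p.2

end LocalGrid

/-! ### Straight-line programs of convolutional layers -/

section Network

variable {N L : ℕ} {X : Type}

/-- Extension of an environment by one feature map. -/
def consEnv {s : Shape L} {ctx : List (Shape L)} (v : FeatureMap N s) (E : Env N ctx) :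
    Env N (s :: ctx) :=
  fun p => Fin.cases (motive := fun p => FeatureMap N ((_ :: _ : List (Shape L)).get p)) v E p

/-- The feature maps `E x` can be computed from the input images with at most `n` parameters. -/
def IsPrefix (σ : ℝ → ℝ) (active : ∀ k : Fin L, Finset (Node N k)) (hL : 0 < L)
    (a b : X → Node N (finest hL) → ℝ) (n : ℕ) (ctx : List (Shape L)) (E : X → Env N ctx) : Prop :=
  ∃ F : CNN ctx → CNN (inputShape hL), ∀ Ψ, (F Ψ).numParams ≤ n + Ψ.numParams ∧
    ∀ x, (F Ψ).eval σ active (inputEnv hL (a x) (b x)) = Ψ.eval σ active (E x)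

/-- The family `v` of images of level `k` is a channel of one of the feature maps. -/
def Located {ctx : List (Shape L)} (E : X → Env N ctx) (k : Fin L) (v : X → Node N k → ℝ) : Prop :=
  ∃ (p : Fin ctx.length) (c : Fin (ctx.get p).channels), (ctx.get p).channels ≤ 2 ∧
    (ctx.get p).level = k ∧ ∀ x, pixel (E x p c) = pixel (v x)

/-- Offsets in a kernel with three rows and columns. -/
def offset (d : Fin 3) : ℤ := ((d : ℕ) : ℤ) - ((1 : ℕ) : ℤ)

/-- A convolution of a family of images with a kernel with three rows and columns. -/
structure ConvSpec (N : ℕ) {L : ℕ} (X : Type) (k : Fin L) where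
  src : Fin L
  image : X → Node N src → ℝ
  kind : ConvKind src k
  kernel : Fin 3 → Fin 3 → ℝ

/-- The result of the convolution. -/
def ConvSpec.value {k : Fin L} (t : ConvSpec N X k) (x : X) (i : Node N k) : ℝ :=
  ∑ d : Fin 3, ∑ e : Fin 3, t.kernel d e *
    t.kind.sample (t.image x) ((i.1 : ℕ) : ℤ) ((i.2 : ℕ) : ℤ) (offset d) (offset e)

open Classical in
/-- The images computed by a layer with one channel. -/
def layerImage (σ : ℝ → ℝ) (active : ∀ k : Fin L, Finset (Node N k)) {k : Fin L}
    (activated sparse : Bool) (terms : List (ConvSpec N X k)) (bias : ℝ) (x : X) (i : Node N k) : ℝ :=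
  if sparse = true ∧ i ∉ active k then 0
  else
    let z := (terms.map fun t => t.value x i).sum + bias
    if activated then σ z else z

lemma ConvKind.sample_congr {ℓ ℓ' : Fin L} (kd : ConvKind ℓ ℓ') {v w : Node N ℓ → ℝ}
    (h : pixel v = pixel w) (p q d e : ℤ) : kd.sample v p q d e = kd.sample w p q d e := by
  cases kd <;> simp [ConvKind.sample, dilatedPixel, h]

lemma exists_convTerm {ctx : List (Shape L)} {E : X → Env N ctx} {k : Fin L}
    (t : ConvSpec N X k) (h : Located E t.src t.image) :
    ∃ τ : ConvTerm ctx ⟨k, 1⟩, τ.numParams ≤ 18 ∧ ∀ x c i, τ.eval (E x) c i = t.value x i := by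
  obtain ⟨src, image, kind, kernel⟩ := t
  obtain ⟨p, c, hc, hp, hE⟩ := h
  dsimp only at hp hE
  subst hp
  -- The kernel ignores all channels of the source but one. With one output channel, at most two
  -- source channels and nine offsets it has at most 18 entries.
  refine ⟨⟨p, kind, 1, 1, fun _ c' d e => if c' = c then kernel d e else 0⟩, ?_, ?_⟩
  · have : 1 * (ctx.get p).channels * (2 * 1 + 1) * (2 * 1 + 1) ≤ 18 := by omega
    exact this
  · intro x c₁ i
    refine (Finset.sum_eq_single c ?_ ?_).trans ?_
    · intro c' _ hc'
      simp [hc']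
    · intro h
      exact absurd (Finset.mem_univ _) h
    · refine Finset.sum_congr rfl fun d _ => Finset.sum_congr rfl fun e _ => ?_
      simp only [if_true]
      exact congrArg _ (ConvKind.sample_congr kind (hE x) _ _ _ _)

lemma exists_convTerms {ctx : List (Shape L)} {E : X → Env N ctx} {k : Fin L}
    (terms : List (ConvSpec N X k)) (h : ∀ t ∈ terms, Located E t.src t.image) :
    ∃ τ : List (ConvTerm ctx ⟨k, 1⟩), (τ.map ConvTerm.numParams).sum ≤ 18 * terms.length ∧
      ∀ x c i, (τ.map fun t => t.eval (E x) c i).sum = (terms.map fun t => t.value x i).sum := by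
  induction terms with
  | nil => exact ⟨[], by simp, by simp⟩
  | cons t terms ih =>
    obtain ⟨τ, h1, h2⟩ := ih fun t ht => h t (List.mem_cons_of_mem _ ht)
    obtain ⟨τ₀, h3, h4⟩ := exists_convTerm t (h t List.mem_cons_self)
    refine ⟨τ₀ :: τ, ?_, ?_⟩
    · simp only [List.map_cons, List.sum_cons, List.length_cons]
      omega
    · intro x c i
      simp only [List.map_cons, List.sum_cons, h2, h4]

variable {σ : ℝ → ℝ} {active : ∀ k : Fin L, Finset (Node N k)} {hL : 0 < L}
  {a b : X → Node N (finest hL) → ℝ}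

/-- A prefix is a map from continuations to networks, so a layer is appended by composition, and all
images located so far remain available through skip connections. -/
lemma IsPrefix.layer {n : ℕ} {ctx : List (Shape L)} {E : X → Env N ctx}
    (hE : IsPrefix σ active hL a b n ctx E) {k : Fin L} (activated sparse : Bool)
    (terms : List (ConvSpec N X k)) (h : ∀ t ∈ terms, Located E t.src t.image) (bias : ℝ) :
    ∃ (ctx' : List (Shape L)) (E' : X → Env N ctx'),
      IsPrefix σ active hL a b (n + (18 * terms.length + 1)) ctx' E' ∧
      (∀ (k : Fin L) (v : X → Node N k → ℝ), Located E k v → Located E' k v) ∧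
      Located E' k (layerImage σ active activated sparse terms bias) := by
  obtain ⟨τ, h1, h2⟩ := exists_convTerms terms h
  obtain ⟨F, hF⟩ := hE
  let l : Layer ctx ⟨k, 1⟩ := ⟨τ, fun _ => bias, activated, sparse⟩
  refine ⟨⟨k, 1⟩ :: ctx, fun x => consEnv (l.eval σ active (E x)) (E x), ?_, ?_, ?_⟩
  · refine ⟨fun Ψ => F (.layer _ l Ψ), fun Ψ => ⟨?_, fun x => ?_⟩⟩
    · refine (hF _).1.trans ?_
      have : (CNN.layer ⟨k, 1⟩ l Ψ).numParams = (τ.map ConvTerm.numParams).sum + 1 + Ψ.numParams := rfl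
      omega
    · exact (hF _).2 x
  · rintro k' v ⟨p, c, hc, hp, hv⟩
    exact ⟨p.succ, c, hc, hp, hv⟩
  · refine ⟨⟨0, Nat.succ_pos _⟩, ⟨0, Nat.one_pos⟩, show 1 ≤ 2 by norm_num, rfl, fun x => ?_⟩
    change pixel (l.eval σ active (E x) 0) = _
    congr 1
    funext i
    simp only [Layer.eval, layerImage, l, h2]

/-- A set of families of images can be computed exactly with `n` parameters. -/
def Exact (σ : ℝ → ℝ) (active : ∀ k : Fin L, Finset (Node N k)) (hL : 0 < L)
    (a b : X → Node N (finest hL) → ℝ) (n : ℕ) (V : Set (Σ k : Fin L, X → Node N k → ℝ)) : Prop :=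
  ∃ (ctx : List (Shape L)) (E : X → Env N ctx), IsPrefix σ active hL a b n ctx E ∧
    ∀ (k : Fin L) (v : X → Node N k → ℝ), ⟨k, v⟩ ∈ V → Located E k v

lemma Exact.layer {n : ℕ} {V : Set (Σ k : Fin L, X → Node N k → ℝ)}
    (hV : Exact σ active hL a b n V) {k : Fin L} (activated sparse : Bool)
    (terms : List (ConvSpec N X k)) (h : ∀ t ∈ terms, ⟨t.src, t.image⟩ ∈ V) (bias : ℝ) :
    Exact σ active hL a b (n + (18 * terms.length + 1))
      (insert ⟨k, layerImage σ active activated sparse terms bias⟩ V) := by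
  obtain ⟨ctx, E, hE, hloc⟩ := hV
  obtain ⟨ctx', E', h1, h2, h3⟩ :=
    hE.layer activated sparse terms (fun t ht => hloc _ _ (h t ht)) bias
  refine ⟨ctx', E', h1, ?_⟩
  intro k' v hv
  rcases hv with hv | hv
  · cases hv
    exact h3
  · exact h2 _ _ (hloc _ _ hv)

lemma exact_input : Exact σ active hL a b 0 {⟨finest hL, a⟩, ⟨finest hL, b⟩} := by
  refine ⟨inputShape hL, fun x => inputEnv hL (a x) (b x), ⟨id, fun Ψ => ⟨by simp, fun x => rfl⟩⟩, ?_⟩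
  intro k v hv
  rcases hv with hv | hv
  · cases hv
    exact ⟨⟨0, Nat.one_pos⟩, ⟨0, Nat.two_pos⟩, show 2 ≤ 2 by norm_num, rfl, fun x => rfl⟩
  · cases hv
    exact ⟨⟨0, Nat.one_pos⟩, ⟨1, Nat.one_lt_two⟩, show 2 ≤ 2 by norm_num, rfl, fun x => rfl⟩

lemma Exact.mono {n n' : ℕ} {V V' : Set (Σ k : Fin L, X → Node N k → ℝ)}
    (hV : Exact σ active hL a b n V) (hn : n ≤ n') (h : V' ⊆ V) : Exact σ active hL a b n' V' := by
  obtain ⟨ctx, E, ⟨F, hF⟩, hloc⟩ := hV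
  exact ⟨ctx, E, ⟨F, fun Ψ => ⟨(hF Ψ).1.trans (by omega), (hF Ψ).2⟩⟩, fun k v hv => hloc k v (h hv)⟩

lemma pixel_node {ℓ : ℕ} (x : Node N ℓ → ℝ) (i : Node N ℓ) :
    pixel x ((i.1 : ℕ) : ℤ) ((i.2 : ℕ) : ℤ) = x i := by
  rw [pixel, dif_pos ⟨⟨Int.natCast_nonneg _, i.1.2⟩, ⟨Int.natCast_nonneg _, i.2.2⟩⟩]
  rfl

/-- A network that outputs images which can be computed. -/
lemma Exact.exists_cnn {n : ℕ} {V : Set (Σ k : Fin L, X → Node N k → ℝ)}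
    (hV : Exact σ active hL a b n V) (v : ∀ k : Fin L, X → Node N k → ℝ) (hv : ∀ k, ⟨k, v k⟩ ∈ V) :
    ∃ Ψ : CNN (inputShape hL), Ψ.numParams ≤ n ∧
      ∀ x k i, Ψ.eval σ active (inputEnv hL (a x) (b x)) k i = v k x i := by
  obtain ⟨ctx, E, ⟨F, hF⟩, hloc⟩ := hV
  choose p c _ hp hE using fun k => hloc k (v k) (hv k)
  refine ⟨F (.output p hp c), (hF _).1, fun x k i => ?_⟩
  rw [(hF _).2]
  change pixel (E x (p k) (c k)) _ _ = _
  rw [hE, pixel_node]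

/-! ### Approximation by networks -/

/-- A set of bounded families of images can be approximated uniformly with `n` parameters. -/
structure Approx (σ : ℝ → ℝ) (active : ∀ k : Fin L, Finset (Node N k)) (hL : 0 < L)
    (a b : X → Node N (finest hL) → ℝ) (n : ℕ) (T : Set (Σ k : Fin L, X → Node N k → ℝ)) :
    Prop where
  bounded : ∀ (k : Fin L) (t : X → Node N k → ℝ), ⟨k, t⟩ ∈ T → ∃ B : ℝ, ∀ x i, |t x i| ≤ B
  approx : ∀ η : ℝ, 0 < η → ∃ V, Exact σ active hL a b n V ∧
    ∀ (k : Fin L) (t : X → Node N k → ℝ), ⟨k, t⟩ ∈ T →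
      ∃ v : X → Node N k → ℝ, ⟨k, v⟩ ∈ V ∧ ∀ x i, |v x i - t x i| ≤ η

lemma Approx.mono {n n' : ℕ} {T T' : Set (Σ k : Fin L, X → Node N k → ℝ)}
    (hT : Approx σ active hL a b n T) (hn : n ≤ n') (h : T' ⊆ T) : Approx σ active hL a b n' T' where
  bounded k t ht := hT.bounded k t (h ht)
  approx η hη := by
    obtain ⟨V, hV, hVT⟩ := hT.approx η hη
    exact ⟨V, hV.mono hn subset_rfl, fun k t ht => hVT k t (h ht)⟩

lemma approx_input (ha : ∃ B : ℝ, ∀ x i, |a x i| ≤ B) (hb : ∃ B : ℝ, ∀ x i, |b x i| ≤ B) :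
    Approx σ active hL a b 0 {⟨finest hL, a⟩, ⟨finest hL, b⟩} where
  bounded k t ht := by
    rcases ht with ht | ht <;> cases ht
    · exact ha
    · exact hb
  approx η hη := ⟨_, exact_input, fun k t ht => ⟨t, ht, fun x i => by simpa using hη.le⟩⟩

lemma abs_pixel_le {ℓ : ℕ} {v : Node N ℓ → ℝ} {B : ℝ} (h : ∀ i, |v i| ≤ B) (hB : 0 ≤ B)
    (p q : ℤ) : |pixel v p q| ≤ B := by
  unfold pixel
  split_ifs
  · exact h _
  · simpa using hB

lemma pixel_sub {ℓ : ℕ} (v w : Node N ℓ → ℝ) (p q : ℤ) :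
    pixel (fun i => v i - w i) p q = pixel v p q - pixel w p q := by
  unfold pixel
  split_ifs <;> simp

lemma ConvKind.abs_sample_le {ℓ ℓ' : Fin L} (kd : ConvKind ℓ ℓ') {v : Node N ℓ → ℝ} {B : ℝ}
    (h : ∀ i, |v i| ≤ B) (hB : 0 ≤ B) (p q d e : ℤ) : |kd.sample v p q d e| ≤ B := by
  cases kd
  · exact abs_pixel_le h hB _ _
  · exact abs_pixel_le h hB _ _
  · simp only [ConvKind.sample, dilatedPixel]
    split_ifs
    · exact abs_pixel_le h hB _ _
    · simpa using hB

lemma ConvKind.sample_sub {ℓ ℓ' : Fin L} (kd : ConvKind ℓ ℓ') (v w : Node N ℓ → ℝ) (p q d e : ℤ) :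
    kd.sample (fun i => v i - w i) p q d e = kd.sample v p q d e - kd.sample w p q d e := by
  cases kd
  · exact pixel_sub _ _ _ _
  · exact pixel_sub _ _ _ _
  · simp only [ConvKind.sample, dilatedPixel]
    split_ifs
    · exact pixel_sub _ _ _ _
    · simp

/-- The sum of the absolute values of a kernel. -/
def ConvSpec.mass {k : Fin L} (t : ConvSpec N X k) : ℝ := ∑ d : Fin 3, ∑ e : Fin 3, |t.kernel d e|

lemma ConvSpec.mass_nonneg {k : Fin L} (t : ConvSpec N X k) : 0 ≤ t.mass :=
  Finset.sum_nonneg fun _ _ => Finset.sum_nonneg fun _ _ => abs_nonneg _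

lemma ConvSpec.abs_value_le {k : Fin L} (t : ConvSpec N X k) {B : ℝ} (hB : 0 ≤ B) {x : X}
    (h : ∀ i, |t.image x i| ≤ B) (i : Node N k) : |t.value x i| ≤ t.mass * B := by
  rw [ConvSpec.value, ConvSpec.mass, Finset.sum_mul]
  refine (Finset.abs_sum_le_sum_abs _ _).trans (Finset.sum_le_sum fun d _ => ?_)
  rw [Finset.sum_mul]
  refine (Finset.abs_sum_le_sum_abs _ _).trans (Finset.sum_le_sum fun e _ => ?_)
  rw [abs_mul]
  exact mul_le_mul_of_nonneg_left (t.kind.abs_sample_le h hB _ _ _ _) (abs_nonneg _)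

lemma ConvSpec.value_sub {k : Fin L} (t : ConvSpec N X k) (w : X → Node N t.src → ℝ) (x : X)
    (i : Node N k) : (⟨t.src, fun x i => w x i - t.image x i, t.kind, t.kernel⟩ :
      ConvSpec N X k).value x i = (⟨t.src, w, t.kind, t.kernel⟩ : ConvSpec N X k).value x i -
        t.value x i := by
  simp only [ConvSpec.value, ConvKind.sample_sub, mul_sub, Finset.sum_sub_distrib]

lemma exists_approx_terms {V T : Set (Σ k : Fin L, X → Node N k → ℝ)} {η : ℝ} (hη : 0 ≤ η)
    (hVT : ∀ (k : Fin L) (t : X → Node N k → ℝ), ⟨k, t⟩ ∈ T →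
      ∃ v : X → Node N k → ℝ, ⟨k, v⟩ ∈ V ∧ ∀ x i, |v x i - t x i| ≤ η)
    {k : Fin L} (terms : List (ConvSpec N X k)) (h : ∀ t ∈ terms, ⟨t.src, t.image⟩ ∈ T) :
    ∃ terms' : List (ConvSpec N X k), terms'.length = terms.length ∧
      (∀ t ∈ terms', ⟨t.src, t.image⟩ ∈ V) ∧
      ∀ x i, |(terms'.map fun t => t.value x i).sum - (terms.map fun t => t.value x i).sum| ≤
        (terms.map ConvSpec.mass).sum * η := by
  induction terms with
  | nil => exact ⟨[], rfl, by simp, by simp⟩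
  | cons t terms ih =>
    obtain ⟨terms', h1, h2, h3⟩ := ih fun t ht => h t (List.mem_cons_of_mem _ ht)
    obtain ⟨v, hv, hvt⟩ := hVT _ _ (h t List.mem_cons_self)
    refine ⟨⟨t.src, v, t.kind, t.kernel⟩ :: terms', by simp [h1], ?_, fun x i => ?_⟩
    · intro t' ht'
      rcases List.mem_cons.1 ht' with rfl | ht'
      · exact hv
      · exact h2 _ ht'
    · simp only [List.map_cons, List.sum_cons]
      rw [add_sub_add_comm, add_mul, ← ConvSpec.value_sub]
      refine (abs_add_le _ _).trans (add_le_add ?_ (h3 x i))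
      exact ConvSpec.abs_value_le ⟨t.src, fun x i => v x i - t.image x i, t.kind, t.kernel⟩ hη
        (hvt x) i

lemma exists_bound_terms {T : Set (Σ k : Fin L, X → Node N k → ℝ)}
    (hT : ∀ (k : Fin L) (t : X → Node N k → ℝ), ⟨k, t⟩ ∈ T → ∃ B : ℝ, ∀ x i, |t x i| ≤ B)
    {k : Fin L} (terms : List (ConvSpec N X k)) (h : ∀ t ∈ terms, ⟨t.src, t.image⟩ ∈ T) :
    ∃ B : ℝ, ∀ x i, |(terms.map fun t => t.value x i).sum| ≤ B := by
  induction terms with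
  | nil => exact ⟨0, by simp⟩
  | cons t terms ih =>
    obtain ⟨B, hB⟩ := ih fun t ht => h t (List.mem_cons_of_mem _ ht)
    obtain ⟨B', hB'⟩ := hT _ _ (h t List.mem_cons_self)
    refine ⟨t.mass * max B' 0 + B, fun x i => ?_⟩
    simp only [List.map_cons, List.sum_cons]
    refine (abs_add_le _ _).trans (add_le_add ?_ (hB x i))
    exact t.abs_value_le (le_max_right _ _) (fun i => (hB' x i).trans (le_max_left _ _)) i

/-- Linear layers preserve approximability. -/
lemma Approx.linear {n : ℕ} {T : Set (Σ k : Fin L, X → Node N k → ℝ)}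
    (hT : Approx σ active hL a b n T) {k : Fin L} (sparse : Bool)
    (terms : List (ConvSpec N X k)) (h : ∀ t ∈ terms, ⟨t.src, t.image⟩ ∈ T) :
    Approx σ active hL a b (n + (18 * terms.length + 1))
      (insert ⟨k, layerImage σ active false sparse terms 0⟩ T) where
  bounded k' t ht := by
    rcases ht with ht | ht
    · cases ht
      obtain ⟨B, hB⟩ := exists_bound_terms hT.bounded terms h
      refine ⟨max B 0, fun x i => ?_⟩
      unfold layerImage
      split_ifs with h1 h2
      · simp
      · simp at h2
      · simpa using Or.inl (hB x i)
    · exact hT.bounded k' t ht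
  approx η hη := by
    have hM : 0 ≤ (terms.map ConvSpec.mass).sum := by
      refine List.sum_nonneg fun m hm => ?_
      obtain ⟨t, -, rfl⟩ := List.mem_map.1 hm
      exact t.mass_nonneg
    set M := (terms.map ConvSpec.mass).sum
    -- The layer amplifies errors by at most the kernel mass `M`; the minimum with `η` serves the
    -- old images.
    have hη' : 0 < min η (η / (M + 1)) := lt_min hη (by positivity)
    obtain ⟨V, hV, hVT⟩ := hT.approx _ hη'
    obtain ⟨terms', h1, h2, h3⟩ := exists_approx_terms hη'.le hVT terms h
    rw [← h1]
    refine ⟨_, hV.layer false sparse terms' h2 0, fun k' t ht => ?_⟩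
    rcases ht with ht | ht
    · cases ht
      refine ⟨_, mem_insert _ _, fun x i => ?_⟩
      unfold layerImage
      split_ifs with h4 h5
      · simpa using hη.le
      · simp at h5
      · simp only [add_zero]
        refine (h3 x i).trans ?_
        calc M * min η (η / (M + 1)) ≤ (M + 1) * (η / (M + 1)) :=
              mul_le_mul (by linarith) (min_le_right _ _) hη'.le (by linarith)
          _ = η := by field_simp
    · obtain ⟨v, hv, hvt⟩ := hVT k' t ht
      exact ⟨v, mem_insert_of_mem _ hv, fun x i => (hvt x i).trans (min_le_left _ _)⟩

/-! ### Multiplication by means of the activation function -/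

/-- The convolution that multiplies every pixel by a number. -/
def scaleSpec (k : Fin L) (v : X → Node N k → ℝ) (r : ℝ) : ConvSpec N X k :=
  ⟨k, v, .vanilla rfl, fun d e => if d = 1 ∧ e = 1 then r else 0⟩

lemma scaleSpec_value {k : Fin L} (v : X → Node N k → ℝ) (r : ℝ) (x : X) (i : Node N k) :
    (scaleSpec k v r).value x i = r * v x i := by
  have h : ∀ d e : Fin 3, (if d = 1 ∧ e = 1 then r else 0) *
      pixel (v x) (((i.1 : ℕ) : ℤ) + offset d) (((i.2 : ℕ) : ℤ) + offset e) =
      if d = 1 then (if e = 1 then r * v x i else 0) else 0 := by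
    intro d e
    by_cases hd : d = 1
    · by_cases he : e = 1
      · subst hd he
        simp [offset, pixel_node]
      · simp [he]
    · simp [hd]
  unfold ConvSpec.value scaleSpec
  simp only [ConvKind.sample, h]
  simp

/-- The mixed second difference of `σ` at `x₀` with increments `h s` and `h t` is `h² c s t +
o(h²)`, since the constant, linear and pure quadratic terms of the Taylor expansion cancel. -/
lemma exists_scalar_product
    (hσ : ∃ x₀ : ℝ, ContDiffAt ℝ 3 σ x₀ ∧ iteratedDeriv 2 σ x₀ ≠ 0) :
    ∃ x₀ : ℝ, ∃ c : ℝ, c ≠ 0 ∧ ∀ B η : ℝ, 0 < η → ∃ h : ℝ, h ≠ 0 ∧ ∀ s t : ℝ, |s| ≤ B → |t| ≤ B →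
      |(σ (h * s + h * t + x₀) - σ (h * s + x₀) - σ (h * t + x₀) + σ x₀) / (h ^ 2 * c) - s * t| ≤ η := by
  obtain ⟨x₀, hx, hc⟩ := hσ
  obtain ⟨u, hu, hσu⟩ := (hx.of_le (show (2 : WithTop ℕ∞) ≤ 3 by norm_num)).contDiffOn le_rfl (by simp)
  obtain ⟨r, hr, hru⟩ := Metric.mem_nhds_iff.1 hu
  have hx₀ : x₀ ∈ Metric.ball x₀ r := Metric.mem_ball_self hr
  have hT := taylor_isLittleO (n := 2) (convex_ball x₀ r) hx₀ (hσu.mono hru)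
  rw [nhdsWithin_eq_nhds.2 (Metric.ball_mem_nhds x₀ hr)] at hT
  refine ⟨x₀, iteratedDeriv 2 σ x₀, hc, fun B η hη => ?_⟩
  set c := iteratedDeriv 2 σ x₀ with hcdef
  set d := derivWithin σ (Metric.ball x₀ r) x₀
  have hc' : iteratedDerivWithin 2 σ (Metric.ball x₀ r) x₀ = c :=
    iteratedDerivWithin_of_isOpen Metric.isOpen_ball hx₀
  have hform : ∀ x, taylorWithinEval σ 2 (Metric.ball x₀ r) x₀ x =
      σ x₀ + d * (x - x₀) + c / 2 * (x - x₀) ^ 2 := by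
    intro x
    rw [taylorWithinEval_succ, taylorWithinEval_succ, taylor_within_zero_eval, hc']
    simp only [smul_eq_mul]
    norm_num
    ring
  set M := |B| + 1
  have hM : 0 < M := by positivity
  -- The three Taylor remainders add up to a multiple of `(s + t)² + s² + t² ≤ 6 M²`.
  have hε : 0 < η * |c| / (6 * M ^ 2) := by positivity
  obtain ⟨δ, hδ, hR⟩ := Metric.eventually_nhds_iff.1 (hT.def hε)
  have hR' : ∀ y, |y| < δ → |σ (y + x₀) - (σ x₀ + d * y + c / 2 * y ^ 2)| ≤
      η * |c| / (6 * M ^ 2) * y ^ 2 := by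
    intro y hy
    have := hR (y := y + x₀) (by rwa [Real.dist_eq, add_sub_cancel_right])
    rw [hform, add_sub_cancel_right, Real.norm_eq_abs, Real.norm_eq_abs, abs_pow, sq_abs] at this
    exact this
  obtain ⟨h, hh, hhδ⟩ : ∃ h : ℝ, 0 < h ∧ h * (2 * M) < δ :=
    ⟨δ / (4 * M), by positivity, by field_simp; norm_num⟩
  refine ⟨h, hh.ne', fun s t hs ht => ?_⟩
  have hBM : B ≤ M := (le_abs_self B).trans (by simp [M])
  have hs' : |s| ≤ M := hs.trans hBM
  have ht' : |t| ≤ M := ht.trans hBM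
  have hst : |s + t| ≤ 2 * M := (abs_add_le _ _).trans (by linarith)
  have bound : ∀ y, |y| ≤ 2 * M → |h * y| < δ := by
    intro y hy
    rw [abs_mul, abs_of_pos hh]
    exact (mul_le_mul_of_nonneg_left hy hh.le).trans_lt hhδ
  have sqb : ∀ (y K : ℝ), |y| ≤ K → y ^ 2 ≤ K ^ 2 := fun y K h => by
    rw [← sq_abs]
    exact pow_le_pow_left₀ (abs_nonneg _) h 2
  have r1 := hR' _ (bound (s + t) hst)
  have r2 := hR' _ (bound s (by linarith))
  have r3 := hR' _ (bound t (by linarith))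
  have q1 := sqb _ _ hst
  have q2 := sqb _ _ hs'
  have q3 := sqb _ _ ht'
  rw [mul_add] at r1
  have hden : 0 < |h ^ 2 * c| := by positivity
  have e : (σ (h * s + h * t + x₀) - σ (h * s + x₀) - σ (h * t + x₀) + σ x₀) / (h ^ 2 * c) - s * t =
      ((σ (h * s + h * t + x₀) - (σ x₀ + d * (h * s + h * t) + c / 2 * (h * s + h * t) ^ 2)) -
        (σ (h * s + x₀) - (σ x₀ + d * (h * s) + c / 2 * (h * s) ^ 2)) -
        (σ (h * t + x₀) - (σ x₀ + d * (h * t) + c / 2 * (h * t) ^ 2))) / (h ^ 2 * c) := by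
    field_simp
    ring
  rw [e, abs_div, div_le_iff₀ hden, abs_mul, abs_of_pos (pow_pos hh 2)]
  refine (abs_sub _ _).trans ((add_le_add (abs_sub _ _) le_rfl).trans ?_)
  calc _ ≤ η * |c| / (6 * M ^ 2) * (h * s + h * t) ^ 2 + η * |c| / (6 * M ^ 2) * (h * s) ^ 2 +
        η * |c| / (6 * M ^ 2) * (h * t) ^ 2 := add_le_add (add_le_add r1 r2) r3
    _ = η * |c| / (6 * M ^ 2) * h ^ 2 * ((s + t) ^ 2 + s ^ 2 + t ^ 2) := by ring
    _ ≤ η * |c| / (6 * M ^ 2) * h ^ 2 * (6 * M ^ 2) :=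
        mul_le_mul_of_nonneg_left (by linarith) (by positivity)
    _ = η * (h ^ 2 * |c|) := by field_simp

/-- Three activated layers and one linear layer realize the second difference, with `37 + 19 + 19 +
55 = 130` parameters. Only the weights depend on the accuracy. -/
lemma Approx.mul {n : ℕ} {T : Set (Σ k : Fin L, X → Node N k → ℝ)}
    (hσ : ∃ x₀ : ℝ, ContDiffAt ℝ 3 σ x₀ ∧ iteratedDeriv 2 σ x₀ ≠ 0)
    (hT : Approx σ active hL a b n T) {k : Fin L} {t₁ t₂ : X → Node N k → ℝ} (h₁ : ⟨k, t₁⟩ ∈ T)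
    (h₂ : ⟨k, t₂⟩ ∈ T) :
    Approx σ active hL a b (n + 130) (insert ⟨k, fun x i => t₁ x i * t₂ x i⟩ T) where
  bounded k' t ht := by
    rcases ht with ht | ht
    · cases ht
      obtain ⟨B₁, hB₁⟩ := hT.bounded k t₁ h₁
      obtain ⟨B₂, hB₂⟩ := hT.bounded k t₂ h₂
      refine ⟨B₁ * B₂, fun x i => ?_⟩
      rw [abs_mul]
      exact mul_le_mul (hB₁ x i) (hB₂ x i) (abs_nonneg _) ((abs_nonneg _).trans (hB₁ x i))
    · exact hT.bounded k' t ht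
  approx η hη := by
    obtain ⟨x₀, c, hc, hprod⟩ := exists_scalar_product hσ
    obtain ⟨B₁, hB₁⟩ := hT.bounded k t₁ h₁
    obtain ⟨B₂, hB₂⟩ := hT.bounded k t₂ h₂
    obtain ⟨B, hB0, hB1, hB2⟩ : ∃ B : ℝ, 0 ≤ B ∧ B₁ ≤ B ∧ B₂ ≤ B :=
      ⟨max 0 (max B₁ B₂), le_max_left _ _, (le_max_left _ _).trans (le_max_right _ _),
        (le_max_right _ _).trans (le_max_right _ _)⟩
    obtain ⟨h, hh, hprod⟩ := hprod (B + 1) (η / 2) (by linarith)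
    -- The bound `δ ≤ 1` keeps the approximate factors in `[-(B + 1), B + 1]`, and `δ (2 B + 1)` is
    -- the error of the product caused by the factors.
    obtain ⟨δ, hδ, hδη, hδ1, hδB⟩ : ∃ δ : ℝ, 0 < δ ∧ δ ≤ η ∧ δ ≤ 1 ∧ δ * (2 * B + 1) ≤ η / 2 := by
      refine ⟨min η (min 1 (η / 2 / (2 * B + 1))), by positivity, min_le_left _ _,
        (min_le_right _ _).trans (min_le_left _ _), ?_⟩
      rw [← le_div_iff₀ (by positivity)]
      exact (min_le_right _ _).trans (min_le_right _ _)
    obtain ⟨V, hV, hVT⟩ := hT.approx δ hδ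
    obtain ⟨v₁, hv₁, hvt₁⟩ := hVT k t₁ h₁
    obtain ⟨v₂, hv₂, hvt₂⟩ := hVT k t₂ h₂
    have V1 := hV.layer true false [scaleSpec k v₁ h, scaleSpec k v₂ h]
      (by simp only [List.mem_cons, List.not_mem_nil, or_false, forall_eq_or_imp, forall_eq]
          exact ⟨hv₁, hv₂⟩) x₀
    have V2 := V1.layer true false [scaleSpec k v₁ h]
      (by simp only [List.mem_cons, List.not_mem_nil, or_false, forall_eq]
          exact Or.inr hv₁) x₀
    have V3 := V2.layer true false [scaleSpec k v₂ h]
      (by simp only [List.mem_cons, List.not_mem_nil, or_false, forall_eq]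
          exact Or.inr (Or.inr hv₂)) x₀
    set w₁ := layerImage σ active true false [scaleSpec k v₁ h, scaleSpec k v₂ h] x₀ with hw₁
    set w₂ := layerImage σ active true false [scaleSpec k v₁ h] x₀ with hw₂
    set w₃ := layerImage σ active true false [scaleSpec k v₂ h] x₀ with hw₃
    have V4 := V3.layer false false [scaleSpec k w₁ (h ^ 2 * c)⁻¹, scaleSpec k w₂ (-(h ^ 2 * c)⁻¹),
      scaleSpec k w₃ (-(h ^ 2 * c)⁻¹)]
      (by simp only [List.mem_cons, List.not_mem_nil, or_false, forall_eq_or_imp, forall_eq]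
          exact ⟨Or.inr (Or.inr (Or.inl rfl)), Or.inr (Or.inl rfl), Or.inl rfl⟩)
      ((h ^ 2 * c)⁻¹ * σ x₀)
    refine ⟨_, V4.mono (by simp) subset_rfl, fun k' t ht => ?_⟩
    rcases ht with ht | ht
    · cases ht
      refine ⟨_, mem_insert _ _, fun x i => ?_⟩
      have hb₁ : |v₁ x i| ≤ B + 1 := by
        have := abs_sub_abs_le_abs_sub (v₁ x i) (t₁ x i)
        linarith [hvt₁ x i, hB₁ x i]
      have hb₂ : |v₂ x i| ≤ B + 1 := by
        have := abs_sub_abs_le_abs_sub (v₂ x i) (t₂ x i)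
        linarith [hvt₂ x i, hB₂ x i]
      have hval : layerImage σ active false false [scaleSpec k w₁ (h ^ 2 * c)⁻¹,
          scaleSpec k w₂ (-(h ^ 2 * c)⁻¹), scaleSpec k w₃ (-(h ^ 2 * c)⁻¹)] ((h ^ 2 * c)⁻¹ * σ x₀) x i =
          (σ (h * v₁ x i + h * v₂ x i + x₀) - σ (h * v₁ x i + x₀) - σ (h * v₂ x i + x₀) + σ x₀) /
            (h ^ 2 * c) := by
        simp only [layerImage, hw₁, hw₂, hw₃, List.map_cons, List.map_nil, List.sum_cons,
          List.sum_nil, scaleSpec_value, Bool.false_eq_true, false_and, if_false, if_true, add_zero]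
        rw [div_eq_inv_mul]
        ring
      rw [hval]
      have e1 := hprod _ _ hb₁ hb₂
      have e2 : |v₁ x i * v₂ x i - t₁ x i * t₂ x i| ≤ η / 2 := by
        have : v₁ x i * v₂ x i - t₁ x i * t₂ x i =
            (v₁ x i - t₁ x i) * v₂ x i + t₁ x i * (v₂ x i - t₂ x i) := by ring
        rw [this]
        refine (abs_add_le _ _).trans ?_
        rw [abs_mul, abs_mul]
        have f1 := mul_le_mul (hvt₁ x i) hb₂ (abs_nonneg _) hδ.le
        have f2 := mul_le_mul ((hB₁ x i).trans hB1) (hvt₂ x i) (abs_nonneg _) hB0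
        nlinarith
      have := abs_add_le ((σ (h * v₁ x i + h * v₂ x i + x₀) - σ (h * v₁ x i + x₀) -
        σ (h * v₂ x i + x₀) + σ x₀) / (h ^ 2 * c) - v₁ x i * v₂ x i)
        (v₁ x i * v₂ x i - t₁ x i * t₂ x i)
      rw [sub_add_sub_cancel] at this
      linarith
    · obtain ⟨v, hv, hvt⟩ := hVT k' t ht
      refine ⟨v, ?_, fun x i => (hvt x i).trans hδη⟩
      exact Or.inr (Or.inr (Or.inr (Or.inr hv)))

/-- A network that approximates images which can be approximated. -/
lemma Approx.exists_cnn {n : ℕ} {T : Set (Σ k : Fin L, X → Node N k → ℝ)}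
    (hT : Approx σ active hL a b n T) (v : ∀ k : Fin L, X → Node N k → ℝ) (hv : ∀ k, ⟨k, v k⟩ ∈ T)
    {η : ℝ} (hη : 0 < η) :
    ∃ Ψ : CNN (inputShape hL), Ψ.numParams ≤ n ∧
      ∀ x k i, |Ψ.eval σ active (inputEnv hL (a x) (b x)) k i - v k x i| ≤ η := by
  obtain ⟨V, hV, hVT⟩ := hT.approx η hη
  choose w hw hwv using fun k => hVT k (v k) (hv k)
  obtain ⟨Ψ, h1, h2⟩ := hV.exists_cnn w hw
  refine ⟨Ψ, h1, fun x k i => ?_⟩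
  rw [h2]
  exact hwv k x i

end Network

/-! ### Sums over nodes as sums over kernels -/

section Window

variable {N : ℕ}

lemma exists_offset_eq {z : ℤ} (h : |z| ≤ 1) : ∃ d : Fin 3, offset d = z := by
  rw [abs_le] at h
  have : z = -1 ∨ z = 0 ∨ z = 1 := by omega
  rcases this with rfl | rfl | rfl
  · exact ⟨0, rfl⟩
  · exact ⟨1, rfl⟩
  · exact ⟨2, rfl⟩

lemma offset_injective : Function.Injective offset := by
  intro d e h
  unfold offset at h
  rw [Fin.ext_iff]
  omega

lemma offset_rev (d : Fin 3) : offset d.rev = -offset d := by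
  fin_cases d <;> rfl

lemma abs_offset_le (d : Fin 3) : |offset d| ≤ 1 := by
  rw [abs_le]
  unfold offset
  omega

/-- The index is sorted by its offset from `(p, q)`. Offsets not attained by any index give empty
sums, which is exactly zero padding. -/
lemma sum_eq_sum_window {J : Type*} [Fintype J] (α β : J → ℤ) (F : J → ℝ) (p q : ℤ)
    (hF : ∀ j, F j ≠ 0 → |α j - p| ≤ 1 ∧ |β j - q| ≤ 1) :
    ∑ j, F j = ∑ δ : Fin 3 × Fin 3, ∑ j,
      if α j = p + offset δ.1 ∧ β j = q + offset δ.2 then F j else 0 := by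
  rw [Finset.sum_comm]
  refine Finset.sum_congr rfl fun j _ => ?_
  by_cases h0 : F j = 0
  · simp [h0]
  · obtain ⟨h1, h2⟩ := hF j h0
    obtain ⟨d, hd⟩ := exists_offset_eq h1
    obtain ⟨e, he⟩ := exists_offset_eq h2
    rw [Finset.sum_eq_single (d, e)]
    · rw [if_pos]
      simp only [hd, he]
      constructor <;> ring
    · rintro ⟨d', e'⟩ _ hne
      rw [if_neg]
      rintro ⟨h3, h4⟩
      refine hne (Prod.ext ?_ ?_)
      · exact offset_injective (by simp only at h3 ⊢; rw [hd, h3]; ring)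
      · exact offset_injective (by simp only at h4 ⊢; rw [he, h4]; ring)
    · intro h
      exact absurd (Finset.mem_univ _) h

lemma pixel_of_eq {ℓ : ℕ} (F : Node N ℓ → ℝ) (i : Node N ℓ) {p q : ℤ}
    (h₁ : ((i.1 : ℕ) : ℤ) = p) (h₂ : ((i.2 : ℕ) : ℤ) = q) : pixel F p q = F i := by
  subst h₁ h₂
  exact pixel_node F i

lemma pixel_cases {ℓ : ℕ} (p q : ℤ) :
    (∃ i : Node N ℓ, ((i.1 : ℕ) : ℤ) = p ∧ ((i.2 : ℕ) : ℤ) = q) ∨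
      ((∀ F : Node N ℓ → ℝ, pixel F p q = 0) ∧
        ∀ i : Node N ℓ, ¬ (((i.1 : ℕ) : ℤ) = p ∧ ((i.2 : ℕ) : ℤ) = q)) := by
  by_cases h : (0 ≤ p ∧ p.toNat < N * 2 ^ ℓ + 1) ∧ (0 ≤ q ∧ q.toNat < N * 2 ^ ℓ + 1)
  · exact Or.inl ⟨(⟨p.toNat, h.1.2⟩, ⟨q.toNat, h.2.2⟩), Int.toNat_of_nonneg h.1.1,
      Int.toNat_of_nonneg h.2.1⟩
  · refine Or.inr ⟨fun F => dif_neg h, fun i hi => h ?_⟩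
    rw [← hi.1, ← hi.2]
    exact ⟨⟨Int.natCast_nonneg _, i.1.2⟩, ⟨Int.natCast_nonneg _, i.2.2⟩⟩

lemma pixel_eq_sum {ℓ : ℕ} (F : Node N ℓ → ℝ) (p q : ℤ) :
    pixel F p q = ∑ j : Node N ℓ,
      if ((j.1 : ℕ) : ℤ) = p ∧ ((j.2 : ℕ) : ℤ) = q then F j else 0 := by
  rcases pixel_cases (N := N) (ℓ := ℓ) p q with ⟨i, h₁, h₂⟩ | ⟨h, h'⟩
  · rw [pixel_of_eq F i h₁ h₂, Finset.sum_eq_single i]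
    · rw [if_pos ⟨h₁, h₂⟩]
    · intro j _ hj
      rw [if_neg]
      rintro ⟨h₃, h₄⟩
      refine hj (Prod.ext (Fin.ext ?_) (Fin.ext ?_)) <;> omega
    · intro h
      exact absurd (Finset.mem_univ _) h
  · rw [h, Finset.sum_eq_zero fun j _ => if_neg (h' j)]

lemma dilatedPixel_eq_sum {ℓ : ℕ} (F : Node N ℓ → ℝ) (p q : ℤ) :
    dilatedPixel F p q = ∑ j : Node N ℓ,
      if 2 * ((j.1 : ℕ) : ℤ) = p ∧ 2 * ((j.2 : ℕ) : ℤ) = q then F j else 0 := by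
  unfold dilatedPixel
  split_ifs with h
  · rw [pixel_eq_sum]
    refine Finset.sum_congr rfl fun j _ => ?_
    congr 1
    rw [eq_iff_iff]
    omega
  · rw [Finset.sum_eq_zero fun j _ => if_neg ?_]
    intro hj
    apply h
    omega

lemma sum_eq_sum_pixel {ℓ : ℕ} (F : Node N ℓ → ℝ) (p q : ℤ)
    (hF : ∀ j, F j ≠ 0 → |((j.1 : ℕ) : ℤ) - p| ≤ 1 ∧ |((j.2 : ℕ) : ℤ) - q| ≤ 1) :
    ∑ j, F j = ∑ δ : Fin 3 × Fin 3, pixel F (p + offset δ.1) (q + offset δ.2) := by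
  simp only [pixel_eq_sum]
  exact sum_eq_sum_window _ _ F p q hF

lemma sum_eq_sum_dilatedPixel {ℓ : ℕ} (F : Node N ℓ → ℝ) (p q : ℤ)
    (hF : ∀ j, F j ≠ 0 → |2 * ((j.1 : ℕ) : ℤ) - p| ≤ 1 ∧ |2 * ((j.2 : ℕ) : ℤ) - q| ≤ 1) :
    ∑ j, F j = ∑ δ : Fin 3 × Fin 3, dilatedPixel F (p + offset δ.1) (q + offset δ.2) := by
  simp only [dilatedPixel_eq_sum]
  exact sum_eq_sum_window _ _ F p q hF

lemma pixel_mul {ℓ : ℕ} (w : ℤ → ℤ → ℝ) (F : Node N ℓ → ℝ) (p q : ℤ) :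
    pixel (fun j => w ((j.1 : ℕ) : ℤ) ((j.2 : ℕ) : ℤ) * F j) p q = w p q * pixel F p q := by
  rcases pixel_cases (N := N) (ℓ := ℓ) p q with ⟨i, rfl, rfl⟩ | ⟨h, -⟩
  · rw [pixel_node, pixel_node]
  · rw [h, h, mul_zero]

lemma dilatedPixel_mul {ℓ : ℕ} (w : ℤ → ℤ → ℝ) (F : Node N ℓ → ℝ) (p q : ℤ) :
    dilatedPixel (fun j => w (2 * ((j.1 : ℕ) : ℤ)) (2 * ((j.2 : ℕ) : ℤ)) * F j) p q =
      w p q * dilatedPixel F p q := by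
  unfold dilatedPixel
  split_ifs with h
  · rw [pixel_mul (fun p q => w (2 * p) (2 * q)), Int.mul_ediv_cancel' h.1, Int.mul_ediv_cancel' h.2]
  · rw [mul_zero]

/-! ### The grid transfers as convolutions -/

/-- Weights of the two-scale relation. -/
def twoScale (p q : ℤ) : ℝ := hexHat (p / 2) (q / 2)

lemma hat_nodePos_eq_twoScale (hN : 0 < N) {k k' : ℕ} (h : k' = k + 1) (i : Node N k)
    (j : Node N k') : hat i (nodePos j) =
      twoScale (((j.1 : ℕ) : ℤ) - 2 * ((i.1 : ℕ) : ℤ)) (((j.2 : ℕ) : ℤ) - 2 * ((i.2 : ℕ) : ℤ)) := by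
  subst h
  exact hat_nodePos_succ hN i j

lemma twoScale_ne_zero {p q : ℤ} (h : twoScale p q ≠ 0) : |p| ≤ 1 ∧ |q| ≤ 1 :=
  ⟨(hexHat_half_ne_zero h).1, (hexHat_half_ne_zero h).2.1⟩

lemma twoScale_neg (p q : ℤ) : twoScale (-p) (-q) = twoScale p q := by
  unfold twoScale
  push_cast
  rw [neg_div, neg_div, hexHat_neg]

lemma sum_restrict (hN : 0 < N) {k k' : ℕ} (h : k' = k + 1) (i : Node N k) (v : Node N k' → ℝ) :
    ∑ j, hat i (nodePos j) * v j = ∑ δ : Fin 3 × Fin 3, twoScale (offset δ.1) (offset δ.2) *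
      pixel v (2 * ((i.1 : ℕ) : ℤ) + offset δ.1) (2 * ((i.2 : ℕ) : ℤ) + offset δ.2) := by
  simp only [hat_nodePos_eq_twoScale hN h]
  rw [sum_eq_sum_pixel _ (2 * ((i.1 : ℕ) : ℤ)) (2 * ((i.2 : ℕ) : ℤ))]
  · refine Finset.sum_congr rfl fun δ _ => ?_
    rw [pixel_mul fun p q => twoScale (p - 2 * ((i.1 : ℕ) : ℤ)) (q - 2 * ((i.2 : ℕ) : ℤ))]
    simp
  · intro j hj
    exact twoScale_ne_zero (left_ne_zero_of_mul hj)

lemma sum_prolong (hN : 0 < N) {k k' : ℕ} (h : k' = k + 1) (j : Node N k') (v : Node N k → ℝ) :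
    ∑ i, hat i (nodePos j) * v i = ∑ δ : Fin 3 × Fin 3, twoScale (offset δ.1) (offset δ.2) *
      dilatedPixel v (((j.1 : ℕ) : ℤ) + offset δ.1) (((j.2 : ℕ) : ℤ) + offset δ.2) := by
  simp only [hat_nodePos_eq_twoScale hN h]
  rw [sum_eq_sum_dilatedPixel _ ((j.1 : ℕ) : ℤ) ((j.2 : ℕ) : ℤ)]
  · refine Finset.sum_congr rfl fun δ _ => ?_
    rw [dilatedPixel_mul fun p q => twoScale (((j.1 : ℕ) : ℤ) - p) (((j.2 : ℕ) : ℤ) - q)]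
    rw [sub_add_cancel_left, sub_add_cancel_left, twoScale_neg]
  · intro i hi
    have := twoScale_ne_zero (left_ne_zero_of_mul hi)
    rwa [abs_sub_comm, abs_sub_comm _ (2 * ((i.2 : ℕ) : ℤ))] at this

/-! ### The coefficients of the operator as images -/

/-- The images of the operator on level `k`, computed from the nodal values of the coefficient: away
from the boundary of the square, pixel `i` of image `δ` is the entry of the operator for the nodes
`i` and `i + δ`. -/
def operatorImage {ℓ : ℕ} (a : Node N ℓ → ℝ) (k : ℕ) (δ : Fin 3 × Fin 3) (i : Node N k) : ℝ :=
  if k < ℓ then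
    ∑ ε : Fin 3 × Fin 3, ∑ η : Fin 3 × Fin 3,
      twoScale (offset η.1) (offset η.2) *
        twoScale (offset ε.1 + offset η.1 - 2 * offset δ.1) (offset ε.2 + offset η.2 - 2 * offset δ.2) *
        pixel (operatorImage a (k + 1) ε) (2 * ((i.1 : ℕ) : ℤ) + offset η.1)
          (2 * ((i.2 : ℕ) : ℤ) + offset η.2)
  else
    ∑ η : Fin 3 × Fin 3, stencilIntegral (meshWidth N k)
        !₂[(offset η.1 : ℝ) * meshWidth N k, (offset η.2 : ℝ) * meshWidth N k]
        !₂[(offset δ.1 : ℝ) * meshWidth N k, (offset δ.2 : ℝ) * meshWidth N k] *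
      pixel a (((i.1 : ℕ) : ℤ) + offset η.1) (((i.2 : ℕ) : ℤ) + offset η.2)
termination_by ℓ - k

lemma nodePos_sub {k : ℕ} (l i : Node N k) : nodePos l - nodePos i =
    !₂[((((l.1 : ℕ) : ℤ) - ((i.1 : ℕ) : ℤ) : ℤ) : ℝ) * meshWidth N k,
      ((((l.2 : ℕ) : ℤ) - ((i.2 : ℕ) : ℤ) : ℤ) : ℝ) * meshWidth N k] := by
  ext j
  fin_cases j <;> simp [nodePos, sub_mul]

/-- Being interior is inherited by all fine nodes in the window of a coarse one, so the stencils of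
interior nodes never depend on those of boundary nodes. -/
lemma exists_fine_node {k : ℕ} {i : Node N k} (hi : IsInterior i) (η : Fin 3 × Fin 3) :
    ∃ p : Node N (k + 1), IsInterior p ∧ ((p.1 : ℕ) : ℤ) = 2 * ((i.1 : ℕ) : ℤ) + offset η.1 ∧
      ((p.2 : ℕ) : ℤ) = 2 * ((i.2 : ℕ) : ℤ) + offset η.2 := by
  obtain ⟨⟨h1, h2⟩, h3, h4⟩ := hi
  have e : N * 2 ^ (k + 1) = 2 * (N * 2 ^ k) := by rw [pow_succ]; ring
  have b1 := abs_le.1 (abs_offset_le η.1)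
  have b2 := abs_le.1 (abs_offset_le η.2)
  obtain ⟨P, hP⟩ := Int.eq_ofNat_of_zero_le (show 0 ≤ 2 * ((i.1 : ℕ) : ℤ) + offset η.1 by omega)
  obtain ⟨Q, hQ⟩ := Int.eq_ofNat_of_zero_le (show 0 ≤ 2 * ((i.2 : ℕ) : ℤ) + offset η.2 by omega)
  have hP' : 0 < P ∧ P < N * 2 ^ (k + 1) := by rw [e]; omega
  have hQ' : 0 < Q ∧ Q < N * 2 ^ (k + 1) := by rw [e]; omega
  exact ⟨(⟨P, Nat.lt_succ_of_lt hP'.2⟩, ⟨Q, Nat.lt_succ_of_lt hQ'.2⟩), ⟨hP', hQ'⟩, hP.symm, hQ.symm⟩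

/-- On the finest level the entry is linear in the nodal values of the coefficient with a
translation invariant stencil. On coarser levels both hats are expanded in those of level `k + 1`.
The node `i` must be interior, while `j` may lie on the boundary. -/
lemma operatorImage_eq (hN : 0 < N) {ℓ : ℕ} (g : Plane → ℝ) (k : ℕ) (hk : k ≤ ℓ)
    (δ : Fin 3 × Fin 3) (i j : Node N k) (hi : IsInterior i)
    (h₁ : ((j.1 : ℕ) : ℤ) = ((i.1 : ℕ) : ℤ) + offset δ.1)
    (h₂ : ((j.2 : ℕ) : ℤ) = ((i.2 : ℕ) : ℤ) + offset δ.2) :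
    operatorImage (nodalImage N ℓ g) k δ i = energyForm (interpolate N ℓ g) (hat i) (hat j) := by
  rw [operatorImage]
  split_ifs with h
  · have hκ := continuous_interpolate hN ℓ g
    set κ := interpolate N ℓ g with hκdef
    rw [energyForm_comm, energyForm_hat_eq_sum hN hκ (exists_lipschitzWith_hat hN j) k.le_succ,
      sum_restrict hN rfl i fun p => energyForm κ (hat j) (hat p), Finset.sum_comm]
    refine Finset.sum_congr rfl fun η _ => ?_
    obtain ⟨p, hp, hp1, hp2⟩ := exists_fine_node hi η
    rw [pixel_of_eq _ p hp1 hp2, energyForm_comm,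
      energyForm_hat_eq_sum hN hκ (exists_lipschitzWith_hat hN p) k.le_succ,
      sum_eq_sum_pixel _ ((p.1 : ℕ) : ℤ) ((p.2 : ℕ) : ℤ), Finset.mul_sum]
    · refine Finset.sum_congr rfl fun ε _ => ?_
      rw [mul_assoc]
      congr 1
      rw [pixel_of_eq _ p hp1 hp2]
      simp only [hat_nodePos_eq_twoScale hN rfl]
      rw [pixel_mul fun P Q => twoScale (P - 2 * ((j.1 : ℕ) : ℤ)) (Q - 2 * ((j.2 : ℕ) : ℤ))]
      congr 1
      · congr 1
        · rw [hp1, h₁]; ring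
        · rw [hp2, h₂]; ring
      · have b1 := abs_le.1 (abs_offset_le ε.1)
        have b2 := abs_le.1 (abs_offset_le ε.2)
        obtain ⟨⟨g1, g2⟩, g3, g4⟩ := hp
        obtain ⟨q, hq1, hq2⟩ : ∃ q : Node N (k + 1),
            ((q.1 : ℕ) : ℤ) = ((p.1 : ℕ) : ℤ) + offset ε.1 ∧
            ((q.2 : ℕ) : ℤ) = ((p.2 : ℕ) : ℤ) + offset ε.2 := by
          obtain ⟨P, hP⟩ := Int.eq_ofNat_of_zero_le (show 0 ≤ ((p.1 : ℕ) : ℤ) + offset ε.1 by omega)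
          obtain ⟨Q, hQ⟩ := Int.eq_ofNat_of_zero_le (show 0 ≤ ((p.2 : ℕ) : ℤ) + offset ε.2 by omega)
          exact ⟨(⟨P, by omega⟩, ⟨Q, by omega⟩), hP.symm, hQ.symm⟩
        rw [pixel_of_eq _ q hq1 hq2]
        exact operatorImage_eq hN g (k + 1) h ε p q ⟨⟨g1, g2⟩, g3, g4⟩ hq1 hq2
    · intro q hq
      by_contra hne
      refine right_ne_zero_of_mul hq (energyForm_hat_eq_zero fun x hx hx' => hne ?_)
      exact abs_sub_le_one_of_hat_ne_zero hx hx'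
  · obtain rfl : k = ℓ := le_antisymm hk (not_lt.1 h)
    rw [energyForm_interpolate hN k g (exists_lipschitzWith_hat hN i) (exists_lipschitzWith_hat hN j),
      sum_eq_sum_pixel _ ((i.1 : ℕ) : ℤ) ((i.2 : ℕ) : ℤ)]
    · refine Finset.sum_congr rfl fun η _ => ?_
      simp only [energyForm_hat_translate hN hi, nodePos_sub, mul_comm (nodalImage N k g _)]
      rw [pixel_mul fun P Q => stencilIntegral (meshWidth N k)
        !₂[((P - ((i.1 : ℕ) : ℤ) : ℤ) : ℝ) * meshWidth N k,
          ((Q - ((i.2 : ℕ) : ℤ) : ℤ) : ℝ) * meshWidth N k]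
        !₂[((((j.1 : ℕ) : ℤ) - ((i.1 : ℕ) : ℤ) : ℤ) : ℝ) * meshWidth N k,
          ((((j.2 : ℕ) : ℤ) - ((i.2 : ℕ) : ℤ) : ℤ) : ℝ) * meshWidth N k]]
      rw [h₁, h₂]
      simp only [add_sub_cancel_left]
    · intro l hl
      by_contra hne
      refine right_ne_zero_of_mul hl (energyForm_mul_hat_eq_zero fun x hx hx' => hne ?_)
      exact abs_sub_le_one_of_hat_ne_zero hx' hx
termination_by ℓ - k

end Window

/-! ### Convenient forms of the layers -/

section Layers

variable {N L : ℕ} {X : Type} {σ : ℝ → ℝ} {active : ∀ k : Fin L, Finset (Node N k)} {hL : 0 < L}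
  {a b : X → Node N (finest hL) → ℝ}

/-- All offsets of a kernel. -/
def offsets : List (Fin 3 × Fin 3) := Finset.univ.toList

lemma length_offsets : offsets.length = 9 := by
  rw [offsets, Finset.length_toList]
  rfl

lemma sum_map_offsets (f : Fin 3 × Fin 3 → ℝ) : (offsets.map f).sum = ∑ δ, f δ :=
  Finset.sum_map_toList _ _

lemma ConvSpec.value_eq_sum {k : Fin L} (t : ConvSpec N X k) (x : X) (i : Node N k) :
    t.value x i = ∑ δ : Fin 3 × Fin 3, t.kernel δ.1 δ.2 *
      t.kind.sample (t.image x) ((i.1 : ℕ) : ℤ) ((i.2 : ℕ) : ℤ) (offset δ.1) (offset δ.2) := by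
  rw [Fintype.sum_prod_type]
  rfl

/-- Translation of an image. -/
def shiftSpec (k : Fin L) (v : X → Node N k → ℝ) (δ : Fin 3 × Fin 3) : ConvSpec N X k :=
  ⟨k, v, .vanilla rfl, fun d e => if (d, e) = δ then 1 else 0⟩

lemma shiftSpec_value {k : Fin L} (v : X → Node N k → ℝ) (δ : Fin 3 × Fin 3) (x : X)
    (i : Node N k) : (shiftSpec k v δ).value x i =
      pixel (v x) (((i.1 : ℕ) : ℤ) + offset δ.1) (((i.2 : ℕ) : ℤ) + offset δ.2) := by
  rw [ConvSpec.value_eq_sum]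
  simp [shiftSpec, ConvKind.sample]

/-- Restriction of a dual image to the next coarser level. -/
def restrictSpec {k k' : Fin L} (h : (k' : ℕ) = k + 1) (v : X → Node N k' → ℝ) : ConvSpec N X k :=
  ⟨k', v, .strided h, fun d e => twoScale (offset d) (offset e)⟩

lemma restrictSpec_value (hN : 0 < N) {k k' : Fin L} (h : (k' : ℕ) = k + 1) (v : X → Node N k' → ℝ)
    (x : X) (i : Node N k) :
    (restrictSpec h v).value x i = ∑ j, hat i (nodePos j) * v x j := by
  rw [ConvSpec.value_eq_sum, sum_restrict hN h]
  rfl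

/-- Prolongation of an image to the next finer level. -/
def prolongSpec {k k' : Fin L} (h : (k' : ℕ) = k + 1) (v : X → Node N k → ℝ) : ConvSpec N X k' :=
  ⟨k, v, .transposed h, fun d e => twoScale (offset d) (offset e)⟩

lemma prolongSpec_value (hN : 0 < N) {k k' : Fin L} (h : (k' : ℕ) = k + 1) (v : X → Node N k → ℝ)
    (x : X) (j : Node N k') :
    (prolongSpec h v).value x j = ∑ i, hat i (nodePos j) * v x i := by
  rw [ConvSpec.value_eq_sum, sum_prolong hN h]
  rfl

lemma Approx.insert_linear {n : ℕ} {T : Set (Σ k : Fin L, X → Node N k → ℝ)}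
    (hT : Approx σ active hL a b n T) {k : Fin L} (terms : List (ConvSpec N X k))
    (h : ∀ t ∈ terms, ⟨t.src, t.image⟩ ∈ T) (t : X → Node N k → ℝ)
    (ht : ∀ x i, t x i = (terms.map fun s => s.value x i).sum) {m : ℕ}
    (hm : n + (18 * terms.length + 1) ≤ m) : Approx σ active hL a b m (insert ⟨k, t⟩ T) := by
  have e : t = layerImage σ active false false terms 0 := by
    funext x i
    simp [layerImage, ht]
  rw [e]
  exact (hT.linear false terms h).mono hm subset_rfl

lemma Approx.insert_sparse {n : ℕ} {T : Set (Σ k : Fin L, X → Node N k → ℝ)}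
    (hT : Approx σ active hL a b n T) {k : Fin L} (terms : List (ConvSpec N X k))
    (h : ∀ t ∈ terms, ⟨t.src, t.image⟩ ∈ T) (t : X → Node N k → ℝ)
    (ht : ∀ x, ∀ i ∈ active k, t x i = (terms.map fun s => s.value x i).sum)
    (ht' : ∀ x, ∀ i ∉ active k, t x i = 0) {m : ℕ}
    (hm : n + (18 * terms.length + 1) ≤ m) : Approx σ active hL a b m (insert ⟨k, t⟩ T) := by
  have e : t = layerImage σ active false true terms 0 := by
    funext x i
    by_cases hi : i ∈ active k
    · simp [layerImage, hi, ht x i hi]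
    · simp [layerImage, hi, ht' x i hi]
  rw [e]
  exact (hT.linear true terms h).mono hm subset_rfl

/-- Since targets are only ever added, images that depend on `T` alone can be computed one by one at
a fixed cost each. -/
lemma Approx.union_image {ι : Type*} [DecidableEq ι] (t : ι → Σ k : Fin L, X → Node N k → ℝ) {c : ℕ}
    {T : Set (Σ k : Fin L, X → Node N k → ℝ)}
    (h : ∀ i n T', T ⊆ T' → Approx σ active hL a b n T' →
      Approx σ active hL a b (n + c) (insert (t i) T'))
    (s : Finset ι) {n : ℕ} (hT : Approx σ active hL a b n T) :
    Approx σ active hL a b (n + c * s.card) (T ∪ t '' s) := by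
  induction s using Finset.induction_on with
  | empty => simpa using hT
  | insert i s hi ih =>
    refine (h i _ _ subset_union_left ih).mono ?_ ?_
    · rw [Finset.card_insert_of_notMem hi]
      exact (by ring : n + c * s.card + c = n + c * (s.card + 1)).le
    · rw [Finset.coe_insert, image_insert_eq, union_insert]

lemma Approx.union_range_offsets (t : Fin 3 × Fin 3 → Σ k : Fin L, X → Node N k → ℝ) {c : ℕ}
    {T : Set (Σ k : Fin L, X → Node N k → ℝ)}
    (h : ∀ i n T', T ⊆ T' → Approx σ active hL a b n T' →
      Approx σ active hL a b (n + c) (insert (t i) T'))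
    {n : ℕ} (hT : Approx σ active hL a b n T) :
    Approx σ active hL a b (n + 9 * c) (T ∪ range t) := by
  have := hT.union_image t h Finset.univ
  rw [Finset.coe_univ, image_univ] at this
  exact this.mono (by simp [mul_comm]) subset_rfl

end Layers

/-! ### The relaxation as a network -/

section Relaxation

variable {N L : ℕ} (hL : 0 < L) (G : LocalGrid N L) {X : Type} (g φ : X → Plane → ℝ) (σ : ℝ → ℝ)

/-- Approximability in terms of the nodal values of the coefficients `g x` and the load images of
the functions `φ x`. -/
abbrev GridApprox (n : ℕ) (T : Set (Σ k : Fin L, X → Node N k → ℝ)) : Prop :=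
  Approx σ G.nodes hL (fun x => nodalImage N (finest hL) (g x))
    (fun x => loadImage N (finest hL) (φ x)) n T

/-- The images of the operator on one level. -/
def operatorTarget (k : Fin L) (δ : Fin 3 × Fin 3) : Σ k : Fin L, X → Node N k → ℝ :=
  ⟨k, fun x => operatorImage (nodalImage N (finest hL) (g x)) k δ⟩

/-- The images of the right-hand side on one level. -/
def loadTarget (k : Fin L) : Σ k : Fin L, X → Node N k → ℝ := ⟨k, fun x => loadImage N k (φ x)⟩

/-- The images of the operator and of the right-hand side on all levels. -/
def dataTargets : Set (Σ k : Fin L, X → Node N k → ℝ) :=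
  {t | ∃ k, t = loadTarget φ k ∨ ∃ δ, t = operatorTarget hL g k δ}

variable {G} in
/-- The coefficients of one level. -/
def stateTarget (u : X → G.Dof → ℝ) (k : Fin L) : Σ k : Fin L, X → Node N k → ℝ :=
  ⟨k, fun x => G.fullExtend (u x) k⟩

variable {G} in
/-- The contribution of the coarser levels. -/
def coarseTarget (u : X → G.Dof → ℝ) (k : Fin L) : Σ k : Fin L, X → Node N k → ℝ :=
  ⟨k, fun x => G.coarsePart (u x) k⟩

variable {G} in
/-- The contribution of the finer levels. -/
def fineTarget (u : X → G.Dof → ℝ) (k : Fin L) : Σ k : Fin L, X → Node N k → ℝ :=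
  ⟨k, fun x => G.finePart (interpolate N (finest hL) (g x)) (u x) k⟩

variable {G} in
/-- The data, the coefficients, and those auxiliary quantities which are up to date when level `m` is
to be processed. -/
def sweepTargets (u : X → G.Dof → ℝ) (m : Fin L) : Set (Σ k : Fin L, X → Node N k → ℝ) :=
  dataTargets hL g φ ∪ {t | ∃ k, t = stateTarget u k ∨ (k ≤ m ∧ t = coarseTarget u k) ∨
    (m ≤ k ∧ t = fineTarget hL g u k)}

variable {G} in
/-- The damped Richardson step for level `k`, for all parameters simultaneously. -/
def familyStep (ω : ℝ) (u : X → G.Dof → ℝ) (k : Fin L) : X → G.Dof → ℝ :=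
  fun x => G.levelStep (interpolate N (finest hL) (g x)) ω (G.rhs (φ x)) (u x) k

variable {hL G g φ σ}

lemma load_mem (k : Fin L) : loadTarget (N := N) φ k ∈ dataTargets (N := N) hL g φ := ⟨k, Or.inl rfl⟩

lemma operator_mem (k : Fin L) (δ : Fin 3 × Fin 3) :
    operatorTarget (N := N) hL g k δ ∈ dataTargets (N := N) hL g φ := ⟨k, Or.inr ⟨δ, rfl⟩⟩

lemma isInterior_of_mem {k : Fin L} {i : Node N k} (hi : i ∈ G.nodes k) : IsInterior i :=
  G.interior k i hi

lemma pixel_add {ℓ : ℕ} (v w : Node N ℓ → ℝ) (p q : ℤ) :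
    pixel (fun i => v i + w i) p q = pixel v p q + pixel w p q := by
  unfold pixel
  split_ifs <;> simp

/-- The operator applied to an image, in terms of the operator images. -/
lemma sum_energyForm_mul (hN : 0 < N) {ℓ k : ℕ} (hk : k ≤ ℓ) (c : Plane → ℝ) {i : Node N k}
    (hi : IsInterior i) (w : Node N k → ℝ) :
    ∑ j : Node N k, energyForm (interpolate N ℓ c) (hat i) (hat j) * w j =
      ∑ δ : Fin 3 × Fin 3, operatorImage (nodalImage N ℓ c) k δ i *
        pixel w (((i.1 : ℕ) : ℤ) + offset δ.1) (((i.2 : ℕ) : ℤ) + offset δ.2) := by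
  rw [sum_eq_sum_pixel _ ((i.1 : ℕ) : ℤ) ((i.2 : ℕ) : ℤ)]
  · refine Finset.sum_congr rfl fun δ _ => ?_
    rcases pixel_cases (N := N) (ℓ := k) (((i.1 : ℕ) : ℤ) + offset δ.1)
      (((i.2 : ℕ) : ℤ) + offset δ.2) with ⟨j, h₁, h₂⟩ | ⟨h, -⟩
    · rw [pixel_of_eq _ j h₁ h₂, pixel_of_eq _ j h₁ h₂, operatorImage_eq hN c k hk δ i j hi h₁ h₂]
    · rw [h, h, mul_zero]
  · intro j hj
    by_contra hne
    refine left_ne_zero_of_mul hj (energyForm_hat_eq_zero fun x hx hx' => hne ?_)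
    exact abs_sub_le_one_of_hat_ne_zero hx hx'

/-- The transposed operator applied to coefficients, in terms of the operator images. -/
lemma sum_mul_energyForm (hN : 0 < N) {ℓ k : ℕ} (hk : k ≤ ℓ) (c : Plane → ℝ) (j : Node N k)
    (w : Node N k → ℝ) (hw : ∀ i, w i ≠ 0 → IsInterior i) :
    ∑ i : Node N k, w i * energyForm (interpolate N ℓ c) (hat i) (hat j) =
      ∑ δ : Fin 3 × Fin 3,
        pixel (fun i => operatorImage (nodalImage N ℓ c) k (δ.1.rev, δ.2.rev) i * w i)
          (((j.1 : ℕ) : ℤ) + offset δ.1) (((j.2 : ℕ) : ℤ) + offset δ.2) := by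
  rw [sum_eq_sum_pixel _ ((j.1 : ℕ) : ℤ) ((j.2 : ℕ) : ℤ)]
  · refine Finset.sum_congr rfl fun δ _ => ?_
    rcases pixel_cases (N := N) (ℓ := k) (((j.1 : ℕ) : ℤ) + offset δ.1)
      (((j.2 : ℕ) : ℤ) + offset δ.2) with ⟨i, h₁, h₂⟩ | ⟨h, -⟩
    · rw [pixel_of_eq _ i h₁ h₂, pixel_of_eq _ i h₁ h₂]
      -- At boundary nodes the operator images need not be entries of the operator, but there the
      -- coefficient vanishes. This is why the product is taken before the translation.
      by_cases hi : w i = 0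
      · rw [hi, zero_mul, mul_zero]
      · rw [operatorImage_eq hN c k hk _ i j (hw i hi), mul_comm]
        · rw [offset_rev, h₁]; ring
        · rw [offset_rev, h₂]; ring
    · rw [h, h]
  · intro i hi
    by_contra hne
    refine right_ne_zero_of_mul hi (energyForm_hat_eq_zero fun x hx hx' => hne ?_)
    exact abs_sub_le_one_of_hat_ne_zero hx' hx

lemma le_finest (k : Fin L) : (k : ℕ) ≤ (finest hL : Fin L) := Nat.le_sub_one_of_lt k.2

/-- For each offset, the shifted sum of coarse part and coefficients is formed and multiplied with
an operator image (`37 + 130` parameters). A sparse layer with twelve terms then assembles the step: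
`9 * 167 + 217 = 1720`. -/
lemma GridApprox.familyStep (hN : 0 < N)
    (hσ : ∃ x₀ : ℝ, ContDiffAt ℝ 3 σ x₀ ∧ iteratedDeriv 2 σ x₀ ≠ 0)
    {n : ℕ} {u : X → G.Dof → ℝ} {k : Fin L} {ω : ℝ}
    (hT : GridApprox hL G g φ σ n (sweepTargets hL g φ u k)) :
    GridApprox hL G g φ σ (n + 1720) (sweepTargets hL g φ (familyStep hL g φ ω u k) k) := by
  let S : Fin 3 × Fin 3 → X → Node N k → ℝ := fun δ x i =>
    pixel (G.coarsePart (u x) k) (((i.1 : ℕ) : ℤ) + offset δ.1) (((i.2 : ℕ) : ℤ) + offset δ.2) +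
    pixel (G.fullExtend (u x) k) (((i.1 : ℕ) : ℤ) + offset δ.1) (((i.2 : ℕ) : ℤ) + offset δ.2)
  let O : Fin 3 × Fin 3 → X → Node N k → ℝ := fun δ x =>
    operatorImage (nodalImage N (finest hL) (g x)) k δ
  have hO : ∀ δ, (⟨k, O δ⟩ : Σ k : Fin L, X → Node N k → ℝ) ∈ sweepTargets hL g φ u k :=
    fun δ => Or.inl (operator_mem k δ)
  have hstate : stateTarget u k ∈ sweepTargets hL g φ u k := Or.inr ⟨k, Or.inl rfl⟩
  have hcoarse : coarseTarget u k ∈ sweepTargets hL g φ u k :=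
    Or.inr ⟨k, Or.inr (Or.inl ⟨le_rfl, rfl⟩)⟩
  have hfine : fineTarget hL g u k ∈ sweepTargets hL g φ u k :=
    Or.inr ⟨k, Or.inr (Or.inr ⟨le_rfl, rfl⟩)⟩
  have h1 := hT.union_range_offsets (c := 167) (fun δ => ⟨k, fun x i => O δ x i * S δ x i⟩) (by
    intro δ n' T' hT' h
    have h2 := h.insert_linear [shiftSpec k (fun x => G.coarsePart (u x) k) δ,
      shiftSpec k (fun x => G.fullExtend (u x) k) δ]
      (by simp only [List.mem_cons, List.not_mem_nil, or_false, forall_eq_or_imp, forall_eq]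
          exact ⟨hT' hcoarse, hT' hstate⟩) (S δ)
      (by intro x i; simp [shiftSpec_value, S]) le_rfl
    have h3 := h2.mul hσ (mem_insert_of_mem _ (hT' (hO δ))) (mem_insert _ _)
    refine h3.mono (by simp) ?_
    exact insert_subset_insert (subset_insert _ _))
  have h2 := h1.insert_sparse ([scaleSpec k (fun x => G.fullExtend (u x) k) 1,
      scaleSpec k (fun x => loadImage N k (φ x)) ω,
      scaleSpec k (fun x => G.finePart (interpolate N (finest hL) (g x)) (u x) k) (-ω)] ++
      offsets.map fun δ => scaleSpec k (fun x i => O δ x i * S δ x i) (-ω))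
    (by
      intro t ht
      simp only [List.cons_append, List.nil_append, List.mem_cons, List.mem_map] at ht
      rcases ht with rfl | rfl | rfl | ⟨δ, -, rfl⟩
      · exact Or.inl hstate
      · exact Or.inl (Or.inl (load_mem k))
      · exact Or.inl hfine
      · exact Or.inr ⟨δ, rfl⟩)
    (fun x => G.fullExtend (LocalMG.familyStep hL g φ ω u k x) k)
    (by
      intro x i hi
      have hstep := LocalGrid.levelStep_apply_self (κ := interpolate N (finest hL) (g x)) (ω := ω)
        (f := G.rhs (φ x)) (u := u x) hN (continuous_interpolate hN _ _) (⟨i, hi⟩ : G.nodes k)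
      have hsum := sum_energyForm_mul hN (le_finest (hL := hL) k) (g x) (isInterior_of_mem hi)
        (fun j => G.coarsePart (u x) k j + G.fullExtend (u x) k j)
      rw [LocalGrid.fullExtend_of_mem _ (⟨i, hi⟩ : G.nodes k)]
      refine hstep.trans ?_
      simp only [LocalGrid.entry]
      rw [hsum, ← LocalGrid.fullExtend_of_mem (u x) (⟨i, hi⟩ : G.nodes k)]
      simp only [List.map_append, List.sum_append, List.map_cons, List.sum_cons, List.map_nil,
        List.sum_nil, List.map_map, Function.comp_def, scaleSpec_value, sum_map_offsets, pixel_add,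
        ← Finset.mul_sum, O, S]
      change _ + ω * (loadImage N k (φ x) i - _) = _
      ring)
    (fun x i hi => LocalGrid.fullExtend_of_notMem _ hi) (m := n + 1720)
    (by
      simp only [List.length_append, List.length_cons, List.length_nil, List.length_map,
        length_offsets]
      omega)
  -- Only the coefficients of level `k` are new; the other targets of the updated iterate coincide
  -- with old ones.
  refine h2.mono le_rfl ?_
  rintro t (ht | ⟨l, rfl | ⟨hl, rfl⟩ | ⟨hl, rfl⟩⟩)
  · exact Or.inr (Or.inl (Or.inl ht))
  · by_cases hlk : l = k
    · subst hlk
      exact Or.inl rfl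
    · refine Or.inr (Or.inl (Or.inr ⟨l, Or.inl ?_⟩))
      unfold stateTarget LocalMG.familyStep
      simp only [LocalGrid.fullExtend_levelStep_of_ne hlk]
  · refine Or.inr (Or.inl (Or.inr ⟨l, Or.inr (Or.inl ⟨hl, ?_⟩)⟩))
    unfold coarseTarget LocalMG.familyStep
    simp only [LocalGrid.coarsePart_levelStep hl]
  · refine Or.inr (Or.inl (Or.inr ⟨l, Or.inr (Or.inr ⟨hl, ?_⟩)⟩))
    unfold fineTarget LocalMG.familyStep
    simp only [LocalGrid.finePart_levelStep hl]

/-- Nine products, one layer collecting their translations, and one strided convolution: `9 * 130 +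
181 + 19 = 1370`. -/
lemma GridApprox.sweep_down (hN : 0 < N)
    (hσ : ∃ x₀ : ℝ, ContDiffAt ℝ 3 σ x₀ ∧ iteratedDeriv 2 σ x₀ ≠ 0)
    {n : ℕ} {u : X → G.Dof → ℝ} {k k' : Fin L} (hk : (k : ℕ) = k' + 1)
    (hT : GridApprox hL G g φ σ n (sweepTargets hL g φ u k)) :
    GridApprox hL G g φ σ (n + 1370) (sweepTargets hL g φ u k') := by
  let O : Fin 3 × Fin 3 → X → Node N k → ℝ := fun δ x =>
    operatorImage (nodalImage N (finest hL) (g x)) k δ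
  let U : X → Node N k → ℝ := fun x => G.fullExtend (u x) k
  let W : X → Node N k → ℝ := fun x j => G.finePart (interpolate N (finest hL) (g x)) (u x) k j +
    ∑ i : Node N k, U x i * energyForm (interpolate N (finest hL) (g x)) (hat i) (hat j)
  have hO : ∀ δ, (⟨k, O δ⟩ : Σ k : Fin L, X → Node N k → ℝ) ∈ sweepTargets hL g φ u k :=
    fun δ => Or.inl (operator_mem k δ)
  have hstate : stateTarget u k ∈ sweepTargets hL g φ u k := Or.inr ⟨k, Or.inl rfl⟩
  have hfine : fineTarget hL g u k ∈ sweepTargets hL g φ u k :=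
    Or.inr ⟨k, Or.inr (Or.inr ⟨le_rfl, rfl⟩)⟩
  have h1 := hT.union_range_offsets (c := 130) (fun δ => ⟨k, fun x i => O δ x i * U x i⟩)
    (fun δ n' T' hT' h => h.mul hσ (hT' (hO δ)) (hT' hstate))
  have h2 := h1.insert_linear
    (scaleSpec k (fun x => G.finePart (interpolate N (finest hL) (g x)) (u x) k) 1 ::
      offsets.map fun δ => shiftSpec k (fun x i => O (δ.1.rev, δ.2.rev) x i * U x i) δ)
    (by
      intro t ht
      simp only [List.mem_cons, List.mem_map] at ht
      rcases ht with rfl | ⟨δ, -, rfl⟩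
      · exact Or.inl hfine
      -- In the transposed operator the row is the neighbour `j + δ`, from which the column `j` is
      -- seen at the reversed offset.
      · exact Or.inr ⟨(δ.1.rev, δ.2.rev), rfl⟩)
    W
    (by
      intro x j
      simp only [List.map_cons, List.sum_cons, List.map_map, Function.comp_def, scaleSpec_value,
        shiftSpec_value, sum_map_offsets, one_mul, W, O]
      rw [sum_mul_energyForm hN (le_finest (hL := hL) k)]
      intro i hi
      by_contra hne
      exact hi (LocalGrid.fullExtend_of_notMem _ fun hmem => hne (isInterior_of_mem hmem)))
    le_rfl
  have h3 := h2.insert_linear [restrictSpec hk W]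
    (by simp only [List.mem_cons, List.not_mem_nil, or_false, forall_eq]
        exact Or.inl rfl)
    (fun x => G.finePart (interpolate N (finest hL) (g x)) (u x) k')
    (by
      intro x j
      simp only [List.map_cons, List.map_nil, List.sum_cons, List.sum_nil, add_zero,
        restrictSpec_value hN]
      exact LocalGrid.finePart_pred hN (continuous_interpolate hN _ _) (u x) hk j)
    (m := n + 1370)
    (by
      simp only [List.length_cons, List.length_nil, List.length_map, length_offsets]
      omega)
  refine h3.mono le_rfl ?_
  rintro t (ht | ⟨l, rfl | ⟨hl, rfl⟩ | ⟨hl, rfl⟩⟩)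
  · exact Or.inr (Or.inr (Or.inl (Or.inl ht)))
  · exact Or.inr (Or.inr (Or.inl (Or.inr ⟨l, Or.inl rfl⟩)))
  · refine Or.inr (Or.inr (Or.inl (Or.inr ⟨l, Or.inr (Or.inl ⟨hl.trans ?_, rfl⟩)⟩)))
    rw [Fin.le_def]; omega
  · by_cases hlk : l = k'
    · subst hlk
      exact Or.inl rfl
    · refine Or.inr (Or.inr (Or.inl (Or.inr ⟨l, Or.inr (Or.inr ⟨?_, rfl⟩)⟩)))
      rw [Fin.le_def] at hl ⊢
      rw [Fin.ext_iff] at hlk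
      omega

lemma Approx.insert_coarse (hN : 0 < N) {n : ℕ} {T : Set (Σ k : Fin L, X → Node N k → ℝ)}
    {u : X → G.Dof → ℝ} {k k' : Fin L} (hk : (k' : ℕ) = k + 1)
    (hT : GridApprox hL G g φ σ n T) (h₁ : coarseTarget u k ∈ T) (h₂ : stateTarget u k ∈ T) :
    GridApprox hL G g φ σ (n + 37) (insert (coarseTarget u k') T) := by
  refine hT.insert_linear [prolongSpec hk fun x => G.coarsePart (u x) k,
    prolongSpec hk fun x => G.fullExtend (u x) k] ?_ _ ?_ (by simp)
  · simp only [List.mem_cons, List.not_mem_nil, or_false, forall_eq_or_imp, forall_eq]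
    exact ⟨h₁, h₂⟩
  · intro x j
    simp only [List.map_cons, List.map_nil, List.sum_cons, List.sum_nil, add_zero,
      prolongSpec_value hN]
    rw [LocalGrid.coarsePart_succ hN (u x) hk j, ← Finset.sum_add_distrib]
    simp only [mul_add]

lemma GridApprox.sweep_up (hN : 0 < N) {n : ℕ} {u : X → G.Dof → ℝ} {k k' : Fin L} (hk : (k' : ℕ) = k + 1)
    (hT : GridApprox hL G g φ σ n (sweepTargets hL g φ u k)) :
    GridApprox hL G g φ σ (n + 37) (sweepTargets hL g φ u k') := by
  refine (Approx.insert_coarse (u := u) hN hk hT (Or.inr ⟨k, Or.inr (Or.inl ⟨le_rfl, rfl⟩)⟩)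
    (Or.inr ⟨k, Or.inl rfl⟩)).mono le_rfl ?_
  rintro t (ht | ⟨l, rfl | ⟨hl, rfl⟩ | ⟨hl, rfl⟩⟩)
  · exact Or.inr (Or.inl ht)
  · exact Or.inr (Or.inr ⟨l, Or.inl rfl⟩)
  · by_cases hlk : l = k'
    · subst hlk
      exact Or.inl rfl
    · refine Or.inr (Or.inr ⟨l, Or.inr (Or.inl ⟨?_, rfl⟩)⟩)
      rw [Fin.le_def] at hl ⊢
      rw [Fin.ext_iff] at hlk
      omega
  · refine Or.inr (Or.inr ⟨l, Or.inr (Or.inr ⟨le_trans ?_ hl, rfl⟩)⟩)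
    rw [Fin.le_def]; omega

/-- The data and the coefficients. -/
def iterTargets (hL : 0 < L) (g φ : X → Plane → ℝ) (u : X → G.Dof → ℝ) :
    Set (Σ k : Fin L, X → Node N k → ℝ) :=
  dataTargets hL g φ ∪ range (stateTarget u)

/-- This is the initialization of `ũ`. On the coarsest level it is zero, which is a layer without
convolutions. -/
lemma GridApprox.coarse_all (hN : 0 < N) {n : ℕ} {u : X → G.Dof → ℝ}
    (hT : GridApprox hL G g φ σ n (iterTargets hL g φ u)) (m : ℕ) :
    GridApprox hL G g φ σ (n + 37 * m)
      (iterTargets hL g φ u ∪ {t | ∃ k : Fin L, (k : ℕ) < m ∧ t = coarseTarget u k}) := by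
  induction m with
  | zero => simpa using hT
  | succ m ih =>
    by_cases hm : m < L
    · have h : GridApprox hL G g φ σ (n + 37 * m + 37) (insert (coarseTarget u ⟨m, hm⟩)
          (iterTargets hL g φ u ∪ {t | ∃ k : Fin L, (k : ℕ) < m ∧ t = coarseTarget u k})) := by
        rcases Nat.eq_zero_or_pos m with rfl | hpos
        · refine ih.insert_linear [] (by simp) _ ?_ (by simp)
          intro x i
          rw [LocalGrid.coarsePart_zero _ rfl]
          rfl
        · exact Approx.insert_coarse hN (k := ⟨m - 1, by omega⟩) (by simp only; omega) ih
            (Or.inr ⟨_, by simp only; omega, rfl⟩) (Or.inl (Or.inr ⟨_, rfl⟩))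
      refine h.mono (by omega) ?_
      rintro t (ht | ⟨l, hl, rfl⟩)
      · exact Or.inr (Or.inl ht)
      · by_cases hlm : (l : ℕ) = m
        · subst hlm
          exact Or.inl rfl
        · exact Or.inr (Or.inr ⟨l, by omega, rfl⟩)
    · refine ih.mono (by omega) ?_
      rintro t (ht | ⟨l, -, rfl⟩)
      · exact Or.inl ht
      · exact Or.inr ⟨l, by omega, rfl⟩

lemma GridApprox.sweep_start (hN : 0 < N) {n : ℕ} {u : X → G.Dof → ℝ}
    (hT : GridApprox hL G g φ σ n (iterTargets hL g φ u)) :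
    GridApprox hL G g φ σ (n + 37 * L + 1) (sweepTargets hL g φ u (finest hL)) := by
  have h := (hT.coarse_all hN L).insert_linear (k := finest hL) [] (by simp)
    (fun x => G.finePart (interpolate N (finest hL) (g x)) (u x) (finest hL))
    (by
      intro x i
      rw [LocalGrid.finePart_finest]
      · rfl
      · change ¬ (L - 1 + 1 < L)
        omega) le_rfl
  refine h.mono (by simp) ?_
  rintro t (ht | ⟨l, rfl | ⟨hl, rfl⟩ | ⟨hl, rfl⟩⟩)
  · exact Or.inr (Or.inl (Or.inl ht))
  · exact Or.inr (Or.inl (Or.inr ⟨l, rfl⟩))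
  · exact Or.inr (Or.inr ⟨l, l.2, rfl⟩)
  · obtain rfl : l = finest hL := by
      refine le_antisymm ?_ hl
      rw [Fin.le_def]
      exact le_finest l
    exact Or.inl rfl

lemma foldl_add_const {α : Type*} (c : ℕ) (l : List α) (n : ℕ) :
    l.foldl (fun n _ => n + c) n = n + c * l.length := by
  induction l generalizing n with
  | nil => simp
  | cons a l ih => rw [List.foldl_cons, ih, List.length_cons]; ring

lemma foldl_familyStep (ω : ℝ) (l : List (Fin L)) (u : X → G.Dof → ℝ) (x : X) :
    l.foldl (familyStep hL g φ ω) u x =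
      l.foldl (G.levelStep (interpolate N (finest hL) (g x)) ω (G.rhs (φ x))) (u x) := by
  induction l generalizing u with
  | nil => rfl
  | cons k l ih => rw [List.foldl_cons, ih, List.foldl_cons]; rfl

/-- One run of the relaxation can be carried out with a number of parameters that is proportional to
the number of levels. -/
lemma GridApprox.run (hN : 0 < N) (hσ : ∃ x₀ : ℝ, ContDiffAt ℝ 3 σ x₀ ∧ iteratedDeriv 2 σ x₀ ≠ 0)
    {n : ℕ} {u : X → G.Dof → ℝ} (ω : ℝ)
    (hT : GridApprox hL G g φ σ n (iterTargets hL g φ u)) :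
    GridApprox hL G g φ σ (n + 5000 * L) (iterTargets hL g φ fun x =>
      G.relaxRun (interpolate N (finest hL) (g x)) ω (G.rhs (φ x)) (u x)) := by
  have h0 := hT.sweep_start hN
  -- The state of the first fold merely counts parameters: `1720 + 1370` per level downwards and
  -- `1720 + 37` upwards. With the start-up cost `37 L + 1` this stays below `5000 L`.
  have h1 := foldl_down hL (stepS := fun n _ => n + 3090) (stepU := LocalMG.familyStep hL g φ ω)
    (I := fun n u k => GridApprox hL G g φ σ n (sweepTargets hL g φ u k))
    (fun n u k h => (h.familyStep hN hσ).mono (by omega) subset_rfl)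
    (fun n u k k' hk h => ((h.familyStep hN hσ).sweep_down hN hσ hk)) h0
  have h2 := foldl_up hL (stepS := fun n _ => n + 1757) (stepU := LocalMG.familyStep hL g φ ω)
    (I := fun n u k => GridApprox hL G g φ σ n (sweepTargets hL g φ u k))
    (fun n u k h => (h.familyStep hN hσ).mono (by omega) subset_rfl)
    (fun n u k k' hk h => ((h.familyStep hN hσ).sweep_up hN hk)) h1
  rw [foldl_add_const, foldl_add_const, List.length_reverse, List.length_finRange] at h2
  refine h2.mono (by omega) ?_
  rintro t (ht | ⟨k, rfl⟩)
  · exact Or.inl ht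
  · refine Or.inr ⟨k, Or.inl ?_⟩
    unfold stateTarget
    simp only [foldl_familyStep]
    rfl

/-! ### Computation of the data on all levels -/

/-- The operator images are linear in those of the next finer level, or in the input on the finest
level: nine layers with at most nine convolutions, and one more for the load, `9 * 163 + 19 = 1486`.
-/
lemma GridApprox.data_level (hN : 0 < N) (hφ : ∀ x, Continuous (φ x)) {n : ℕ} {m : ℕ} (hm : m < L)
    {T : Set (Σ k : Fin L, X → Node N k → ℝ)} (hT : GridApprox hL G g φ σ n T)
    (ha : (⟨finest hL, fun x => nodalImage N (finest hL) (g x)⟩ : Σ k : Fin L, X → Node N k → ℝ) ∈ T)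
    (hb : loadTarget φ (finest hL) ∈ T)
    (hdata : ∀ k : Fin L, (k : ℕ) = m + 1 →
      loadTarget φ k ∈ T ∧ ∀ δ, operatorTarget hL g k δ ∈ T) :
    GridApprox hL G g φ σ (n + 1486)
      (insert (loadTarget φ ⟨m, hm⟩) (T ∪ range (operatorTarget hL g ⟨m, hm⟩))) := by
  by_cases hm' : m + 1 < L
  · let k' : Fin L := ⟨m + 1, hm'⟩
    obtain ⟨h₁, h₂⟩ := hdata k' rfl
    have hstep := hT.union_range_offsets (c := 163) (operatorTarget hL g ⟨m, hm⟩) (by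
      intro δ n' T' hT' h
      refine h.insert_linear (k := ⟨m, hm⟩) (offsets.map fun ε => ⟨k',
        fun x => operatorImage (nodalImage N (finest hL) (g x)) k' ε, .strided rfl,
        fun d e => twoScale (offset d) (offset e) *
          twoScale (offset ε.1 + offset d - 2 * offset δ.1) (offset ε.2 + offset e - 2 * offset δ.2)⟩)
        ?_ _ ?_ ?_
      · intro t ht
        obtain ⟨ε, -, rfl⟩ := List.mem_map.1 ht
        exact hT' (h₂ ε)
      · intro x i
        rw [List.map_map, Function.comp_def, sum_map_offsets, operatorImage, if_pos]
        · refine Finset.sum_congr rfl fun ε _ => ?_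
          rw [ConvSpec.value_eq_sum]
          rfl
        · change m < L - 1
          omega
      · rw [List.length_map, length_offsets])
    refine hstep.insert_linear (k := ⟨m, hm⟩) [restrictSpec (k' := k') rfl fun x => loadImage N k' (φ x)]
      ?_ _ ?_ (by simp)
    · simp only [List.mem_cons, List.not_mem_nil, or_false, forall_eq]
      exact Or.inl h₁
    · intro x i
      simp only [List.map_cons, List.map_nil, List.sum_cons, List.sum_nil, add_zero,
        restrictSpec_value hN]
      exact loadFunctional_hat_eq_sum hN (hφ x) (Nat.le_succ m) i
  · obtain ⟨k, hk⟩ : ∃ k : Fin L, k = ⟨m, hm⟩ := ⟨_, rfl⟩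
    have hkf : k = finest hL := by
      rw [hk]
      refine Fin.ext ?_
      change m = L - 1
      omega
    rw [← hk]
    subst hkf
    have hstep := hT.union_range_offsets (c := 163) (operatorTarget hL g (finest hL)) (by
      intro δ n' T' hT' h
      refine h.insert_linear (k := finest hL) [⟨finest hL,
        fun x => nodalImage N (finest hL) (g x), .vanilla rfl,
        fun d e => stencilIntegral (meshWidth N (finest hL : Fin L))
          !₂[(offset d : ℝ) * meshWidth N (finest hL : Fin L),
            (offset e : ℝ) * meshWidth N (finest hL : Fin L)]
          !₂[(offset δ.1 : ℝ) * meshWidth N (finest hL : Fin L),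
            (offset δ.2 : ℝ) * meshWidth N (finest hL : Fin L)]⟩] ?_ _ ?_ ?_
      · simp only [List.mem_cons, List.not_mem_nil, or_false, forall_eq]
        exact hT' ha
      · intro x i
        rw [List.map_singleton, List.sum_singleton, ConvSpec.value_eq_sum, operatorImage,
          if_neg (lt_irrefl _)]
        rfl
      · simp)
    exact hstep.mono (by omega) (insert_subset (Or.inl hb) subset_rfl)

/-- The data on all levels can be computed with a number of parameters that is proportional to the
number of levels. -/
lemma gridApprox_data (hN : 0 < N) (hφ : ∀ x, Continuous (φ x))
    (ha : ∃ B : ℝ, ∀ x i, |nodalImage N (finest hL) (g x) i| ≤ B)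
    (hb : ∃ B : ℝ, ∀ x i, |loadImage N (finest hL) (φ x) i| ≤ B) :
    GridApprox hL G g φ σ (1486 * L) (dataTargets hL g φ) := by
  have key : ∀ j ≤ L, GridApprox hL G g φ σ (1486 * j)
      ({⟨finest hL, fun x => nodalImage N (finest hL) (g x)⟩, loadTarget φ (finest hL)} ∪
        {t | ∃ k : Fin L, L - j ≤ (k : ℕ) ∧
          (t = loadTarget φ k ∨ ∃ δ, t = operatorTarget hL g k δ)}) := by
    intro j
    induction j with
    | zero =>
      intro _
      refine (approx_input ha hb).mono (by simp) ?_
      rintro t (ht | ⟨k, hk, -⟩)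
      · exact ht
      · have := k.2
        omega
    | succ j ih =>
      intro hj
      have h := GridApprox.data_level (m := L - (j + 1)) hN hφ (by omega) (ih (by omega))
        (Or.inl (Or.inl rfl)) (Or.inl (Or.inr rfl)) (fun k hk =>
          ⟨Or.inr ⟨k, by omega, Or.inl rfl⟩, fun δ => Or.inr ⟨k, by omega, Or.inr ⟨δ, rfl⟩⟩⟩)
      refine h.mono (by omega) ?_
      rintro t (ht | ⟨k, hk, ht⟩)
      · exact Or.inr (Or.inl (Or.inl ht))
      · by_cases hkj : (k : ℕ) = L - (j + 1)
        · have hk' : k = ⟨L - (j + 1), by omega⟩ := Fin.ext hkj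
          rw [hk'] at ht
          rcases ht with rfl | ⟨δ, rfl⟩
          · exact Or.inl rfl
          · exact Or.inr (Or.inr ⟨δ, rfl⟩)
        · exact Or.inr (Or.inl (Or.inr ⟨k, by omega, ht⟩))
  refine (key L le_rfl).mono le_rfl ?_
  rintro t ⟨k, ht⟩
  exact Or.inr ⟨k, by omega, ht⟩

lemma gridApprox_zero (hN : 0 < N) (hφ : ∀ x, Continuous (φ x))
    (ha : ∃ B : ℝ, ∀ x i, |nodalImage N (finest hL) (g x) i| ≤ B)
    (hb : ∃ B : ℝ, ∀ x i, |loadImage N (finest hL) (φ x) i| ≤ B) :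
    GridApprox hL G g φ σ (1487 * L) (iterTargets (G := G) hL g φ fun _ => 0) := by
  have h := (gridApprox_data (G := G) (σ := σ) hN hφ ha hb).union_image
    (stateTarget (G := G) fun _ => 0) (c := 1) (by
      intro k n T' _ h
      refine h.insert_linear [] (by simp) _ ?_ (by simp)
      intro x i
      simp [LocalGrid.fullExtend]) Finset.univ
  rw [Finset.coe_univ, image_univ] at h
  exact h.mono (by simp; omega) subset_rfl

/-- Any number of runs of the relaxation, started from zero. -/
lemma gridApprox_iterate (hN : 0 < N)
    (hσ : ∃ x₀ : ℝ, ContDiffAt ℝ 3 σ x₀ ∧ iteratedDeriv 2 σ x₀ ≠ 0)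
    (hφ : ∀ x, Continuous (φ x))
    (ha : ∃ B : ℝ, ∀ x i, |nodalImage N (finest hL) (g x) i| ≤ B)
    (hb : ∃ B : ℝ, ∀ x i, |loadImage N (finest hL) (φ x) i| ≤ B) (ω : ℝ) (m : ℕ) :
    GridApprox hL G g φ σ (1487 * L + 5000 * L * m) (iterTargets (G := G) hL g φ fun x =>
      (G.relaxRun (interpolate N (finest hL) (g x)) ω (G.rhs (φ x)))^[m] 0) := by
  induction m with
  | zero => exact gridApprox_zero hN hφ ha hb
  | succ m ih =>
    have h := GridApprox.run hN hσ ω ih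
    simp only [← Function.iterate_succ_apply'] at h
    exact h.mono (by rw [mul_add, mul_one, add_assoc]) subset_rfl

end Relaxation

/-! ### The convergence rate -/

lemma rate_pos {c : ℝ} (hc : 0 < c) {L : ℕ} (hL : 0 < L) : 0 < rate c L := by
  have : (0 : ℝ) < L := by exact_mod_cast hL
  unfold rate
  positivity

lemma rate_lt_one {c : ℝ} (hc : 0 < c) (L : ℕ) : rate c L < 1 := by
  unfold rate
  rw [div_lt_one (by positivity)]
  linarith

lemma rate_pow_le {c : ℝ} (hc : 0 < c) {L : ℕ} (hL : 0 < L) {ε : ℝ} (hε : 0 < ε) {m : ℕ}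
    (hm : Real.log ε⁻¹ / Real.log (rate c L)⁻¹ ≤ m) : rate c L ^ m ≤ ε := by
  have h0 := rate_pos hc hL
  have h1 : 0 < Real.log (rate c L)⁻¹ := Real.log_pos ((one_lt_inv₀ h0).2 (rate_lt_one hc L))
  rw [div_le_iff₀ h1, ← Real.log_pow, Real.log_le_log_iff (by positivity) (by positivity), inv_pow]
    at hm
  exact (inv_le_inv₀ hε (by positivity)).1 hm

/-- Bernoulli's inequality for `rate c L = 1 - 1 / (1 + c L)` reduces this to `3 / (1 + c L) ≤ δ /
(2 L)`. -/
lemma one_sub_le_rate_pow {c δ : ℝ} (hδ : 0 < δ) (hc : 6 / δ ≤ c) {L : ℕ} (hL : 0 < L) :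
    1 - δ / (2 * L) ≤ rate c L ^ 3 := by
  have hL' : (0 : ℝ) < L := by exact_mod_cast hL
  have hc0 : 0 < c := lt_of_lt_of_le (by positivity) hc
  have h1 : rate c L = 1 + -(1 / (1 + c * L)) := by
    unfold rate
    field_simp
    ring
  have h2 : 1 / (1 + c * L) ≤ 1 := by
    rw [div_le_one (by positivity)]
    linarith [mul_pos hc0 hL']
  have h3 := one_add_mul_le_pow (show (-2 : ℝ) ≤ -(1 / (1 + c * L)) by linarith) 3
  rw [← h1] at h3
  refine le_trans ?_ h3
  have h4 : 3 * (1 / (1 + c * L)) ≤ δ / (2 * L) := by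
    rw [mul_one_div, div_le_div_iff₀ (by positivity) (by positivity)]
    rw [div_le_iff₀ hδ] at hc
    nlinarith
  push_cast
  linarith

/-- Here `log (rate c L)⁻¹ ≤ 1 / (c L) ≤ 1` and `log ε⁻¹ ≥ log 2`. The bound lets additive constants
in the parameter count be absorbed. -/
lemma half_le_log_div_log_rate {c : ℝ} (hc : 1 ≤ c) {L : ℕ} (hL : 0 < L) {ε : ℝ} (hε : 0 < ε)
    (hε' : ε ≤ 1 / 2) : 1 / 2 ≤ Real.log ε⁻¹ / Real.log (rate c L)⁻¹ := by
  have hL' : (1 : ℝ) ≤ L := by exact_mod_cast hL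
  have hc0 : 0 < c := by linarith
  have h0 := rate_pos hc0 hL
  have h1 : 0 < Real.log (rate c L)⁻¹ := Real.log_pos ((one_lt_inv₀ h0).2 (rate_lt_one hc0 L))
  have h2 : Real.log (rate c L)⁻¹ ≤ 1 := by
    refine (Real.log_le_sub_one_of_pos (by positivity)).trans ?_
    have : (1 : ℝ) ≤ c * L := one_le_mul_of_one_le_of_one_le hc hL'
    unfold rate
    rw [inv_div, sub_le_iff_le_add, div_le_iff₀ (by positivity)]
    linarith
  have h3 : 1 / 2 ≤ Real.log ε⁻¹ := by
    have h4 : (2 : ℝ) ≤ ε⁻¹ := by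
      rw [le_inv_comm₀ (by norm_num) hε]
      linarith
    have := Real.log_le_log (by norm_num) h4
    linarith [Real.log_two_gt_d9]
  rw [le_div_iff₀ h1]
  linarith

/-! ### The energy norm -/

section EnergyNorm

open Matrix

open scoped MatrixOrder in
-- With `A = Bᵀ B` the energy seminorm is a Euclidean norm, from which it inherits the triangle
-- inequality.
lemma SpectralBounds.exists_factor {ι : Type*} [Fintype ι] [DecidableEq ι] {A : Matrix ι ι ℝ}
    {cmin cmax : ℝ} (h : SpectralBounds A cmin cmax) :
    ∃ B : Matrix ι ι ℝ, ∀ v, Real.sqrt (v ⬝ᵥ A *ᵥ v) = ‖WithLp.toLp 2 (B *ᵥ v)‖ := by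
  have hA : A.PosSemidef := by
    refine PosSemidef.of_dotProduct_mulVec_nonneg ?_ fun x => ?_
    · rw [Matrix.IsHermitian, Matrix.conjTranspose_eq_transpose_of_trivial]
      exact h.symm
    · rw [star_trivial]
      exact h.form_nonneg x
  obtain ⟨B, rfl⟩ := CStarAlgebra.nonneg_iff_eq_star_mul_self.1 hA.nonneg
  refine ⟨B, fun v => ?_⟩
  rw [EuclideanSpace.norm_eq, star_eq_conjTranspose, Matrix.conjTranspose_eq_transpose_of_trivial, ← mulVec_mulVec,
    dotProduct_mulVec, ← mulVec_transpose, transpose_transpose]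
  simp [dotProduct, sq]

namespace LocalGrid

variable {N L : ℕ} {G : LocalGrid N L} {κ : Plane → ℝ} {cmin cmax : ℝ}

lemma energyNorm_add_le (h : SpectralBounds (G.stiffness κ) cmin cmax) (v w : G.Dof → ℝ) :
    G.energyNorm κ (v + w) ≤ G.energyNorm κ v + G.energyNorm κ w := by
  obtain ⟨B, hB⟩ := h.exists_factor
  unfold energyNorm
  rw [hB, hB, hB, mulVec_add, WithLp.toLp_add]
  exact norm_add_le _ _

lemma energyNorm_sub_le (h : SpectralBounds (G.stiffness κ) cmin cmax) (u v w : G.Dof → ℝ) :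
    G.energyNorm κ (u - w) ≤ G.energyNorm κ (u - v) + G.energyNorm κ (v - w) := by
  rw [← sub_add_sub_cancel u v w]
  exact energyNorm_add_le h _ _

lemma energyNorm_sub_comm (v w : G.Dof → ℝ) :
    G.energyNorm κ (v - w) = G.energyNorm κ (w - v) := by
  unfold energyNorm
  rw [← neg_sub v w, mulVec_neg, neg_dotProduct, dotProduct_neg, neg_neg]

lemma energyNorm_le_of_abs_le (h : SpectralBounds (G.stiffness κ) cmin cmax) (hmax : 0 ≤ cmax)
    {v : G.Dof → ℝ} {η : ℝ} (hη : 0 ≤ η) (hv : ∀ p, |v p| ≤ η) :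
    G.energyNorm κ v ≤ η * Real.sqrt (cmax * Fintype.card G.Dof) := by
  rw [energyNorm]
  have h1 : v ⬝ᵥ v ≤ Fintype.card G.Dof * η ^ 2 := by
    calc v ⬝ᵥ v ≤ ∑ _ : G.Dof, η ^ 2 := Finset.sum_le_sum fun p _ => by
          rw [← sq, ← sq_abs]
          exact pow_le_pow_left₀ (abs_nonneg _) (hv p) 2
      _ = Fintype.card G.Dof * η ^ 2 := by simp
  calc Real.sqrt (v ⬝ᵥ G.stiffness κ *ᵥ v)
      ≤ Real.sqrt (η ^ 2 * (cmax * Fintype.card G.Dof)) := by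
        refine Real.sqrt_le_sqrt ((h.form_le hmax v).trans ?_)
        linarith [mul_le_mul_of_nonneg_left h1 hmax]
    _ = η * Real.sqrt (cmax * Fintype.card G.Dof) := by
        rw [Real.sqrt_mul (sq_nonneg _), Real.sqrt_sq hη]

lemma isSymm_stiffness : (G.stiffness κ).IsSymm := by
  ext p q
  exact energyForm_comm _ _ _

/-- The iteration converges geometrically in the energy norm. -/
lemma energyNorm_sub_iterate_le (h : SpectralBounds (G.stiffness κ) cmin cmax) (hL : 0 < L) {ω : ℝ}
    (hω : 0 < ω) (hmax : 0 < cmax) (hωc : ω ≤ cmax⁻¹) {ρ : ℝ} (hρ0 : 0 ≤ ρ)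
    (hρ : 1 - cmin * ω / (2 * L) ≤ ρ) {f u : G.Dof → ℝ} (hu : G.stiffness κ *ᵥ u = f) (m : ℕ) :
    G.energyNorm κ (u - (G.relaxRun κ ω f)^[m] 0) ≤ ρ ^ m * G.energyNorm κ u := by
  have sweep : ∀ (l : List (Fin L)) (v : G.Dof → ℝ), l.Nodup → (∀ k, k ∈ l) → l.length = L →
      (u - l.foldl (G.levelStep κ ω f) v) ⬝ᵥ G.stiffness κ *ᵥ (u - l.foldl (G.levelStep κ ω f) v) ≤
        ρ * ((u - v) ⬝ᵥ G.stiffness κ *ᵥ (u - v)) := by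
    intro l v hl hall hlen
    have e : u - l.foldl (G.levelStep κ ω f) v = _ := sub_foldl_blockStep hu l v
    rw [e]
    refine (form_foldl_blockStep_le h hω hmax hωc (u - v) l hl (fun p => hall _) (by omega)).trans ?_
    rw [hlen]
    exact mul_le_mul_of_nonneg_right hρ (h.form_nonneg _)
  -- The two sweeps of a run contract the energy by `ρ ^ 2`, hence its square root by `ρ`.
  have run : ∀ v : G.Dof → ℝ, (u - G.relaxRun κ ω f v) ⬝ᵥ G.stiffness κ *ᵥ (u - G.relaxRun κ ω f v) ≤
      ρ ^ 2 * ((u - v) ⬝ᵥ G.stiffness κ *ᵥ (u - v)) := by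
    intro v
    have s1 := sweep (List.finRange L).reverse v (List.nodup_reverse.2 (List.nodup_finRange L))
      (by simp) (by simp)
    have s2 := sweep (List.finRange L) ((List.finRange L).reverse.foldl (G.levelStep κ ω f) v)
      (List.nodup_finRange L) (by simp) (by simp)
    refine s2.trans ?_
    rw [sq, mul_assoc]
    exact mul_le_mul_of_nonneg_left s1 hρ0
  induction m with
  | zero => simp
  | succ m ih =>
    rw [Function.iterate_succ_apply', pow_succ', mul_assoc]
    refine le_trans ?_ (mul_le_mul_of_nonneg_left ih hρ0)
    unfold energyNorm
    conv_rhs => rw [← Real.sqrt_sq hρ0, ← Real.sqrt_mul (sq_nonneg ρ)]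
    exact Real.sqrt_le_sqrt (run _)

lemma llmgIter_eq (hN : 0 < N) (hL : 0 < L) (hκ : Continuous κ) (hG : G.Nested) (ω : ℝ)
    (f : G.Dof → ℝ) (m : ℕ) : G.llmgIter κ ω f m = (G.relaxRun κ ω f)^[m] 0 := by
  unfold llmgIter
  rw [show G.llmg κ ω f = G.relaxRun κ ω f from funext fun u => llmg_eq_relaxRun hN hL hκ hG f u]

end LocalGrid

end EnergyNorm

/-- A network that approximates the iterates uniformly. -/
lemma exists_cnn_iterate {σ : ℝ → ℝ}
    (hσ : ∃ x₀ : ℝ, ContDiffAt ℝ 3 σ x₀ ∧ iteratedDeriv 2 σ x₀ ≠ 0) {N L : ℕ} (hN : 0 < N)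
    (hL : 0 < L) (G : LocalGrid N L) (Γ : Set (ℕ → ℝ)) (κ : (ℕ → ℝ) → Plane → ℝ) {κmin κmax : ℝ}
    (hκmin : 0 < κmin) (hκ : ∀ y ∈ Γ, ∀ x ∈ unitSquare, κmin ≤ κ y x ∧ κ y x ≤ κmax) (ω M : ℝ)
    (m : ℕ) {η : ℝ} (hη : 0 < η) :
    ∃ Ψ : CNN (inputShape hL), Ψ.numParams ≤ 1487 * L + 5000 * L * m ∧
      ∀ y ∈ Γ, ∀ f ∈ gridSpace N (finest hL), (∀ i, |loadImage N (finest hL) f i| ≤ M) → ∀ p,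
        |Ψ.realize σ G hL (nodalImage N (finest hL) (κ y)) (loadImage N (finest hL) f) p -
          (G.relaxRun (interpolate N (finest hL) (κ y)) ω (G.rhs f))^[m] 0 p| ≤ η := by
  -- The family is indexed by all admissible pairs of parameter and load, so one network serves them
  -- all. The bounds `κmax` and `M` make the input images uniformly bounded.
  let X : Type := {x : (ℕ → ℝ) × (Plane → ℝ) // x.1 ∈ Γ ∧ x.2 ∈ gridSpace N (finest hL) ∧
    ∀ i, |loadImage N (finest hL) x.2 i| ≤ M}
  have happrox := gridApprox_iterate (hL := hL) (G := G) (g := fun x : X => κ x.1.1)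
    (φ := fun x : X => x.1.2) hN hσ (fun x => continuous_of_mem_gridSpace hN x.2.2.1)
    ⟨κmax, fun x i => by
      obtain ⟨h1, h2⟩ := hκ _ x.2.1 _ (nodePos_mem hN i)
      rw [nodalImage, abs_of_pos (hκmin.trans_le h1)]
      exact h2⟩
    ⟨M, fun x i => x.2.2.2 i⟩ ω m
  obtain ⟨Ψ, h1, h2⟩ := happrox.exists_cnn _ (fun k => Or.inr ⟨k, rfl⟩) hη
  refine ⟨Ψ, h1, fun y hy f hf hM p => ?_⟩
  have := h2 ⟨(y, f), hy, hf, hM⟩ p.1 p.2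
  rw [LocalGrid.fullExtend_of_mem] at this
  exact this

end LocalMG

end

open LocalMG

/-! ### Choice of the constants and assembly of the theorem -/

theorem mainTheorem6 (σ : ℝ → ℝ) (hσ : AdmissibleActivation σ) :
    ∃ C : ℝ, 0 < C ∧
      ∀ cmin cmax ω : ℝ, 0 < cmin → 0 < cmax → 0 < ω → ω ≤ cmax⁻¹ →
      ∃ c : ℝ, 0 < c ∧
        ∀ (N L : ℕ) (_hN : 0 < N) (hL : 0 < L) (G : LocalGrid N L)
          (Γ : Set (ℕ → ℝ)) (κ : (ℕ → ℝ) → Plane → ℝ) (κmin κmax : ℝ), 0 < κmin →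
          (∀ y ∈ Γ, ∀ x ∈ unitSquare, κmin ≤ κ y x ∧ κ y x ≤ κmax) →
          (∀ y ∈ Γ, ∀ μ ∈ spectrum ℝ (G.stiffness (interpolate N (finest hL) (κ y))),
            μ ≠ 0 → cmin ≤ μ ∧ μ ≤ cmax) →
          -- convergence of the multigrid iteration with the rate determined by `c`
          (G.Nested → ∀ ε : ℝ, 0 < ε → ∀ m : ℕ,
            Real.log ε⁻¹ / Real.log (rate c L)⁻¹ ≤ m →
            ∀ y ∈ Γ, ∀ f ∈ gridSpace N (finest hL), ∀ u : G.Dof → ℝ,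
              let κh := interpolate N (finest hL) (κ y)
              (G.stiffness κh).mulVec u = G.rhs f →
                G.energyNorm κh (u - G.llmgIter κh ω (G.rhs f) m) ≤ ε * G.energyNorm κh u) ∧
          -- approximation of the discrete solution by a convolutional neural network
          (∀ ε : ℝ, 0 < ε → ε ≤ 1 / 2 → ∀ M : ℝ, 0 < M → ∀ m : ℕ,
            Real.log ε⁻¹ / Real.log (rate c L)⁻¹ ≤ m →
            ∃ Ψ : CNN (inputShape hL),
              (Ψ.numParams : ℝ) ≤ C * L * (Real.log ε⁻¹ / Real.log (rate c L)⁻¹) ∧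
              ∀ y ∈ Γ, ∀ f ∈ gridSpace N (finest hL),
                (∀ i, |loadImage N (finest hL) f i| ≤ M) →
                ∀ u : G.Dof → ℝ,
                  let κh := interpolate N (finest hL) (κ y)
                  let out := Ψ.realize σ G hL (nodalImage N (finest hL) (κ y))
                    (loadImage N (finest hL) f)
                  let v := G.llmgIter κh ω (G.rhs f) m
                  (G.stiffness κh).mulVec u = G.rhs f →
                    G.energyNorm κh (out - u) ≤ ε * (1 + G.energyNorm κh u) ∧
                    (G.Nested →
                      G.energyNorm κh (out - u) ≤
                        G.energyNorm κh (out - v) + G.energyNorm κh (v - u) ∧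
                      G.energyNorm κh (out - v) + G.energyNorm κh (v - u) ≤
                        ε * (1 + G.energyNorm κh u))) := by
  -- With `R` the quotient of logarithms, the count is `1487 L + 5000 L (R + 1) = 6487 L + 5000 L
  -- R`, and `L ≤ 2 L R` turns it into at most `17974 L R`.
  refine ⟨18000, by norm_num, fun cmin cmax ω hcmin hcmax hω hωc => ?_⟩
  have hδ : 0 < cmin * ω := mul_pos hcmin hω
  refine ⟨max 1 (6 / (cmin * ω)), lt_max_of_lt_left one_pos, ?_⟩
  generalize hc : max 1 (6 / (cmin * ω)) = c
  have hc1 : 1 ≤ c := hc ▸ le_max_left _ _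
  have hcδ : 6 / (cmin * ω) ≤ c := hc ▸ le_max_right _ _
  have hc0 : 0 < c := one_pos.trans_le hc1
  intro N L hN hL G Γ κ κmin κmax hκmin hκ hspec
  have hA : ∀ y ∈ Γ, SpectralBounds (G.stiffness (interpolate N (finest hL) (κ y))) cmin cmax :=
    fun y hy => ⟨LocalGrid.isSymm_stiffness, hcmin, hspec y hy⟩
  have hr0 := rate_pos hc0 hL
  have hr1 := rate_lt_one hc0 L
  have hρ := one_sub_le_rate_pow hδ hcδ hL
  -- The reduction per run is `rate c L ^ 3`, so the accuracy reached is both `ε` and `ε ^ 3`: the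
  -- first serves part (i), where `ε` may exceed `1`, the second part (ii).
  have hconv : ∀ y ∈ Γ, ∀ (f u : G.Dof → ℝ),
      (G.stiffness (interpolate N (finest hL) (κ y))).mulVec u = f → ∀ ε : ℝ, 0 < ε → ∀ m : ℕ,
      Real.log ε⁻¹ / Real.log (rate c L)⁻¹ ≤ m →
      G.energyNorm (interpolate N (finest hL) (κ y))
        (u - (G.relaxRun (interpolate N (finest hL) (κ y)) ω f)^[m] 0) ≤
          min ε (ε ^ 3) * G.energyNorm (interpolate N (finest hL) (κ y)) u := by
    intro y hy f u hu ε hε m hm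
    refine (LocalGrid.energyNorm_sub_iterate_le (hA y hy) hL hω hcmax hωc (pow_nonneg hr0.le 3) hρ hu
      m).trans (mul_le_mul_of_nonneg_right ?_ (Real.sqrt_nonneg _))
    have h1 := rate_pow_le hc0 hL hε hm
    rw [← pow_mul, mul_comm, pow_mul]
    refine le_min (le_trans ?_ h1) (pow_le_pow_left₀ (by positivity) h1 3)
    exact pow_le_of_le_one (by positivity) (pow_le_one₀ hr0.le hr1.le) (by norm_num)
  refine ⟨?_, ?_⟩
  · intro hG ε hε m hm y hy f _ u κh hu
    rw [LocalGrid.llmgIter_eq hN hL (continuous_interpolate hN _ _) hG]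
    exact (hconv y hy _ u hu ε hε m hm).trans
      (mul_le_mul_of_nonneg_right (min_le_left _ _) (Real.sqrt_nonneg _))
  · intro ε hε hε' M _ m hm
    obtain ⟨R, hR⟩ : ∃ R, R = Real.log ε⁻¹ / Real.log (rate c L)⁻¹ := ⟨_, rfl⟩
    have hR2 : 1 / 2 ≤ R := hR ▸ half_le_log_div_log_rate hc1 hL hε hε'
    -- The network imitates the least admissible number of runs, because its size must not grow with
    -- `m`.
    obtain ⟨m₀, hm₀, hm₀'⟩ : ∃ m₀ : ℕ, R ≤ m₀ ∧ (m₀ : ℝ) ≤ R + 1 :=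
      ⟨⌈R⌉₊, Nat.le_ceil R, (Nat.ceil_lt_add_one (by linarith)).le⟩
    set K := Real.sqrt (cmax * Fintype.card G.Dof)
    have hK : 0 ≤ K := Real.sqrt_nonneg _
    -- The factor `K` from the maximum norm to the energy norm depends on the grid, but it enters
    -- only the tolerance and not the number of parameters.
    have hη : 0 < ε / 4 / (K + 1) := by positivity
    obtain ⟨Ψ, hΨ, happ⟩ := exists_cnn_iterate hσ.2 hN hL G Γ κ hκmin hκ ω M m₀ hη
    refine ⟨Ψ, ?_, ?_⟩
    · rw [← hR]
      have hL' : (0 : ℝ) ≤ L := by positivity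
      have h1 : (Ψ.numParams : ℝ) ≤ 1487 * L + 5000 * L * m₀ := by exact_mod_cast hΨ
      have h2 : (L : ℝ) * m₀ ≤ L * (R + 1) := mul_le_mul_of_nonneg_left hm₀' hL'
      have h3 : (L : ℝ) * (1 / 2) ≤ L * R := mul_le_mul_of_nonneg_left hR2 hL'
      nlinarith
    · intro y hy f hf hM u κh out v hu
      -- This is where `ε ≤ 1 / 2` and the third power of the rate are used.
      have hε3 : min ε (ε ^ 3) ≤ ε / 4 := by
        refine (min_le_right _ _).trans ?_
        nlinarith [mul_nonneg hε.le (mul_nonneg (sub_nonneg.2 hε') (add_nonneg hε.le one_half_pos.le))]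
      have hq : 0 ≤ G.energyNorm κh u := Real.sqrt_nonneg _
      set w := (G.relaxRun κh ω (G.rhs f))^[m₀] 0
      have hw : G.energyNorm κh (w - u) ≤ ε / 4 * G.energyNorm κh u := by
        rw [LocalGrid.energyNorm_sub_comm]
        exact (hconv y hy _ u hu ε hε m₀ (hR ▸ hm₀)).trans (mul_le_mul_of_nonneg_right hε3 hq)
      have hout : G.energyNorm κh (out - w) ≤ ε / 4 := by
        refine (LocalGrid.energyNorm_le_of_abs_le (hA y hy) hcmax.le hη.le
          (happ y hy f hf hM)).trans ?_
        change ε / 4 / (K + 1) * K ≤ ε / 4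
        rw [div_mul_eq_mul_div, div_le_iff₀ (by positivity)]
        nlinarith
      have htri : G.energyNorm κh (out - u) ≤ ε / 4 + ε / 4 * G.energyNorm κh u :=
        (LocalGrid.energyNorm_sub_le (hA y hy) out w u).trans (add_le_add hout hw)
      have hεq : 0 ≤ ε * G.energyNorm κh u := mul_nonneg hε.le hq
      refine ⟨by linarith, fun hG => ⟨LocalGrid.energyNorm_sub_le (hA y hy) out v u, ?_⟩⟩
      have hv : G.energyNorm κh (u - v) ≤ ε / 4 * G.energyNorm κh u := by
        have hv' : v = (G.relaxRun κh ω (G.rhs f))^[m] 0 :=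
          LocalGrid.llmgIter_eq hN hL (continuous_interpolate hN _ _) hG ω _ m
        rw [hv']
        exact (hconv y hy _ u hu ε hε m hm).trans (mul_le_mul_of_nonneg_right hε3 hq)
      -- The network follows `m₀` runs and `v` comes from `m` runs, so they are compared through
      -- `u`. Altogether the error is at most `ε / 4 + 3 ε / 4` times the energy norm of `u`, the
      -- first term being without that factor.
      have h1 := LocalGrid.energyNorm_sub_le (hA y hy) out u v
      rw [LocalGrid.energyNorm_sub_comm v u]
      linarith
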